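/- Let $\mathbb C^2=\mathbb R^4$ carry the standard symplectic form $\omega=dx_1\wedge dy_1+dx_2\wedge dy_2$, and for $a,b>0$ let $$E(a,b)=\Big\{(z,w)\in\mathbb C^2 : \frac{\pi|z|^2}{a}+\frac{\pi|w|^2}{b}<1\Big\}.$$ For a set $X\subset\mathbb C^2$ and $x\ge 1$, write $L(1,x)\hookrightarrow X$ if there is a smooth Lagrangian embedding of the torus $\mathbb T^2=\mathbb R^2/\mathbb Z^2$ into $\mathbb C^2$ with image contained in $X$ such that the image $(e_1,e_2)$ of the standard basis of $H_1(\mathbb T^2;\mathbb Z)$ satisfies $\mu(e_1)=\mu(e_2)=2$, $\Omega(e_1)=1$ and $\Omega(e_2)=x$. Here $\mu$ is the Maslov class and $\Omega$ is the area class of the torus, that is, $\Omega(e)$ is the integral over a loop in class $e$ of a primitive of $\omega$. **Theorem.** For every $x\ge 1$ and every open set $U$ containing the closure of $E(2,4)\cap\{\pi|w|^2<2\}$, we have $L(1,x)\hookrightarrow U$. **Corollary.** Let $a>2$, $b>0$, $\frac1a+\frac2b\le 1$ and $x\ge 1$. 1. If $\frac1a+\frac2b<1$ or $x<2$, then $L(1,x)\hookrightarrow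 E(a,b)$. 2. In all cases, including $\frac1a+\frac2b=1$, $L(1,x)\hookrightarrow V$ for every open set $V$ containing the closure of $E(a,b)$. -/

import Mathlib

/-- The torus `𝕋² = ℝ² / ℤ²`. -/
abbrev Torus2 : Type := UnitAddCircle × UnitAddCircle

/-- The `ℤ²`-periodic map `ℝ² → ℂ²` obtained by composing `f : 𝕋² → ℂ²` with the
quotient map `ℝ² → ℝ² / ℤ²`. As that map is a local diffeomorphism, `f` is smooth
exactly if its lift is, and the differentials of `f` are those of its lift. -/
def torusLift (f : Torus2 → ℂ × ℂ) (s : ℝ × ℝ) : ℂ × ℂ :=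
  f ((s.1 : UnitAddCircle), (s.2 : UnitAddCircle))

/-- The standard symplectic form `dx₁ ∧ dy₁ + dx₂ ∧ dy₂` on `ℂ² = ℝ⁴`, where
`zⱼ = xⱼ + i yⱼ`. -/
def omegaStd (u v : ℂ × ℂ) : ℝ :=
  (u.1.re * v.1.im - u.1.im * v.1.re) + (u.2.re * v.2.im - u.2.im * v.2.re)

/-- The Liouville form `- y₁ dx₁ - y₂ dx₂` at the point `p`, evaluated on `v`. The sign
makes it a primitive of `dx₁ ∧ dy₁ + dx₂ ∧ dy₂`. -/
def liouvilleStd (p v : ℂ × ℂ) : ℝ :=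
  -(p.1.im * v.1.re) - p.2.im * v.2.re

/-- `dλ = ω`: since `λ` has coefficients linear in the point, `dλ (u, v)` is
`λ_u (v) - λ_v (u)`. -/
theorem liouvilleStd_sub (u v : ℂ × ℂ) :
    liouvilleStd u v - liouvilleStd v u = omegaStd u v := by
  unfold liouvilleStd omegaStd
  ring

/-- `f : 𝕋² → ℂ²` is a (smooth) Lagrangian embedding: a smooth injective immersion,
which is an embedding because `𝕋²` is compact, that pulls `ω` back to zero. -/
structure IsLagrangianEmbedding (f : Torus2 → ℂ × ℂ) : Prop where
  smooth : ContDiff ℝ (⊤ : ℕ∞) (torusLift f)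
  injective : Function.Injective f
  immersion : ∀ s : ℝ × ℝ, Function.Injective (fderiv ℝ (torusLift f) s)
  isotropic : ∀ s u v : ℝ × ℝ,
    omegaStd (fderiv ℝ (torusLift f) s u) (fderiv ℝ (torusLift f) s v) = 0

/-- The linear path in `ℝ²` whose image in `𝕋²` is a loop representing the class
`k ∈ ℤ² = H₁(𝕋², ℤ)`; the standard basis is `(1, 0)`, `(0, 1)`. -/
def torusLoop (k : ℤ × ℤ) (t : ℝ) : ℝ × ℝ := (k.1 * t, k.2 * t)

/-- The value of the area class `Ω` on `f_* k`: the integral of the Liouville form over the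
loop `f ∘ k` (equivalently the symplectic area of any disc bounded by that loop). -/
noncomputable def areaClass (f : Torus2 → ℂ × ℂ) (k : ℤ × ℤ) : ℝ :=
  ∫ t in (0 : ℝ)..1,
    liouvilleStd (torusLift f (torusLoop k t)) (deriv (fun τ => torusLift f (torusLoop k τ)) t)

/-- The complex determinant of two vectors of `ℂ²`. -/
def complexDet (u v : ℂ × ℂ) : ℂ := u.1 * v.2 - u.2 * v.1

/-- The loop `Λ t`, `0 ≤ t ≤ 1`, of Lagrangian planes in `ℂ²` has Maslov index `n`:
for a continuous frame `u t, v t` of `Λ t`, the phase `(det / |det|)²`, which does not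
depend on the frame, has winding number `n`, as measured by a continuous argument `θ`. -/
def HasMaslovIndex (Λ : ℝ → Submodule ℝ (ℂ × ℂ)) (n : ℤ) : Prop :=
  ∃ (u v : ℝ → ℂ × ℂ) (θ : ℝ → ℝ),
    Continuous u ∧ Continuous v ∧ Continuous θ ∧
    (∀ t, Λ t = Submodule.span ℝ {u t, v t}) ∧
    (∀ t, complexDet (u t) (v t) ≠ 0) ∧
    (∀ t, complexDet (u t) (v t) ^ 2 =
      (‖complexDet (u t) (v t)‖ : ℂ) ^ 2 * Complex.exp (θ t * Complex.I)) ∧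
    θ 1 - θ 0 = 2 * Real.pi * n

/-- The tangent plane, at the image of `s`, of the immersed torus parametrised by `f`. -/
noncomputable def tangentPlane (f : Torus2 → ℂ × ℂ) (s : ℝ × ℝ) : Submodule ℝ (ℂ × ℂ) :=
  LinearMap.range (fderiv ℝ (torusLift f) s : ℝ × ℝ →ₗ[ℝ] ℂ × ℂ)

/-- The Maslov class `μ` takes the value `n` on `f_* k`. -/
def MaslovClassEq (f : Torus2 → ℂ × ℂ) (k : ℤ × ℤ) (n : ℤ) : Prop :=
  HasMaslovIndex (fun t => tangentPlane f (torusLoop k t)) n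

/-- `L(w₁, w₂) ↪ X`: there is a Lagrangian embedding of `𝕋²` with image in `X` for which
the image `(e₁, e₂)` of the standard basis of `H₁(𝕋², ℤ)` satisfies `μ(e₁) = μ(e₂) = 2`,
`Ω(e₁) = w₁` and `Ω(e₂) = w₂`. -/
def LagrangianTorusEmbeds (w₁ w₂ : ℝ) (X : Set (ℂ × ℂ)) : Prop :=
  ∃ f : Torus2 → ℂ × ℂ, IsLagrangianEmbedding f ∧ Set.range f ⊆ X ∧
    MaslovClassEq f (1, 0) 2 ∧ MaslovClassEq f (0, 1) 2 ∧
    areaClass f (1, 0) = w₁ ∧ areaClass f (0, 1) = w₂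

/-- The open symplectic ellipsoid `E(a, b)` (for positive `a` and `b`). -/
def ellipsoid (a b : ℝ) : Set (ℂ × ℂ) :=
  {p | Real.pi * ‖p.1‖ ^ 2 / a + Real.pi * ‖p.2‖ ^ 2 / b < 1}

/-! In the coordinates `Z = π|z|²`, `θ = arg z / 2π`, `W = π|w|²`, `φ = arg w / 2π`, the form is `dZ
∧ dθ + dW ∧ dφ`. For `x = 1 + y > 1` the torus is fibred by nearly rectangular curves of area 1 in
the `z`-annulus, lying over an immersed closed curve in the `w`-annulus.

The base curve has rotation number `n + 1` and runs almost `n + 1` times around a rectangle of width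
`2A` in `W` and height `2B ≈ 1/2` in `φ`. It therefore has area about `4AB(n + 1)`, which is set to
`n + 1 + y`. Subtracting `n` fibre classes from the base class leaves area `1 + y`, and rotation
number `(n + 1) - n = 1`, hence Maslov number 2. As `n` grows the excess `y` is spread over more
turns: `A ≈ 1 + y/(n + 1)` tends to 1, so the size of the torus does not depend on `x` in the limit.

The base curve is a spiral whose inner end is joined to its outer end by a segment through the disc.
This segment crosses the other strands, and the double points must be removed. Over a "column",
consisting of the segment and the adjacent outer arc, the fibre is translated in the `Z`-direction
by `R`. The torus stays Lagrangian if `φ` is sheared by `κ(η - η(0))` with `R' = -κu'`. Taking `κ =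
1/2`, up to smoothing, gives `R ≈ (2A - W)/2`: zero at the far side `W ≈ 2A`, and at least `A` near
`W = 0`, where the crossings lie. The fibre is narrower than `A`, so the lifted fibres miss the
others. The fibre has height `4B` in `θ`, so the shear moves `φ` by at most `2B`, which keeps the
column clear of the other strands elsewhere.

Finally `Z ≤ 1 + R` and `R + W/2 ≤ A`, approximately, give `Z/2 + W/4 ≤ 1` and `W ≤ 2` up to a small
error, which is the truncated ellipsoid. The Lagrangian, Maslov and area computations are made for
an abstract `Suspension`; the embedding rests on `exists_eq_add_int_mul_pi`, the size on
`shift_add_baseU_le`, and the choice of constants on `exists_parameters`. For `x = 1`, and for `x <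
2` in the corollary, a product of circles suffices. -/

/-! ### Symplectic polar coordinates -/

/-- Symplectic polar coordinates on `ℂ`: `Z = π |z|²` and `θ = arg z / 2π`. -/
noncomputable def polarPoint (Z θ : ℝ) : ℂ :=
  (Real.sqrt (Z / Real.pi) : ℂ) * Complex.exp ((2 * Real.pi * θ : ℝ) * Complex.I)

theorem norm_polarPoint (Z θ : ℝ) : ‖polarPoint Z θ‖ = Real.sqrt (Z / Real.pi) := by
  unfold polarPoint
  rw [norm_mul, Complex.norm_exp_ofReal_mul_I, mul_one, Complex.norm_real,
    Real.norm_of_nonneg (Real.sqrt_nonneg _)]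

theorem pi_mul_norm_polarPoint_sq {Z : ℝ} (hZ : 0 ≤ Z) (θ : ℝ) :
    Real.pi * ‖polarPoint Z θ‖ ^ 2 = Z := by
  rw [norm_polarPoint, Real.sq_sqrt (by positivity)]
  field_simp

theorem polarPoint_ne_zero {Z : ℝ} (hZ : 0 < Z) (θ : ℝ) : polarPoint Z θ ≠ 0 := by
  have h := pi_mul_norm_polarPoint_sq hZ.le θ
  intro h0
  rw [h0] at h
  simp at h
  linarith

theorem polarPoint_add_int (Z θ : ℝ) (k : ℤ) : polarPoint Z (θ + k) = polarPoint Z θ := by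
  unfold polarPoint
  congr 1
  rw [Complex.exp_eq_exp_iff_exists_int]
  exact ⟨k, by push_cast; ring⟩

theorem polarPoint_injective {Z Z' θ θ' : ℝ} (hZ : 0 < Z) (hZ' : 0 < Z')
    (h : polarPoint Z θ = polarPoint Z' θ') : Z = Z' ∧ ∃ k : ℤ, θ = θ' + k := by
  have h1 : Z = Z' := by
    rw [← pi_mul_norm_polarPoint_sq hZ.le θ, h, pi_mul_norm_polarPoint_sq hZ'.le θ']
  refine ⟨h1, ?_⟩
  subst h1
  unfold polarPoint at h
  have h2 : (Real.sqrt (Z / Real.pi) : ℂ) ≠ 0 := by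
    have : 0 < Real.sqrt (Z / Real.pi) := Real.sqrt_pos.2 (by positivity)
    exact_mod_cast this.ne'
  have h3 := mul_left_cancel₀ h2 h
  rw [Complex.exp_eq_exp_iff_exists_int] at h3
  obtain ⟨k, hk⟩ := h3
  refine ⟨k, ?_⟩
  have h4 := congrArg Complex.im hk
  simp at h4
  have := Real.pi_pos
  have h5 : (2 * Real.pi) * θ = (2 * Real.pi) * (θ' + k) := by linarith
  exact mul_left_cancel₀ (by positivity) h5

theorem hasFDerivAt_polarPoint {V : Type*} [NormedAddCommGroup V] [NormedSpace ℝ V]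
    {Z θ : V → ℝ} {Z' θ' : V →L[ℝ] ℝ} {p : V} (hZ : HasFDerivAt Z Z' p)
    (hθ : HasFDerivAt θ θ' p) (h0 : 0 < Z p) :
    ∃ L : V →L[ℝ] ℂ, HasFDerivAt (fun q => polarPoint (Z q) (θ q)) L p ∧
      ∀ v, L v = polarPoint (Z p) (θ p) *
        (((Z' v / (2 * Z p) : ℝ) : ℂ) + (2 * Real.pi * θ' v : ℝ) * Complex.I) := by
  have hpi := Real.pi_pos
  have hZ1 : HasFDerivAt (fun q => Z q / Real.pi) (Real.pi⁻¹ • Z') p := by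
    simpa only [div_eq_mul_inv] using hZ.mul_const Real.pi⁻¹
  have h1 := hZ1.sqrt (by positivity)
  have h2 := Complex.ofRealCLM.hasFDerivAt.comp p h1
  have h3 := (Complex.ofRealCLM.hasFDerivAt.comp p (hθ.const_mul (2 * Real.pi))).mul_const
    Complex.I
  have h4 := h2.mul h3.cexp
  refine ⟨_, h4, fun v => ?_⟩
  have hs : Real.sqrt (Z p / Real.pi) ≠ 0 := (Real.sqrt_pos.2 (by positivity)).ne'
  have hss : Real.sqrt (Z p / Real.pi) ^ 2 = Z p / Real.pi := Real.sq_sqrt (by positivity)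
  have key : (1 / (2 * Real.sqrt (Z p / Real.pi))) * (Real.pi⁻¹ * Z' v) =
      Real.sqrt (Z p / Real.pi) * (Z' v / (2 * Z p)) := by
    have : Z p = Real.pi * Real.sqrt (Z p / Real.pi) ^ 2 := by rw [hss]; field_simp
    generalize Real.sqrt (Z p / Real.pi) = q at *
    rw [this]
    field_simp
  simp [polarPoint] at *
  have key' := congrArg (fun r : ℝ => (r : ℂ)) key
  push_cast at key'
  linear_combination (Complex.exp (2 * Real.pi * θ p * Complex.I)) * key'

/-- The map into `ℂ²` with symplectic polar coordinates `(Z, θ)`, `(W, φ)`. -/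
noncomputable def toricMap {V : Type*} (Z θ W φ : V → ℝ) (p : V) : ℂ × ℂ :=
  (polarPoint (Z p) (θ p), polarPoint (W p) (φ p))

section toric

variable {V : Type*} [NormedAddCommGroup V] [NormedSpace ℝ V] {Z θ W φ : V → ℝ}

theorem contDiff_polarPoint (hZ : ContDiff ℝ (⊤ : ℕ∞) Z) (hθ : ContDiff ℝ (⊤ : ℕ∞) θ)
    (h0 : ∀ p, 0 < Z p) : ContDiff ℝ (⊤ : ℕ∞) (fun p => polarPoint (Z p) (θ p)) := by
  have hpi := Real.pi_pos
  unfold polarPoint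
  refine ContDiff.mul ?_ (ContDiff.cexp ?_)
  · exact Complex.ofRealCLM.contDiff.comp
      ((hZ.div_const Real.pi).sqrt fun p => (div_pos (h0 p) hpi).ne')
  · exact (Complex.ofRealCLM.contDiff.comp (contDiff_const.mul hθ)).mul contDiff_const

theorem contDiff_toricMap (hZ : ContDiff ℝ (⊤ : ℕ∞) Z) (hθ : ContDiff ℝ (⊤ : ℕ∞) θ)
    (hW : ContDiff ℝ (⊤ : ℕ∞) W) (hφ : ContDiff ℝ (⊤ : ℕ∞) φ) (hZ0 : ∀ p, 0 < Z p)
    (hW0 : ∀ p, 0 < W p) : ContDiff ℝ (⊤ : ℕ∞) (toricMap Z θ W φ) :=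
  (contDiff_polarPoint hZ hθ hZ0).prodMk (contDiff_polarPoint hW hφ hW0)

theorem fderiv_toricMap {p : V} (hZ : DifferentiableAt ℝ Z p) (hθ : DifferentiableAt ℝ θ p)
    (hW : DifferentiableAt ℝ W p) (hφ : DifferentiableAt ℝ φ p) (hZ0 : 0 < Z p)
    (hW0 : 0 < W p) (v : V) :
    fderiv ℝ (toricMap Z θ W φ) p v =
      (polarPoint (Z p) (θ p) * (((fderiv ℝ Z p v / (2 * Z p) : ℝ) : ℂ) +
          (2 * Real.pi * fderiv ℝ θ p v : ℝ) * Complex.I),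
        polarPoint (W p) (φ p) * (((fderiv ℝ W p v / (2 * W p) : ℝ) : ℂ) +
          (2 * Real.pi * fderiv ℝ φ p v : ℝ) * Complex.I)) := by
  obtain ⟨L, hL, hLv⟩ := hasFDerivAt_polarPoint hZ.hasFDerivAt hθ.hasFDerivAt hZ0
  obtain ⟨M, hM, hMv⟩ := hasFDerivAt_polarPoint hW.hasFDerivAt hφ.hasFDerivAt hW0
  have h : HasFDerivAt (toricMap Z θ W φ) (L.prod M) p := hL.prodMk hM
  rw [h.fderiv, ContinuousLinearMap.prod_apply, hLv, hMv]

/-- A tangent vector is `z` times its logarithmic derivative, so the area of two of them is `|z|²`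
times the area of the logarithmic derivatives. This is the identity `dx ∧ dy = dZ ∧ dθ`. -/
theorem area_polarPoint {Z : ℝ} (hZ : 0 < Z) (θ a b c d : ℝ) :
    (polarPoint Z θ * (((a / (2 * Z) : ℝ) : ℂ) + (2 * Real.pi * b : ℝ) * Complex.I)).re *
        (polarPoint Z θ * (((c / (2 * Z) : ℝ) : ℂ) + (2 * Real.pi * d : ℝ) * Complex.I)).im -
      (polarPoint Z θ * (((a / (2 * Z) : ℝ) : ℂ) + (2 * Real.pi * b : ℝ) * Complex.I)).im *
        (polarPoint Z θ * (((c / (2 * Z) : ℝ) : ℂ) + (2 * Real.pi * d : ℝ) * Complex.I)).re =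
      a * d - b * c := by
  have h := pi_mul_norm_polarPoint_sq hZ.le θ
  rw [← Complex.normSq_eq_norm_sq, Complex.normSq_apply] at h
  generalize polarPoint Z θ = z at *
  simp only [Complex.mul_re, Complex.mul_im, Complex.add_re, Complex.add_im, Complex.ofReal_re,
    Complex.ofReal_im, Complex.I_re, Complex.I_im]
  have hpi := Real.pi_pos
  rw [← h] at hZ ⊢
  have h0 : 0 < z.re * z.re + z.im * z.im := pos_of_mul_pos_right hZ hpi.le
  have h1 : ∀ x : ℝ, x / (2 * (Real.pi * (z.re * z.re + z.im * z.im))) *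
      (2 * Real.pi * (z.re * z.re + z.im * z.im)) = x := by
    intro x
    rw [mul_assoc 2 Real.pi, div_mul_cancel₀]
    positivity
  linear_combination d * h1 a - b * h1 c

theorem omegaStd_fderiv_toricMap {p : V} (hZ : DifferentiableAt ℝ Z p)
    (hθ : DifferentiableAt ℝ θ p) (hW : DifferentiableAt ℝ W p) (hφ : DifferentiableAt ℝ φ p)
    (hZ0 : 0 < Z p) (hW0 : 0 < W p) (v w : V) :
    omegaStd (fderiv ℝ (toricMap Z θ W φ) p v) (fderiv ℝ (toricMap Z θ W φ) p w) =
      (fderiv ℝ Z p v * fderiv ℝ θ p w - fderiv ℝ θ p v * fderiv ℝ Z p w) +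
      (fderiv ℝ W p v * fderiv ℝ φ p w - fderiv ℝ φ p v * fderiv ℝ W p w) := by
  rw [fderiv_toricMap hZ hθ hW hφ hZ0 hW0, fderiv_toricMap hZ hθ hW hφ hZ0 hW0]
  unfold omegaStd
  rw [area_polarPoint hZ0, area_polarPoint hW0]

end toric

/-- The primitives `-y dx` and `Z dθ = (x dy - y dx)/2` differ by the exact form `d(xy)/2`, which
integrates to zero over loops. -/
theorem liouville_polarPoint {Z : ℝ} (hZ : 0 < Z) (θ a b : ℝ) :
    -((polarPoint Z θ).im *
        (polarPoint Z θ * (((a / (2 * Z) : ℝ) : ℂ) + (2 * Real.pi * b : ℝ) * Complex.I)).re) =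
      Z * b - ((polarPoint Z θ *
        (((a / (2 * Z) : ℝ) : ℂ) + (2 * Real.pi * b : ℝ) * Complex.I)).re * (polarPoint Z θ).im +
        (polarPoint Z θ).re * (polarPoint Z θ *
        (((a / (2 * Z) : ℝ) : ℂ) + (2 * Real.pi * b : ℝ) * Complex.I)).im) / 2 := by
  have h := pi_mul_norm_polarPoint_sq hZ.le θ
  rw [← Complex.normSq_eq_norm_sq, Complex.normSq_apply] at h
  generalize polarPoint Z θ = z at *
  simp only [Complex.mul_re, Complex.mul_im, Complex.add_re, Complex.add_im, Complex.ofReal_re,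
    Complex.ofReal_im, Complex.I_re, Complex.I_im]
  linear_combination b * h

/-- The area of a loop in symplectic polar coordinates. -/
theorem integral_liouvilleStd_toricMap {Z θ W φ : ℝ → ℝ} (hZ : ContDiff ℝ (⊤ : ℕ∞) Z)
    (hθ : ContDiff ℝ (⊤ : ℕ∞) θ) (hW : ContDiff ℝ (⊤ : ℕ∞) W) (hφ : ContDiff ℝ (⊤ : ℕ∞) φ)
    (hZ0 : ∀ p, 0 < Z p) (hW0 : ∀ p, 0 < W p)
    (hper : toricMap Z θ W φ 1 = toricMap Z θ W φ 0) :
    ∫ t in (0 : ℝ)..1, liouvilleStd (toricMap Z θ W φ t) (deriv (toricMap Z θ W φ) t) =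
      ∫ t in (0 : ℝ)..1, (Z t * deriv θ t + W t * deriv φ t) := by
  have hc := contDiff_toricMap hZ hθ hW hφ hZ0 hW0
  have hne : ((⊤ : ℕ∞) : WithTop ℕ∞) ≠ 0 := by simp
  set c := toricMap Z θ W φ with hcdef
  let G : ℝ → ℝ := fun t => ((c t).1.re * (c t).1.im + (c t).2.re * (c t).2.im) / 2
  let G' : ℝ → ℝ := fun t => (((deriv c t).1.re * (c t).1.im + (c t).1.re * (deriv c t).1.im) +
    ((deriv c t).2.re * (c t).2.im + (c t).2.re * (deriv c t).2.im)) / 2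
  have hG : ∀ t, HasDerivAt G (G' t) t := by
    intro t
    have h := (hc.differentiable hne t).hasDerivAt
    have h1 : HasDerivAt (fun τ => (c τ).1) (deriv c t).1 t := h.fst
    have h2 : HasDerivAt (fun τ => (c τ).2) (deriv c t).2 t := h.snd
    have re : ∀ {f : ℝ → ℂ} {f' : ℂ}, HasDerivAt f f' t → HasDerivAt (fun τ => (f τ).re) f'.re t :=
      fun hf => Complex.reCLM.hasFDerivAt.comp_hasDerivAt t hf
    have im : ∀ {f : ℝ → ℂ} {f' : ℂ}, HasDerivAt f f' t → HasDerivAt (fun τ => (f τ).im) f'.im t :=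
      fun hf => Complex.imCLM.hasFDerivAt.comp_hasDerivAt t hf
    exact (((re h1).mul (im h1)).add ((re h2).mul (im h2))).div_const 2
  have hdc : Continuous (deriv c) := hc.continuous_deriv (by simp)
  have hcc : Continuous c := hc.continuous
  have hG'c : Continuous G' := by fun_prop
  have hpt : ∀ t, liouvilleStd (c t) (deriv c t) =
      (Z t * deriv θ t + W t * deriv φ t) - G' t := by
    intro t
    have hd : deriv c t = _ := (fderiv_apply_one_eq_deriv (f := c) (x := t)).symm.trans
      (fderiv_toricMap (hZ.differentiable hne t) (hθ.differentiable hne t)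
        (hW.differentiable hne t) (hφ.differentiable hne t) (hZ0 t) (hW0 t) 1)
    simp only [fderiv_apply_one_eq_deriv] at hd
    have e1 := liouville_polarPoint (hZ0 t) (θ t) (deriv Z t) (deriv θ t)
    have e2 := liouville_polarPoint (hW0 t) (φ t) (deriv W t) (deriv φ t)
    simp only [G', liouvilleStd, hd]
    simp only [hcdef, toricMap]
    linarith
  simp_rw [hpt]
  have hZc : Continuous fun t => Z t * deriv θ t + W t * deriv φ t :=
    (hZ.continuous.mul (hθ.continuous_deriv (by simp))).add
      (hW.continuous.mul (hφ.continuous_deriv (by simp)))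
  rw [intervalIntegral.integral_sub (hZc.intervalIntegrable _ _) (hG'c.intervalIntegrable _ _),
    intervalIntegral.integral_eq_sub_of_hasDerivAt (fun t _ => hG t)
      (hG'c.intervalIntegrable _ _)]
  have : G 1 = G 0 := by simp only [G]; rw [hper]
  rw [this]; ring

/-! ### Tori from periodic maps -/

/-- The function on the torus with a given lift. -/
noncomputable def torusDescend (F : ℝ × ℝ → ℂ × ℂ) (p : Torus2) : ℂ × ℂ :=
  F (Quotient.out p.1, Quotient.out p.2)

theorem unitAddCircle_coe_eq_iff {a b : ℝ} :
    (a : UnitAddCircle) = b ↔ ∃ k : ℤ, a = b + k := by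
  rw [← sub_eq_zero, ← AddCircle.coe_sub, AddCircle.coe_eq_zero_iff]
  refine exists_congr fun k => ?_
  rw [zsmul_one, eq_sub_iff_add_eq', eq_comm]

theorem coe_out_unitAddCircle (a : UnitAddCircle) : ((Quotient.out a : ℝ) : UnitAddCircle) = a :=
  Quotient.out_eq a

theorem torusLift_torusDescend {F : ℝ × ℝ → ℂ × ℂ}
    (hF : ∀ s t : ℝ, ∀ k l : ℤ, F (s + k, t + l) = F (s, t)) :
    torusLift (torusDescend F) = F := by
  funext ⟨s, t⟩
  obtain ⟨k, hk⟩ := unitAddCircle_coe_eq_iff.1 (coe_out_unitAddCircle (s : UnitAddCircle))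
  obtain ⟨l, hl⟩ := unitAddCircle_coe_eq_iff.1 (coe_out_unitAddCircle (t : UnitAddCircle))
  unfold torusLift torusDescend
  simp only [hk, hl, hF]

theorem isLagrangianEmbedding_torusDescend {F : ℝ × ℝ → ℂ × ℂ}
    (hper : ∀ s t : ℝ, ∀ k l : ℤ, F (s + k, t + l) = F (s, t))
    (hF : ContDiff ℝ (⊤ : ℕ∞) F)
    (hinj : ∀ s t s' t' : ℝ, F (s, t) = F (s', t') →
      (∃ k : ℤ, s = s' + k) ∧ ∃ l : ℤ, t = t' + l)
    (himm : ∀ p v : ℝ × ℝ, fderiv ℝ F p v = 0 → v = 0)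
    (hiso : ∀ p u v : ℝ × ℝ, omegaStd (fderiv ℝ F p u) (fderiv ℝ F p v) = 0) :
    IsLagrangianEmbedding (torusDescend F) where
  smooth := by rw [torusLift_torusDescend hper]; exact hF
  injective := by
    rintro ⟨a, b⟩ ⟨a', b'⟩ h
    obtain ⟨h1, h2⟩ := hinj _ _ _ _ h
    have e1 := unitAddCircle_coe_eq_iff.2 h1
    have e2 := unitAddCircle_coe_eq_iff.2 h2
    simp only [coe_out_unitAddCircle] at e1 e2
    rw [e1, e2]
  immersion := by
    intro s
    rw [torusLift_torusDescend hper]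
    exact (injective_iff_map_eq_zero _).2 fun v hv => himm s v hv
  isotropic := by rw [torusLift_torusDescend hper]; exact hiso

/-! ### Winding numbers and the Maslov index -/

/-- The loop `D` in `ℂ ∖ 0` has winding number `n` over `[0, 1]`. -/
def HasWinding (D : ℝ → ℂ) (n : ℤ) : Prop :=
  ∃ α : ℝ → ℝ, Continuous α ∧ (∀ t, D t ≠ 0 ∧ D t = ‖D t‖ * Complex.exp (α t * Complex.I)) ∧
    α 1 - α 0 = 2 * Real.pi * n

theorem HasWinding.ne_zero {D : ℝ → ℂ} {n : ℤ} (h : HasWinding D n) (t : ℝ) : D t ≠ 0 := by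
  obtain ⟨α, -, h, -⟩ := h
  exact (h t).1

theorem HasWinding.mul {D E : ℝ → ℂ} {m n : ℤ} (hD : HasWinding D m) (hE : HasWinding E n) :
    HasWinding (fun t => D t * E t) (m + n) := by
  obtain ⟨α, hα, h1, h2⟩ := hD
  obtain ⟨β, hβ, h3, h4⟩ := hE
  refine ⟨fun t => α t + β t, hα.add hβ, fun t => ⟨mul_ne_zero (h1 t).1 (h3 t).1, ?_⟩, ?_⟩
  · beta_reduce
    conv_lhs => rw [(h1 t).2, (h3 t).2]
    rw [norm_mul]
    push_cast
    rw [add_mul, Complex.exp_add]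
    ring
  · push_cast
    linarith

theorem hasWinding_const {z : ℂ} (hz : z ≠ 0) : HasWinding (fun _ => z) 0 :=
  ⟨fun _ => Complex.arg z, continuous_const,
    fun _ => ⟨hz, (Complex.norm_mul_exp_arg_mul_I z).symm⟩, by simp⟩

theorem hasWinding_polarPoint {Z θ : ℝ → ℝ} (hZ : ∀ t, 0 < Z t) (hθ : Continuous θ) {n : ℤ}
    (hn : θ 1 - θ 0 = n) : HasWinding (fun t => polarPoint (Z t) (θ t)) n := by
  refine ⟨fun t => 2 * Real.pi * θ t, by fun_prop,
    fun t => ⟨polarPoint_ne_zero (hZ t) _, ?_⟩, by rw [← hn]; ring⟩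
  rw [norm_polarPoint]
  rfl

/-- The factor by which the direction of `exp (iα)` changes if its real part is multiplied by `a`
and its imaginary part by `b`. -/
noncomputable def rescaleFactor (a b α : ℝ) : ℂ :=
  (((a * Real.cos α : ℝ) : ℂ) + (b * Real.sin α : ℝ) * Complex.I) *
    Complex.exp ((-α : ℝ) * Complex.I)

/-- The real part is `a cos² α + b sin² α > 0`: a positive diagonal map turns no vector by a right
angle or more. Hence the change of argument is the principal one and is continuous. -/
theorem rescaleFactor_mem_slitPlane {a b : ℝ} (ha : 0 < a) (hb : 0 < b) (α : ℝ) :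
    rescaleFactor a b α ∈ Complex.slitPlane := by
  left
  simp only [rescaleFactor, Complex.mul_re, Complex.add_re, Complex.add_im, Complex.ofReal_re,
    Complex.ofReal_im, Complex.mul_im, Complex.I_re, Complex.I_im, Complex.exp_ofReal_mul_I_re,
    Complex.exp_ofReal_mul_I_im, Real.cos_neg, Real.sin_neg]
  have := Real.sin_sq_add_cos_sq α
  by_cases hc : Real.cos α = 0
  · rw [hc] at this ⊢
    have : Real.sin α ^ 2 = 1 := by linarith
    nlinarith
  · have : 0 < Real.cos α ^ 2 := by positivity
    nlinarith [mul_pos ha this, mul_nonneg hb.le (sq_nonneg (Real.sin α))]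

theorem rescaleFactor_mul_exp (a b α : ℝ) :
    rescaleFactor a b α * Complex.exp (α * Complex.I) =
      ((a * Real.cos α : ℝ) : ℂ) + (b * Real.sin α : ℝ) * Complex.I := by
  rw [rescaleFactor, mul_assoc, ← Complex.exp_add]
  simp

theorem rescaleFactor_add_int (a b α : ℝ) (n : ℤ) :
    rescaleFactor a b (α + n * (2 * Real.pi)) = rescaleFactor a b α := by
  unfold rescaleFactor
  rw [Real.cos_add_int_mul_two_pi, Real.sin_add_int_mul_two_pi]
  congr 1
  rw [Complex.exp_eq_exp_iff_exists_int]
  exact ⟨-n, by push_cast; ring⟩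

theorem rescale_eq {a b : ℝ} (ha : 0 < a) (hb : 0 < b) (α : ℝ) {ρ : ℝ} (hρ : 0 < ρ) :
    ((a * (ρ * Real.cos α) : ℝ) : ℂ) + (b * (ρ * Real.sin α) : ℝ) * Complex.I ≠ 0 ∧
    ((a * (ρ * Real.cos α) : ℝ) : ℂ) + (b * (ρ * Real.sin α) : ℝ) * Complex.I =
      ‖((a * (ρ * Real.cos α) : ℝ) : ℂ) + (b * (ρ * Real.sin α) : ℝ) * Complex.I‖ *
        Complex.exp ((α + Complex.arg (rescaleFactor a b α) : ℝ) * Complex.I) := by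
  have e : ((a * (ρ * Real.cos α) : ℝ) : ℂ) + (b * (ρ * Real.sin α) : ℝ) * Complex.I =
      ρ * (rescaleFactor a b α * Complex.exp (α * Complex.I)) := by
    rw [rescaleFactor_mul_exp]; push_cast; ring
  have hw : rescaleFactor a b α ≠ 0 :=
    Complex.slitPlane_ne_zero (rescaleFactor_mem_slitPlane ha hb α)
  rw [e]
  refine ⟨mul_ne_zero (by exact_mod_cast hρ.ne') (mul_ne_zero hw (Complex.exp_ne_zero _)), ?_⟩
  rw [norm_mul, norm_mul, Complex.norm_exp_ofReal_mul_I, Complex.norm_real,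
    Real.norm_of_nonneg hρ.le, mul_one]
  conv_lhs => rw [← Complex.norm_mul_exp_arg_mul_I (rescaleFactor a b α)]
  push_cast
  rw [add_mul, Complex.exp_add]
  ring

theorem continuous_arg_rescaleFactor {a b α : ℝ → ℝ} (ha : Continuous a) (hb : Continuous b)
    (hα : Continuous α) (ha0 : ∀ t, 0 < a t) (hb0 : ∀ t, 0 < b t) :
    Continuous fun t => Complex.arg (rescaleFactor (a t) (b t) (α t)) := by
  have hc : Continuous fun t => rescaleFactor (a t) (b t) (α t) := by
    unfold rescaleFactor; fun_prop
  refine continuous_iff_continuousAt.2 fun t => ?_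
  have h1 := Complex.continuousAt_arg (rescaleFactor_mem_slitPlane (ha0 t) (hb0 t) (α t))
  exact ContinuousAt.comp (f := fun t => rescaleFactor (a t) (b t) (α t)) h1 hc.continuousAt

/-- A vector field obtained from `D` by rescaling its two components positively has the same
winding number. -/
theorem HasWinding.rescale {D : ℝ → ℂ} {n : ℤ} (hD : HasWinding D n) {a b : ℝ → ℝ}
    (ha : Continuous a) (hb : Continuous b) (ha0 : ∀ t, 0 < a t) (hb0 : ∀ t, 0 < b t)
    (ha1 : a 1 = a 0) (hb1 : b 1 = b 0) :
    HasWinding (fun t => ((a t * (D t).re : ℝ) : ℂ) + (b t * (D t).im : ℝ) * Complex.I) n := by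
  obtain ⟨α, hα, h1, h2⟩ := hD
  refine ⟨fun t => α t + Complex.arg (rescaleFactor (a t) (b t) (α t)),
    hα.add (continuous_arg_rescaleFactor ha hb hα ha0 hb0), fun t => ?_, ?_⟩
  · have e1 : (D t).re = ‖D t‖ * Real.cos (α t) := by
      conv_lhs => rw [(h1 t).2]
      rw [Complex.re_ofReal_mul, Complex.exp_ofReal_mul_I_re]
    have e2 : (D t).im = ‖D t‖ * Real.sin (α t) := by
      conv_lhs => rw [(h1 t).2]
      rw [Complex.im_ofReal_mul, Complex.exp_ofReal_mul_I_im]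
    beta_reduce
    rw [e1, e2]
    exact rescale_eq (ha0 t) (hb0 t) _ (norm_pos_iff.2 (h1 t).1)
  · have e : α 1 = α 0 + n * (2 * Real.pi) := by linarith
    simp only [ha1, hb1, e, rescaleFactor_add_int]
    ring

/-- The images of the standard basis vectors frame the tangent planes; the index is twice the
winding number because the phase is the square of the determinant. -/
theorem hasMaslovIndex_of_hasWinding {F : ℝ × ℝ → ℂ × ℂ} (hF : ContDiff ℝ (⊤ : ℕ∞) F)
    {c : ℝ → ℝ × ℝ} (hc : Continuous c) {n : ℤ}
    (hn : HasWinding (fun t => complexDet (fderiv ℝ F (c t) (1, 0)) (fderiv ℝ F (c t) (0, 1))) n) :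
    HasMaslovIndex (fun t => LinearMap.range (fderiv ℝ F (c t) : ℝ × ℝ →ₗ[ℝ] ℂ × ℂ)) (2 * n) := by
  obtain ⟨α, hα, h1, h2⟩ := hn
  have hcont : Continuous (fun t => fderiv ℝ F (c t)) :=
    (hF.continuous_fderiv (by simp)).comp hc
  refine ⟨fun t => fderiv ℝ F (c t) (1, 0), fun t => fderiv ℝ F (c t) (0, 1),
    fun t => 2 * α t, hcont.clm_apply continuous_const, hcont.clm_apply continuous_const,
    by fun_prop, fun t => ?_, fun t => (h1 t).1, fun t => ?_, ?_⟩
  · apply le_antisymm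
    · rintro _ ⟨⟨a, b⟩, rfl⟩
      rw [Submodule.mem_span_pair]
      refine ⟨a, b, ?_⟩
      rw [ContinuousLinearMap.coe_coe, ← map_smul, ← map_smul, ← map_add]
      simp
    · rw [Submodule.span_le]
      rintro _ (rfl | rfl)
      · exact ⟨(1, 0), rfl⟩
      · exact ⟨(0, 1), rfl⟩
  · have h3 := (h1 t).2
    beta_reduce at h3 ⊢
    conv_lhs => rw [h3]
    rw [mul_pow, ← Complex.exp_nat_mul]
    congr 2
    push_cast
    ring
  · push_cast
    linarith

/-! ### Suspensions over an immersed base curve -/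

/-- Data for a Lagrangian torus that fibres over a closed immersed curve `(u, φ)` of the `w`-plane,
in symplectic polar coordinates: over the point with parameter `t` lies the curve `(ξ, η)`
translated by `R t` in the first coordinate, and the point with second coordinate `η` is
displaced by `κ t * (η - η 0)`. The function `g` of degree one is used to add `m` times the fibre
class to the second generator. -/
structure Suspension where
  (ξ η u φ R κ g : ℝ → ℝ)
  m : ℤ
  N : ℤ
  β : ℝ → ℝ
  contDiff_ξ : ContDiff ℝ (⊤ : ℕ∞) ξ
  contDiff_η : ContDiff ℝ (⊤ : ℕ∞) η
  contDiff_u : ContDiff ℝ (⊤ : ℕ∞) u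
  contDiff_φ : ContDiff ℝ (⊤ : ℕ∞) φ
  contDiff_R : ContDiff ℝ (⊤ : ℕ∞) R
  contDiff_κ : ContDiff ℝ (⊤ : ℕ∞) κ
  contDiff_g : ContDiff ℝ (⊤ : ℕ∞) g
  periodic_ξ : Function.Periodic ξ 1
  periodic_η : Function.Periodic η 1
  periodic_u : Function.Periodic u 1
  periodic_φ : Function.Periodic φ 1
  periodic_R : Function.Periodic R 1
  periodic_κ : Function.Periodic κ 1
  g_add_one : ∀ t, g (t + 1) = g t + 1
  pos_ξ : ∀ s t, 0 < ξ s + R t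
  pos_u : ∀ t, 0 < u t
  -- The Lagrangian condition: it balances the terms `R' dt ∧ dη` and `κ u' dt ∧ dη`.
  rel : ∀ t, κ t * deriv u t = -deriv R t
  -- The fibre coordinate may advance only where there is neither translation nor shear. Elsewhere
  -- the second generator stays at a fibre parameter where `η = η 0` and `η' = 0`, so that the shear
  -- is invisible along it.
  flat : ∀ t, ((∃ k : ℤ, g t = k) ∧ deriv g t = 0) ∨
    (R t = 0 ∧ κ t = 0 ∧ deriv R t = 0 ∧ deriv κ t = 0)
  flat_zero : R 0 = 0 ∧ κ 0 = 0 ∧ deriv R 0 = 0 ∧ deriv κ 0 = 0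
  -- At a critical point of `u` the immersion relies on `φ'` alone, which `κ'` must not cancel.
  deriv_κ : ∀ t, deriv u t = 0 → deriv κ t = 0
  deriv_η_zero : deriv η 0 = 0
  continuous_β : Continuous β
  periodic_β : Function.Periodic β 1
  fibre : ∀ s, (((deriv ξ s : ℝ) : ℂ) + (deriv η s : ℝ) * Complex.I) ≠ 0 ∧
    (((deriv ξ s : ℝ) : ℂ) + (deriv η s : ℝ) * Complex.I) =
      ‖(((deriv ξ s : ℝ) : ℂ) + (deriv η s : ℝ) * Complex.I)‖ *
        Complex.exp ((2 * Real.pi * s + β s : ℝ) * Complex.I)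
  base : HasWinding (fun t => ((deriv u t : ℝ) : ℂ) + (deriv φ t : ℝ) * Complex.I) N
  -- The class combining `m` fibres with the base loop has total rotation number 1, hence Maslov
  -- number 2.
  sum_eq : m + N = 1
  -- Both angles vary over less than a full circle, so equality modulo 1 is equality. Moreover, as
  -- the angles are single-valued real functions, the polar factors do not wind around the origin.
  η_range : ∀ s s', |η s - η s'| < 1
  φ_range : ∀ s t s' t', |(φ t + κ t * (η s - η 0)) - (φ t' + κ t' * (η s' - η 0))| < 1
  inj : ∀ s t s' t', ξ s + R t = ξ s' + R t' → η s = η s' → u t = u t' →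
    φ t + κ t * (η s - η 0) = φ t' + κ t' * (η s' - η 0) →
      (∃ k : ℤ, s = s' + k) ∧ ∃ l : ℤ, t = t' + l
  area_fibre : ∫ s in (0 : ℝ)..1, ξ s * deriv η s = 1

namespace Suspension

variable (D : Suspension)

def S (p : ℝ × ℝ) : ℝ := p.1 + D.m * D.g p.2
def Z (p : ℝ × ℝ) : ℝ := D.ξ (D.S p) + D.R p.2
def θ (p : ℝ × ℝ) : ℝ := D.η (D.S p)
def W (p : ℝ × ℝ) : ℝ := D.u p.2
def Φ (p : ℝ × ℝ) : ℝ := D.φ p.2 + D.κ p.2 * (D.η (D.S p) - D.η 0)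

/-- The map `ℝ² → ℂ²` that parametrises the torus. -/
noncomputable def map : ℝ × ℝ → ℂ × ℂ := toricMap D.Z D.θ D.W D.Φ

theorem contDiff_S : ContDiff ℝ (⊤ : ℕ∞) D.S :=
  contDiff_fst.add (contDiff_const.mul (D.contDiff_g.comp contDiff_snd))

theorem contDiff_Z : ContDiff ℝ (⊤ : ℕ∞) D.Z :=
  (D.contDiff_ξ.comp D.contDiff_S).add (D.contDiff_R.comp contDiff_snd)

theorem contDiff_θ : ContDiff ℝ (⊤ : ℕ∞) D.θ := D.contDiff_η.comp D.contDiff_S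

theorem contDiff_W : ContDiff ℝ (⊤ : ℕ∞) D.W := D.contDiff_u.comp contDiff_snd

theorem contDiff_Φ : ContDiff ℝ (⊤ : ℕ∞) D.Φ :=
  (D.contDiff_φ.comp contDiff_snd).add
    ((D.contDiff_κ.comp contDiff_snd).mul ((D.contDiff_η.comp D.contDiff_S).sub contDiff_const))

theorem Z_pos (p : ℝ × ℝ) : 0 < D.Z p := D.pos_ξ _ _
theorem W_pos (p : ℝ × ℝ) : 0 < D.W p := D.pos_u _

theorem contDiff_map : ContDiff ℝ (⊤ : ℕ∞) D.map :=
  contDiff_toricMap D.contDiff_Z D.contDiff_θ D.contDiff_W D.contDiff_Φ D.Z_pos D.W_pos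

theorem hasFDerivAt_comp_snd {f : ℝ → ℝ} (hf : ContDiff ℝ (⊤ : ℕ∞) f) (p : ℝ × ℝ) :
    HasFDerivAt (fun q : ℝ × ℝ => f q.2) (deriv f p.2 • ContinuousLinearMap.snd ℝ ℝ ℝ) p :=
  (hf.differentiable (by simp) p.2).hasDerivAt.comp_hasFDerivAt p hasFDerivAt_snd

theorem hasFDerivAt_S (p : ℝ × ℝ) :
    HasFDerivAt D.S (ContinuousLinearMap.fst ℝ ℝ ℝ +
      (D.m : ℝ) • (deriv D.g p.2 • ContinuousLinearMap.snd ℝ ℝ ℝ)) p :=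
  hasFDerivAt_fst.add ((hasFDerivAt_comp_snd D.contDiff_g p).const_mul _)

theorem hasFDerivAt_comp_S {f : ℝ → ℝ} (hf : ContDiff ℝ (⊤ : ℕ∞) f) (p : ℝ × ℝ) :
    HasFDerivAt (fun q : ℝ × ℝ => f (D.S q)) (deriv f (D.S p) • (ContinuousLinearMap.fst ℝ ℝ ℝ +
      (D.m : ℝ) • (deriv D.g p.2 • ContinuousLinearMap.snd ℝ ℝ ℝ))) p :=
  (hf.differentiable (by simp) (D.S p)).hasDerivAt.comp_hasFDerivAt p (D.hasFDerivAt_S p)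

theorem fderiv_Z (p v : ℝ × ℝ) : fderiv ℝ D.Z p v =
    deriv D.ξ (D.S p) * (v.1 + D.m * (deriv D.g p.2 * v.2)) + deriv D.R p.2 * v.2 := by
  have h : HasFDerivAt D.Z _ p :=
    (D.hasFDerivAt_comp_S D.contDiff_ξ p).add (hasFDerivAt_comp_snd D.contDiff_R p)
  rw [h.fderiv]
  simp
  ring

theorem fderiv_θ (p v : ℝ × ℝ) : fderiv ℝ D.θ p v =
    deriv D.η (D.S p) * (v.1 + D.m * (deriv D.g p.2 * v.2)) := by
  have h : HasFDerivAt D.θ _ p := D.hasFDerivAt_comp_S D.contDiff_η p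
  rw [h.fderiv]
  simp
  ring

theorem fderiv_W (p v : ℝ × ℝ) : fderiv ℝ D.W p v = deriv D.u p.2 * v.2 := by
  have h : HasFDerivAt D.W _ p := hasFDerivAt_comp_snd D.contDiff_u p
  rw [h.fderiv]
  simp

theorem fderiv_Φ (p v : ℝ × ℝ) : fderiv ℝ D.Φ p v =
    deriv D.φ p.2 * v.2 + deriv D.κ p.2 * v.2 * (D.η (D.S p) - D.η 0) +
      D.κ p.2 * (deriv D.η (D.S p) * (v.1 + D.m * (deriv D.g p.2 * v.2))) := by
  have h : HasFDerivAt D.Φ _ p := (hasFDerivAt_comp_snd D.contDiff_φ p).add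
    ((hasFDerivAt_comp_snd D.contDiff_κ p).mul
      ((D.hasFDerivAt_comp_S D.contDiff_η p).sub_const (D.η 0)))
  rw [h.fderiv]
  simp
  ring

theorem fderiv_map (p v : ℝ × ℝ) : fderiv ℝ D.map p v =
      (polarPoint (D.Z p) (D.θ p) * (((fderiv ℝ D.Z p v / (2 * D.Z p) : ℝ) : ℂ) +
          (2 * Real.pi * fderiv ℝ D.θ p v : ℝ) * Complex.I),
        polarPoint (D.W p) (D.Φ p) * (((fderiv ℝ D.W p v / (2 * D.W p) : ℝ) : ℂ) +
          (2 * Real.pi * fderiv ℝ D.Φ p v : ℝ) * Complex.I)) :=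
  fderiv_toricMap (D.contDiff_Z.differentiable (by simp) p)
    (D.contDiff_θ.differentiable (by simp) p) (D.contDiff_W.differentiable (by simp) p)
    (D.contDiff_Φ.differentiable (by simp) p) (D.Z_pos p) (D.W_pos p) v

theorem isotropic (p v w : ℝ × ℝ) :
    omegaStd (fderiv ℝ D.map p v) (fderiv ℝ D.map p w) = 0 := by
  unfold map
  rw [omegaStd_fderiv_toricMap (D.contDiff_Z.differentiable (by simp) p)
    (D.contDiff_θ.differentiable (by simp) p) (D.contDiff_W.differentiable (by simp) p)
    (D.contDiff_Φ.differentiable (by simp) p) (D.Z_pos p) (D.W_pos p)]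
  simp only [fderiv_Z, fderiv_θ, fderiv_W, fderiv_Φ]
  linear_combination (deriv D.η (D.S p) * (v.2 * (w.1 + D.m * (deriv D.g p.2 * w.2)) -
    w.2 * (v.1 + D.m * (deriv D.g p.2 * v.2)))) * D.rel p.2

/-- If `v` is in the kernel, then `dW = 0` and `dθ = 0`. A nonzero second component would force `u'
= 0`, hence `κ' = 0` and then `φ' = 0`, against the immersion of the base. What remains is the
velocity of the fibre. -/
theorem immersive (p v : ℝ × ℝ) (h : fderiv ℝ D.map p v = 0) : v = 0 := by
  rw [fderiv_map, Prod.mk_eq_zero] at h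
  have h1 := (mul_eq_zero.1 h.1).resolve_left (polarPoint_ne_zero (D.Z_pos p) _)
  have h2 := (mul_eq_zero.1 h.2).resolve_left (polarPoint_ne_zero (D.W_pos p) _)
  have hpi := Real.pi_pos
  have a1 := congrArg Complex.re h1
  have a2 := congrArg Complex.im h1
  have a3 := congrArg Complex.re h2
  have a4 := congrArg Complex.im h2
  simp only [Complex.add_re, Complex.ofReal_re, Complex.mul_re, Complex.I_re, Complex.ofReal_im,
    Complex.I_im, Complex.add_im, Complex.mul_im, Complex.zero_re, Complex.zero_im, mul_zero,
    sub_zero, add_zero, mul_one, zero_add] at a1 a2 a3 a4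
  have hZ := D.Z_pos p
  have hW := D.W_pos p
  have b1 := (div_eq_zero_iff.1 a1).resolve_right (by positivity)
  have b2 := (mul_eq_zero.1 a2).resolve_left (by positivity)
  have b3 := (div_eq_zero_iff.1 a3).resolve_right (by positivity)
  have b4 := (mul_eq_zero.1 a4).resolve_left (by positivity)
  rw [fderiv_Z] at b1
  rw [fderiv_θ] at b2
  rw [fderiv_W] at b3
  rw [fderiv_Φ, b2, mul_zero, add_zero] at b4
  have hv2 : v.2 = 0 := by
    by_contra hv
    have hu := (mul_eq_zero.1 b3).resolve_right hv
    rw [D.deriv_κ _ hu, zero_mul, zero_mul, add_zero] at b4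
    have hφ := (mul_eq_zero.1 b4).resolve_right hv
    exact D.base.ne_zero p.2 (by simp [hu, hφ])
  rw [hv2] at b1 b2
  simp only [mul_zero, add_zero] at b1 b2
  have hv1 : v.1 = 0 := by
    by_contra hv
    exact (D.fibre (D.S p)).1 (by
      rw [(mul_eq_zero.1 b1).resolve_right hv, (mul_eq_zero.1 b2).resolve_right hv]; simp)
  exact Prod.ext hv1 hv2

theorem g_add_int (t : ℝ) (l : ℤ) : D.g (t + l) = D.g t + l := by
  have h : Function.Periodic (fun t => D.g t - t) 1 := fun t => by
    simp only [D.g_add_one]; ring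
  have h2 := h.int_mul l t
  simp only [mul_one] at h2
  linarith

theorem map_add_int (s t : ℝ) (k l : ℤ) : D.map (s + k, t + l) = D.map (s, t) := by
  have hS : D.S (s + k, t + l) = D.S (s, t) + (k + D.m * l : ℤ) := by
    unfold S; simp only [g_add_int]; push_cast; ring
  have hp : ∀ {f : ℝ → ℝ}, Function.Periodic f 1 → ∀ x (n : ℤ), f (x + n) = f x := by
    intro f hf x n
    simpa using hf.int_mul n x
  simp only [map, toricMap, Z, θ, W, Φ, hS, hp D.periodic_ξ, hp D.periodic_η, hp D.periodic_u,
    hp D.periodic_φ, hp D.periodic_R, hp D.periodic_κ]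

theorem map_inj (s t s' t' : ℝ) (h : D.map (s, t) = D.map (s', t')) :
    (∃ k : ℤ, s = s' + k) ∧ ∃ l : ℤ, t = t' + l := by
  have hint : ∀ x y : ℝ, |x - y| < 1 → (∃ k : ℤ, x = y + k) → x = y := by
    rintro x y hxy ⟨k, rfl⟩
    rw [add_sub_cancel_left, ← Int.cast_abs] at hxy
    have : |k| < 1 := by exact_mod_cast hxy
    rw [Int.abs_lt_one_iff.1 this]; simp
  have h1 := polarPoint_injective (D.Z_pos _) (D.Z_pos _) (congrArg Prod.fst h)
  have h2 := polarPoint_injective (D.W_pos _) (D.W_pos _) (congrArg Prod.snd h)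
  have h3 := hint _ _ (D.η_range _ _) h1.2
  have h4 := hint _ _ (D.φ_range _ _ _ _) h2.2
  obtain ⟨⟨k, hk⟩, l, hl⟩ := D.inj _ _ _ _ h1.1 h3 h2.1 h4
  simp only at hl
  refine ⟨⟨k - D.m * l, ?_⟩, l, hl⟩
  unfold S at hk
  simp only [hl, g_add_int] at hk
  push_cast
  linarith

theorem deriv_periodic {f : ℝ → ℝ} (hf : Function.Periodic f 1) :
    Function.Periodic (deriv f) 1 := by
  intro x
  rw [← deriv_comp_add_const]
  congr 1
  funext y
  exact hf y

theorem deriv_η_int (k : ℤ) : deriv D.η k = 0 := by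
  have := (deriv_periodic D.periodic_η).int_mul k 0
  rw [← D.deriv_η_zero, ← this]
  simp

theorem η_int (k : ℤ) : D.η k = D.η 0 := by
  have := D.periodic_η.int_mul k 0
  rw [← this]
  simp

/-- The tangential part of the torus splits into a fibre and a base factor along any curve where
the fibre is not sheared. -/
theorem complexDet_map (p : ℝ × ℝ)
    (h : D.κ p.2 * deriv D.η (D.S p) = 0)
    (h' : deriv D.κ p.2 * (D.η (D.S p) - D.η 0) = 0) :
    complexDet (fderiv ℝ D.map p (1, 0)) (fderiv ℝ D.map p (0, 1)) =
      (polarPoint (D.Z p) (D.θ p) * polarPoint (D.W p) (D.Φ p)) *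
      ((((1 / (2 * D.Z p)) * deriv D.ξ (D.S p) : ℝ) +
        (2 * Real.pi * deriv D.η (D.S p) : ℝ) * Complex.I) *
      (((1 / (2 * D.W p)) * deriv D.u p.2 : ℝ) +
        (2 * Real.pi * deriv D.φ p.2 : ℝ) * Complex.I)) := by
  have e1 : fderiv ℝ D.Φ p (1, 0) = 0 := by rw [fderiv_Φ]; simp; simpa using h
  have e2 : fderiv ℝ D.Φ p (0, 1) = deriv D.φ p.2 := by
    rw [fderiv_Φ]
    simp only [mul_one, zero_add, h', add_zero]
    rw [← mul_assoc, h]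
    ring
  rw [fderiv_map, fderiv_map, e1, e2]
  unfold complexDet
  simp only [fderiv_Z, fderiv_θ, fderiv_W]
  push_cast
  simp
  ring

theorem hasWinding_fibre {c : ℝ → ℝ} (hc : Continuous c) {k : ℤ} (hk : c 1 = c 0 + k) :
    HasWinding (fun t => ((deriv D.ξ (c t) : ℝ) : ℂ) + (deriv D.η (c t) : ℝ) * Complex.I) k := by
  refine ⟨fun t => 2 * Real.pi * c t + D.β (c t), ?_, fun t => D.fibre (c t), ?_⟩
  · have := D.continuous_β
    fun_prop
  · have := D.periodic_β.int_mul k (c 0)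
    rw [mul_one] at this
    simp only [hk, this]
    ring

/-- The determinant is a product of two polar factors of winding number 0, of the rescaled fibre
velocity, which turns once per period of the fibre, and of the rescaled base velocity. -/
theorem hasWinding_complexDet {c : ℝ → ℝ × ℝ} (hc : Continuous c) {k l : ℤ}
    (hc1 : c 1 = ((c 0).1 + k, (c 0).2 + l)) {n : ℤ}
    (h : ∀ t, D.κ (c t).2 * deriv D.η (D.S (c t)) = 0)
    (h' : ∀ t, deriv D.κ (c t).2 * (D.η (D.S (c t)) - D.η 0) = 0)
    (hn : HasWinding
      (fun t => ((deriv D.u (c t).2 : ℝ) : ℂ) + (deriv D.φ (c t).2 : ℝ) * Complex.I) n) :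
    HasWinding (fun t => complexDet (fderiv ℝ D.map (c t) (1, 0)) (fderiv ℝ D.map (c t) (0, 1)))
      (k + D.m * l + n) := by
  have hp : ∀ {f : ℝ → ℝ}, Function.Periodic f 1 → ∀ x (n : ℤ), f (x + n) = f x := by
    intro f hf x n
    simpa using hf.int_mul n x
  have hS : D.S (c 1) = D.S (c 0) + (k + D.m * l : ℤ) := by
    rw [hc1]; unfold S; simp only [g_add_int]; push_cast; ring
  have hZ : D.Z (c 1) = D.Z (c 0) := by
    unfold Z; rw [hS, hp D.periodic_ξ]; simp only [hc1, hp D.periodic_R]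
  have hθ : D.θ (c 1) = D.θ (c 0) := by unfold θ; rw [hS, hp D.periodic_η]
  have hW : D.W (c 1) = D.W (c 0) := by unfold W; simp only [hc1, hp D.periodic_u]
  have hΦ : D.Φ (c 1) = D.Φ (c 0) := by
    unfold Φ; rw [hS, hp D.periodic_η]; simp only [hc1, hp D.periodic_φ, hp D.periodic_κ]
  have cS := D.contDiff_S.continuous
  have cZ := D.contDiff_Z.continuous
  have cθ := D.contDiff_θ.continuous
  have cW := D.contDiff_W.continuous
  have cΦ := D.contDiff_Φ.continuous
  have w1 : HasWinding (fun t => polarPoint (D.Z (c t)) (D.θ (c t))) 0 :=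
    hasWinding_polarPoint (fun t => D.Z_pos _) (by fun_prop) (by simp [hθ])
  have w2 : HasWinding (fun t => polarPoint (D.W (c t)) (D.Φ (c t))) 0 :=
    hasWinding_polarPoint (fun t => D.W_pos _) (by fun_prop) (by simp [hΦ])
  have w3 := (D.hasWinding_fibre (c := fun t => D.S (c t)) (by fun_prop) hS).rescale
    (a := fun t => 1 / (2 * D.Z (c t))) (b := fun _ => 2 * Real.pi)
    (Continuous.div (by fun_prop) (by fun_prop) fun t => by have := D.Z_pos (c t); positivity)
    continuous_const
    (fun t => by have := D.Z_pos (c t); positivity)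
    (fun t => by have := Real.pi_pos; positivity) (by simp only [hZ]) rfl
  have w4 := hn.rescale
    (a := fun t => 1 / (2 * D.W (c t))) (b := fun _ => 2 * Real.pi)
    (Continuous.div (by fun_prop) (by fun_prop) fun t => by have := D.W_pos (c t); positivity)
    continuous_const
    (fun t => by have := D.W_pos (c t); positivity)
    (fun t => by have := Real.pi_pos; positivity) (by simp only [hW]) rfl
  have w := (w1.mul w2).mul (w3.mul w4)
  have e : (fun t => complexDet (fderiv ℝ D.map (c t) (1, 0)) (fderiv ℝ D.map (c t) (0, 1))) = _ :=
    funext fun t => D.complexDet_map (c t) (h t) (h' t)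
  rw [e]
  simpa using w

/-- The dichotomy `flat`, evaluated along the loop `s = 0`: either `m * g t` is an integer, where
`η` agrees with `η 0` and is critical, or translation and shear vanish. -/
theorem κ_mul_eq_zero (t : ℝ) : D.κ t * deriv D.η (D.m * D.g t) = 0 ∧
    deriv D.κ t * (D.η (D.m * D.g t) - D.η 0) = 0 ∧
    D.κ t * (D.η (D.m * D.g t) - D.η 0) = 0 ∧
    D.R t * (D.m * deriv D.g t) = 0 := by
  rcases D.flat t with ⟨⟨k, hk⟩, h⟩ | ⟨h1, h2, h3, h4⟩
  · have e : (D.m * D.g t : ℝ) = (D.m * k : ℤ) := by rw [hk]; push_cast; ring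
    rw [e, D.deriv_η_int, D.η_int, h]
    simp
  · simp [h1, h2, h4]

theorem torusLoop_one_zero : torusLoop (1, 0) = fun t => (t, 0) := by
  funext t; simp [torusLoop]

theorem torusLoop_zero_one : torusLoop (0, 1) = fun t => (0, t) := by
  funext t; simp [torusLoop]

theorem maslov_one_zero : MaslovClassEq (torusDescend D.map) (1, 0) 2 := by
  unfold MaslovClassEq tangentPlane
  rw [torusLift_torusDescend D.map_add_int, torusLoop_one_zero]
  obtain ⟨-, h2, -, h4⟩ := D.flat_zero
  have hw := D.hasWinding_complexDet (c := fun t => (t, 0)) (by fun_prop) (k := 1) (l := 0)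
    (by simp) (by simp [h2]) (by simp [h4])
    (hasWinding_const (D.base.ne_zero 0))
  have h := hasMaslovIndex_of_hasWinding D.contDiff_map (c := fun t => (t, 0)) (by fun_prop) hw
  simpa using h

theorem maslov_zero_one : MaslovClassEq (torusDescend D.map) (0, 1) 2 := by
  unfold MaslovClassEq tangentPlane
  rw [torusLift_torusDescend D.map_add_int, torusLoop_zero_one]
  have hS : ∀ t, D.S (0, t) = D.m * D.g t := fun t => by simp [S]
  have hw := D.hasWinding_complexDet (c := fun t => (0, t)) (by fun_prop) (k := 0) (l := 1)
    (by simp) (fun t => by simpa only [hS] using (D.κ_mul_eq_zero t).1)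
    (fun t => by simpa only [hS] using (D.κ_mul_eq_zero t).2.1) D.base
  rw [zero_add, mul_one, D.sum_eq] at hw
  exact hasMaslovIndex_of_hasWinding D.contDiff_map (c := fun t => (0, t)) (by fun_prop) hw

theorem areaClass_map (k : ℤ × ℤ) : areaClass (torusDescend D.map) k =
    ∫ t in (0 : ℝ)..1, (D.Z (torusLoop k t) * deriv (fun τ => D.θ (torusLoop k τ)) t +
      D.W (torusLoop k t) * deriv (fun τ => D.Φ (torusLoop k τ)) t) := by
  unfold areaClass
  rw [torusLift_torusDescend D.map_add_int]
  have hl : ContDiff ℝ (⊤ : ℕ∞) (torusLoop k) :=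
    (contDiff_const.mul contDiff_id).prodMk (contDiff_const.mul contDiff_id)
  refine integral_liouvilleStd_toricMap (D.contDiff_Z.comp hl) (D.contDiff_θ.comp hl)
    (D.contDiff_W.comp hl) (D.contDiff_Φ.comp hl) (fun t => D.Z_pos _) (fun t => D.W_pos _) ?_
  have := D.map_add_int 0 0 k.1 k.2
  simp only [zero_add] at this
  change D.map (torusLoop k 1) = D.map (torusLoop k 0)
  simpa [torusLoop] using this

theorem periodic_ξ_mul_deriv_η : Function.Periodic (fun s => D.ξ s * deriv D.η s) 1 := fun s => by
  simp only [D.periodic_ξ s, deriv_periodic D.periodic_η s]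

theorem continuous_ξ_mul_deriv_η : Continuous (fun s => D.ξ s * deriv D.η s) :=
  D.contDiff_ξ.continuous.mul (D.contDiff_η.continuous_deriv (by simp))

theorem area_one_zero : areaClass (torusDescend D.map) (1, 0) = 1 := by
  rw [areaClass_map, torusLoop_one_zero]
  obtain ⟨h1, h2, -, -⟩ := D.flat_zero
  have e : ∀ t, D.Z (t, 0) * deriv (fun τ => D.θ (τ, 0)) t +
      D.W (t, 0) * deriv (fun τ => D.Φ (τ, 0)) t =
      D.ξ (t + D.m * D.g 0) * deriv D.η (t + D.m * D.g 0) := by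
    intro t
    simp only [Z, θ, W, Φ, S, h1, h2, zero_mul, add_zero, deriv_const, mul_zero]
    rw [deriv_comp_add_const]
  simp_rw [e]
  rw [intervalIntegral.integral_comp_add_right (fun s => D.ξ s * deriv D.η s), zero_add,
    add_comm (1 : ℝ), D.periodic_ξ_mul_deriv_η.intervalIntegral_add_eq _ 0, zero_add,
    D.area_fibre]

/-- Along this loop the shear and the translation drop out, so the area is that of the base curve
plus `m` times the fibre area 1, by substitution of `m * g`. -/
theorem area_zero_one : areaClass (torusDescend D.map) (0, 1) =
    (∫ t in (0 : ℝ)..1, D.u t * deriv D.φ t) + D.m := by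
  rw [areaClass_map, torusLoop_zero_one]
  have hg : ∀ t, HasDerivAt (fun τ => D.m * D.g τ) (D.m * deriv D.g t) t := fun t =>
    (D.contDiff_g.differentiable (by simp) t).hasDerivAt.const_mul _
  have hη : ∀ t, HasDerivAt D.η (deriv D.η t) t := fun t =>
    (D.contDiff_η.differentiable (by simp) t).hasDerivAt
  have e : ∀ t, D.Z (0, t) * deriv (fun τ => D.θ (0, τ)) t +
      D.W (0, t) * deriv (fun τ => D.Φ (0, τ)) t =
      D.u t * deriv D.φ t +
      ((fun s => D.ξ s * deriv D.η s) ∘ fun τ => D.m * D.g τ) t * (D.m * deriv D.g t) := by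
    intro t
    simp only [Z, θ, W, Φ, S, zero_add, fun τ => (D.κ_mul_eq_zero τ).2.2.1, add_zero]
    have h1 : deriv (fun τ => D.η (D.m * D.g τ)) t =
      deriv D.η (D.m * D.g t) * (D.m * deriv D.g t) := ((hη _).comp t (hg t)).deriv
    have h2 := (D.κ_mul_eq_zero t).2.2.2
    rw [h1, Function.comp_apply]
    linear_combination deriv D.η (D.m * D.g t) * h2
  simp_rw [e]
  have c1 : Continuous fun t => D.u t * deriv D.φ t :=
    D.contDiff_u.continuous.mul (D.contDiff_φ.continuous_deriv (by simp))
  have c2 : Continuous fun t => (D.m : ℝ) * deriv D.g t :=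
    continuous_const.mul (D.contDiff_g.continuous_deriv (by simp))
  have c3 : Continuous ((fun s => D.ξ s * deriv D.η s) ∘ fun τ => (D.m : ℝ) * D.g τ) :=
    D.continuous_ξ_mul_deriv_η.comp (continuous_const.mul D.contDiff_g.continuous)
  have c4 : Continuous fun t =>
    ((fun s => D.ξ s * deriv D.η s) ∘ fun τ => (D.m : ℝ) * D.g τ) t * (D.m * deriv D.g t) :=
    c3.mul c2
  rw [intervalIntegral.integral_add (c1.intervalIntegrable _ _)
      (c4.intervalIntegrable _ _),
    intervalIntegral.integral_comp_mul_deriv (fun t _ => hg t) c2.continuousOn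
      D.continuous_ξ_mul_deriv_η]
  congr 1
  have h := D.periodic_ξ_mul_deriv_η.intervalIntegral_add_zsmul_eq D.m (D.m * D.g 0)
    (fun a b => D.continuous_ξ_mul_deriv_η.intervalIntegrable _ _)
  have h1 : (D.m : ℝ) * D.g 1 = D.m * D.g 0 + D.m • (1 : ℝ) := by
    rw [← zero_add (1 : ℝ), D.g_add_one]; simp; ring
  rw [h1, h, D.periodic_ξ_mul_deriv_η.intervalIntegral_add_eq _ 0, zero_add, D.area_fibre]
  simp

theorem lagrangianTorusEmbeds {X : Set (ℂ × ℂ)} (hX : ∀ p, D.map p ∈ X) :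
    LagrangianTorusEmbeds 1 ((∫ t in (0 : ℝ)..1, D.u t * deriv D.φ t) + D.m) X := by
  refine ⟨torusDescend D.map, isLagrangianEmbedding_torusDescend D.map_add_int D.contDiff_map
    D.map_inj D.immersive D.isotropic, ?_, D.maslov_one_zero, D.maslov_zero_one,
    D.area_one_zero, D.area_zero_one⟩
  rintro _ ⟨p, rfl⟩
  exact hX _

end Suspension

/-! ### Smooth steps -/

/-- A smooth odd monotone function that is `-1` on `(-∞, -1]` and `1` on `[1, ∞)`. -/
noncomputable def oddStep (x : ℝ) : ℝ := 2 * Real.smoothTransition ((x + 1) / 2) - 1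

theorem contDiff_oddStep : ContDiff ℝ (⊤ : ℕ∞) oddStep :=
  (contDiff_const.mul (Real.smoothTransition.contDiff.comp
    ((contDiff_id.add contDiff_const).div_const 2))).sub contDiff_const

theorem oddStep_of_one_le {x : ℝ} (h : 1 ≤ x) : oddStep x = 1 := by
  rw [oddStep, Real.smoothTransition.one_of_one_le (by linarith)]; norm_num

theorem oddStep_of_le_neg_one {x : ℝ} (h : x ≤ -1) : oddStep x = -1 := by
  rw [oddStep, Real.smoothTransition.zero_of_nonpos (by linarith)]; norm_num

theorem oddStep_le_one (x : ℝ) : oddStep x ≤ 1 := by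
  have := Real.smoothTransition.le_one ((x + 1) / 2)
  unfold oddStep; linarith

theorem neg_one_le_oddStep (x : ℝ) : -1 ≤ oddStep x := by
  have := Real.smoothTransition.nonneg ((x + 1) / 2)
  unfold oddStep; linarith

theorem oddStep_neg (x : ℝ) : oddStep (-x) = -oddStep x := by
  unfold oddStep Real.smoothTransition
  have e1 : 1 - (-x + 1) / 2 = (x + 1) / 2 := by ring
  have e2 : 1 - (x + 1) / 2 = (-x + 1) / 2 := by ring
  rw [e1, e2]
  have h := (Real.smoothTransition.pos_denom ((x + 1) / 2)).ne'
  rw [e2] at h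
  rw [add_comm (expNegInvGlue ((-x + 1) / 2))]
  field_simp
  ring

theorem monotone_oddStep : Monotone oddStep := by
  intro x y h
  have := Real.smoothTransition.monotone (show (x + 1) / 2 ≤ (y + 1) / 2 by linarith)
  unfold oddStep; linarith

theorem oddStep_zero : oddStep 0 = 0 := by
  have := oddStep_neg 0
  rw [neg_zero] at this; linarith

theorem oddStep_nonneg {x : ℝ} (h : 0 ≤ x) : 0 ≤ oddStep x := by
  rw [← oddStep_zero]; exact monotone_oddStep h

theorem hasDerivAt_oddStep (x : ℝ) : HasDerivAt oddStep (deriv oddStep x) x :=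
  (contDiff_oddStep.differentiable (by simp) x).hasDerivAt

theorem deriv_oddStep_nonneg (x : ℝ) : 0 ≤ deriv oddStep x := monotone_oddStep.deriv_nonneg

theorem continuous_deriv_oddStep : Continuous (deriv oddStep) :=
  contDiff_oddStep.continuous_deriv (by simp)

theorem deriv_oddStep_eq_zero {x : ℝ} (h : 1 ≤ |x|) : deriv oddStep x = 0 := by
  rcases le_abs.1 h with h | h
  · have : IsLocalMax oddStep x := Filter.Eventually.of_forall fun y => by
      simpa only [oddStep_of_one_le h] using oddStep_le_one y
    exact this.deriv_eq_zero
  · have : IsLocalMin oddStep x := Filter.Eventually.of_forall fun y => by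
      simpa only [oddStep_of_le_neg_one (show x ≤ -1 by linarith)] using neg_one_le_oddStep y
    exact this.deriv_eq_zero

theorem hasDerivAt_oddStep_comp {f : ℝ → ℝ} {f' t : ℝ} (hf : HasDerivAt f f' t) :
    HasDerivAt (fun τ => oddStep (f τ)) (deriv oddStep (f t) * f') t :=
  (hasDerivAt_oddStep _).comp t hf

/-- A smooth function with positive derivative that is close to a step on `[-1, 1]`. -/
noncomputable def edge (μ x : ℝ) : ℝ := oddStep (2 * x) + μ * x

theorem hasDerivAt_edge (μ x : ℝ) : HasDerivAt (edge μ) (deriv oddStep (2 * x) * 2 + μ) x := by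
  have h1 : HasDerivAt (fun y : ℝ => 2 * y) 2 x := by simpa using (hasDerivAt_id x).const_mul 2
  have h2 : HasDerivAt (fun y : ℝ => μ * y) μ x := by simpa using (hasDerivAt_id x).const_mul μ
  exact (hasDerivAt_oddStep_comp h1).add h2

theorem contDiff_edge (μ : ℝ) : ContDiff ℝ (⊤ : ℕ∞) (edge μ) :=
  (contDiff_oddStep.comp (contDiff_const.mul contDiff_id)).add (contDiff_const.mul contDiff_id)

theorem strictMono_edge {μ : ℝ} (hμ : 0 < μ) : StrictMono (edge μ) := by
  intro x y h
  have := monotone_oddStep (show 2 * x ≤ 2 * y by linarith)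
  unfold edge
  nlinarith

theorem edge_one (μ : ℝ) : edge μ 1 = 1 + μ := by
  rw [edge, oddStep_of_one_le (by norm_num)]; ring

theorem edge_neg_one (μ : ℝ) : edge μ (-1) = -(1 + μ) := by
  rw [edge, oddStep_of_le_neg_one (by norm_num)]; ring

theorem edge_mem {μ : ℝ} (hμ : 0 < μ) {x : ℝ} (h : -1 ≤ x) (h' : x ≤ 1) :
    -(1 + μ) ≤ edge μ x ∧ edge μ x ≤ 1 + μ := by
  have h1 := (strictMono_edge hμ).monotone h
  have h2 := (strictMono_edge hμ).monotone h'
  rw [edge_neg_one] at h1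
  rw [edge_one] at h2
  exact ⟨h1, h2⟩

/-! ### The fibre curve -/

/-- A nearly rectangular closed curve. -/
noncomputable def fibreX (μ c l s : ℝ) : ℝ := c - l * edge μ (Real.sin (2 * Real.pi * s))
noncomputable def fibreY (μ c h s : ℝ) : ℝ := c + h * edge μ (Real.cos (2 * Real.pi * s))

section fibre

variable (μ c l h : ℝ)

theorem contDiff_fibreX : ContDiff ℝ (⊤ : ℕ∞) (fibreX μ c l) :=
  contDiff_const.sub (contDiff_const.mul ((contDiff_edge μ).comp
    (Real.contDiff_sin.comp (contDiff_const.mul contDiff_id))))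

theorem contDiff_fibreY : ContDiff ℝ (⊤ : ℕ∞) (fibreY μ c h) :=
  contDiff_const.add (contDiff_const.mul ((contDiff_edge μ).comp
    (Real.contDiff_cos.comp (contDiff_const.mul contDiff_id))))

theorem periodic_fibreX : Function.Periodic (fibreX μ c l) 1 := fun s => by
  unfold fibreX
  rw [mul_add, mul_one, Real.sin_add_two_pi]

theorem periodic_fibreY : Function.Periodic (fibreY μ c h) 1 := fun s => by
  unfold fibreY
  rw [mul_add, mul_one, Real.cos_add_two_pi]

theorem hasDerivAt_two_pi_mul (s : ℝ) : HasDerivAt (fun s => 2 * Real.pi * s) (2 * Real.pi) s := by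
  simpa using (hasDerivAt_id s).const_mul (2 * Real.pi)

theorem deriv_fibreX (s : ℝ) : deriv (fibreX μ c l) s =
    -(l * (deriv oddStep (2 * Real.sin (2 * Real.pi * s)) * 2 + μ) *
      (2 * Real.pi * Real.cos (2 * Real.pi * s))) := by
  have h := (((hasDerivAt_edge μ _).comp s (hasDerivAt_two_pi_mul s).sin).const_mul l).const_sub c
  exact h.deriv.trans (by ring)

theorem deriv_fibreY (s : ℝ) : deriv (fibreY μ c h) s =
    -(h * (deriv oddStep (2 * Real.cos (2 * Real.pi * s)) * 2 + μ) *
      (2 * Real.pi * Real.sin (2 * Real.pi * s))) := by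
  have h := (((hasDerivAt_edge μ _).comp s (hasDerivAt_two_pi_mul s).cos).const_mul h).const_add c
  exact h.deriv.trans (by ring)

theorem fibreX_mem {μ l : ℝ} (hμ : 0 < μ) (hl : 0 < l) (s : ℝ) :
    c - l * (1 + μ) ≤ fibreX μ c l s ∧ fibreX μ c l s ≤ c + l * (1 + μ) := by
  have := edge_mem hμ (Real.neg_one_le_sin (2 * Real.pi * s)) (Real.sin_le_one _)
  unfold fibreX
  constructor <;> nlinarith

theorem fibreY_mem {μ h : ℝ} (hμ : 0 < μ) (hh : 0 < h) (s : ℝ) :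
    c - h * (1 + μ) ≤ fibreY μ c h s ∧ fibreY μ c h s ≤ c + h * (1 + μ) := by
  have := edge_mem hμ (Real.neg_one_le_cos (2 * Real.pi * s)) (Real.cos_le_one _)
  unfold fibreY
  constructor <;> nlinarith

theorem fibreY_zero : fibreY μ c h 0 = c + h * (1 + μ) := by
  simp [fibreY, edge_one]

theorem fibre_inj {μ l h c c' : ℝ} (hμ : 0 < μ) (hl : 0 < l) (hh : 0 < h) {s s' : ℝ}
    (h1 : fibreX μ c l s = fibreX μ c l s') (h2 : fibreY μ c' h s = fibreY μ c' h s') :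
    ∃ k : ℤ, s = s' + k := by
  unfold fibreX at h1
  unfold fibreY at h2
  have e1 : Real.sin (2 * Real.pi * s) = Real.sin (2 * Real.pi * s') :=
    (strictMono_edge hμ).injective (mul_left_cancel₀ hl.ne' (by linarith))
  have e2 : Real.cos (2 * Real.pi * s) = Real.cos (2 * Real.pi * s') :=
    (strictMono_edge hμ).injective (mul_left_cancel₀ hh.ne' (by linarith))
  have e3 : Complex.exp ((2 * Real.pi * s : ℝ) * Complex.I) =
      Complex.exp ((2 * Real.pi * s' : ℝ) * Complex.I) := by
    apply Complex.ext <;> simp only [Complex.exp_ofReal_mul_I_re, Complex.exp_ofReal_mul_I_im, e1, e2]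
  rw [Complex.exp_eq_exp_iff_exists_int] at e3
  obtain ⟨k, hk⟩ := e3
  refine ⟨k, ?_⟩
  have h4 := congrArg Complex.im hk
  simp at h4
  have := Real.pi_pos
  have h5 : (2 * Real.pi) * s = (2 * Real.pi) * (s' + k) := by linarith
  exact mul_left_cancel₀ (by positivity) h5

/-- A continuous argument of the velocity of the fibre curve, up to the linear part. -/
noncomputable def fibrePhase (s : ℝ) : ℝ :=
  Real.pi + Complex.arg (rescaleFactor
    (l * (deriv oddStep (2 * Real.sin (2 * Real.pi * s)) * 2 + μ))
    (h * (deriv oddStep (2 * Real.cos (2 * Real.pi * s)) * 2 + μ)) (2 * Real.pi * s))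

theorem edge_deriv_pos {μ : ℝ} (hμ : 0 < μ) (x : ℝ) : 0 < deriv oddStep x * 2 + μ := by
  have := deriv_oddStep_nonneg x
  linarith

theorem continuous_fibrePhase {μ l h : ℝ} (hμ : 0 < μ) (hl : 0 < l) (hh : 0 < h) :
    Continuous (fibrePhase μ l h) := by
  have := continuous_deriv_oddStep
  refine continuous_const.add (continuous_arg_rescaleFactor (by fun_prop) (by fun_prop)
    (by fun_prop) (fun t => ?_) fun t => ?_)
  · exact mul_pos hl (edge_deriv_pos hμ _)
  · exact mul_pos hh (edge_deriv_pos hμ _)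

theorem periodic_fibrePhase : Function.Periodic (fibrePhase μ l h) 1 := fun s => by
  unfold fibrePhase
  rw [show 2 * Real.pi * (s + 1) = 2 * Real.pi * s + 2 * Real.pi by ring,
    Real.sin_add_two_pi, Real.cos_add_two_pi]
  have := fun a b => rescaleFactor_add_int a b (2 * Real.pi * s) 1
  simp only [Int.cast_one, one_mul] at this
  rw [this]

/-- The velocity is minus a positive rescaling of `(cos 2πs, sin 2πs)`. The sign accounts for the
summand `π` in the phase, and the rescaling for the bounded correction. -/
theorem fibre_phase {μ l h : ℝ} (c c' : ℝ) (hμ : 0 < μ) (hl : 0 < l) (hh : 0 < h) (s : ℝ) :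
    (((deriv (fibreX μ c l) s : ℝ) : ℂ) + (deriv (fibreY μ c' h) s : ℝ) * Complex.I) ≠ 0 ∧
    (((deriv (fibreX μ c l) s : ℝ) : ℂ) + (deriv (fibreY μ c' h) s : ℝ) * Complex.I) =
      ‖((deriv (fibreX μ c l) s : ℝ) : ℂ) + (deriv (fibreY μ c' h) s : ℝ) * Complex.I‖ *
        Complex.exp ((2 * Real.pi * s + fibrePhase μ l h s : ℝ) * Complex.I) := by
  have hr := rescale_eq (mul_pos hl (edge_deriv_pos hμ (2 * Real.sin (2 * Real.pi * s))))
    (mul_pos hh (edge_deriv_pos hμ (2 * Real.cos (2 * Real.pi * s)))) (2 * Real.pi * s)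
    (show 0 < 2 * Real.pi by have := Real.pi_pos; positivity)
  rw [deriv_fibreX, deriv_fibreY]
  push_cast at hr ⊢
  rw [neg_mul, ← neg_add, norm_neg, neg_ne_zero]
  refine ⟨hr.1, ?_⟩
  conv_lhs => rw [hr.2]
  rw [fibrePhase]
  push_cast
  have : (2 * (Real.pi : ℂ) * s + (Real.pi + (Complex.arg (rescaleFactor
    (l * (deriv oddStep (2 * Real.sin (2 * Real.pi * s)) * 2 + μ))
    (h * (deriv oddStep (2 * Real.cos (2 * Real.pi * s)) * 2 + μ)) (2 * Real.pi * s)) : ℂ))) *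
      Complex.I = (2 * (Real.pi : ℂ) * s + (Complex.arg (rescaleFactor
    (l * (deriv oddStep (2 * Real.sin (2 * Real.pi * s)) * 2 + μ))
    (h * (deriv oddStep (2 * Real.cos (2 * Real.pi * s)) * 2 + μ)) (2 * Real.pi * s)) : ℂ)) *
      Complex.I + Real.pi * Complex.I := by ring
  rw [this, Complex.exp_add, Complex.exp_pi_mul_I]
  ring

/-- The area enclosed by the fibre curve with unit half axes. -/
noncomputable def fibreArea (μ : ℝ) : ℝ :=
  ∫ s in (0 : ℝ)..1, edge μ (Real.sin (2 * Real.pi * s)) *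
    ((deriv oddStep (2 * Real.cos (2 * Real.pi * s)) * 2 + μ) *
      (2 * Real.pi * Real.sin (2 * Real.pi * s)))

theorem continuous_fibreArea_integrand (μ : ℝ) : Continuous fun s : ℝ =>
    edge μ (Real.sin (2 * Real.pi * s)) *
    ((deriv oddStep (2 * Real.cos (2 * Real.pi * s)) * 2 + μ) *
      (2 * Real.pi * Real.sin (2 * Real.pi * s))) := by
  have := continuous_deriv_oddStep
  have := (contDiff_edge μ).continuous
  fun_prop

theorem integral_fibre (c' : ℝ) :
    ∫ s in (0 : ℝ)..1, fibreX μ c l s * deriv (fibreY μ c' h) s = l * h * fibreArea μ := by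
  have hd : ∀ s, HasDerivAt (fibreY μ c' h) (deriv (fibreY μ c' h) s) s := fun s =>
    ((contDiff_fibreY μ c' h).differentiable (by simp) s).hasDerivAt
  have hc : Continuous (deriv (fibreY μ c' h)) := (contDiff_fibreY μ c' h).continuous_deriv (by simp)
  have h0 : ∫ s in (0 : ℝ)..1, deriv (fibreY μ c' h) s = 0 := by
    rw [intervalIntegral.integral_eq_sub_of_hasDerivAt (fun s _ => hd s)
      (hc.intervalIntegrable _ _), ← zero_add (1 : ℝ), periodic_fibreY μ c' h 0, sub_self]
  have e : ∀ s, fibreX μ c l s * deriv (fibreY μ c' h) s = c * deriv (fibreY μ c' h) s +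
      l * h * (edge μ (Real.sin (2 * Real.pi * s)) *
        ((deriv oddStep (2 * Real.cos (2 * Real.pi * s)) * 2 + μ) *
        (2 * Real.pi * Real.sin (2 * Real.pi * s)))) := by
    intro s
    rw [fibreX, sub_mul, deriv_fibreY]
    ring
  simp_rw [e]
  rw [intervalIntegral.integral_add ((hc.const_mul c).intervalIntegrable _ _)
    (((continuous_fibreArea_integrand μ).const_mul _).intervalIntegrable _ _),
    intervalIntegral.integral_const_mul, intervalIntegral.integral_const_mul, h0, fibreArea]
  ring

end fibre

theorem edge_mul_self_nonneg {μ : ℝ} (hμ : 0 < μ) (x : ℝ) : 0 ≤ edge μ x * x := by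
  have h0 : edge μ 0 = 0 := by simp [edge, oddStep_zero]
  rcases le_total 0 x with h | h
  · exact mul_nonneg (h0 ▸ (strictMono_edge hμ).monotone h) h
  · exact mul_nonneg_of_nonpos_of_nonpos (h0 ▸ (strictMono_edge hμ).monotone h) h

theorem abs_le_edge_mul_self {μ : ℝ} (hμ : 0 < μ) {x : ℝ} (hx : 1 ≤ |2 * x|) :
    |x| ≤ edge μ x * x := by
  rcases le_abs.1 hx with h | h
  · rw [edge, oddStep_of_one_le h, abs_of_nonneg (by linarith)]
    nlinarith [mul_nonneg hμ.le (mul_self_nonneg x)]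
  · rw [edge, oddStep_of_le_neg_one (by linarith), abs_of_nonpos (by linarith)]
    nlinarith [mul_nonneg hμ.le (mul_self_nonneg x)]

/-- Where the step of `2 cos x` has nonzero derivative, `|cos x| < 1/2`, hence `|sin x| ≥ 1/2` and
the other edge coordinate already has absolute value at least 1. -/
theorem abs_deriv_oddStep_cos_le {μ : ℝ} (hμ : 0 < μ) (x : ℝ) :
    |deriv oddStep (2 * Real.cos x) * (2 * (-Real.sin x * (2 * Real.pi)))| ≤
      edge μ (Real.sin x) * ((deriv oddStep (2 * Real.cos x) * 2 + μ) *
        (2 * Real.pi * Real.sin x)) := by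
  have hd := deriv_oddStep_nonneg (2 * Real.cos x)
  have hpi := Real.pi_pos
  have h0 := edge_mul_self_nonneg hμ (Real.sin x)
  have e : edge μ (Real.sin x) * ((deriv oddStep (2 * Real.cos x) * 2 + μ) *
        (2 * Real.pi * Real.sin x)) = 2 * Real.pi * (deriv oddStep (2 * Real.cos x) * 2 + μ) *
        (edge μ (Real.sin x) * Real.sin x) := by ring
  rw [e]
  by_cases hc : 1 ≤ |2 * Real.cos x|
  · rw [deriv_oddStep_eq_zero hc]
    simp only [zero_mul, abs_zero, zero_add]
    positivity
  · have hs : 1 ≤ |2 * Real.sin x| := by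
      rw [← one_le_sq_iff_one_le_abs]
      rw [← one_le_sq_iff_one_le_abs] at hc
      nlinarith [Real.sin_sq_add_cos_sq x]
    have h1 := abs_le_edge_mul_self hμ hs
    rw [abs_mul, abs_mul, abs_mul, abs_neg, abs_of_nonneg hd, abs_two,
      abs_of_pos (show 0 < 2 * Real.pi by positivity)]
    calc _ = 2 * Real.pi * (deriv oddStep (2 * Real.cos x) * 2) * |Real.sin x| := by ring
      _ ≤ 2 * Real.pi * (deriv oddStep (2 * Real.cos x) * 2 + μ) *
        (edge μ (Real.sin x) * Real.sin x) := by gcongr; linarith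

/-- The integrand dominates the absolute derivative of `oddStep (2 cos 2πs)`, which falls from 1 to
-1 and rises back to 1, so its total variation is at least 4. This bounds the width of a fibre of
given height and area 1. -/
theorem four_le_fibreArea {μ : ℝ} (hμ : 0 < μ) : 4 ≤ fibreArea μ := by
  set D : ℝ → ℝ := fun s => deriv oddStep (2 * Real.cos (2 * Real.pi * s)) *
    (2 * (-Real.sin (2 * Real.pi * s) * (2 * Real.pi))) with hD
  have cD : Continuous D := by
    have := continuous_deriv_oddStep
    fun_prop
  have hd : ∀ s, HasDerivAt (fun s => oddStep (2 * Real.cos (2 * Real.pi * s))) (D s) s :=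
    fun s => hasDerivAt_oddStep_comp ((hasDerivAt_two_pi_mul s).cos.const_mul 2)
  have hI : ∀ a b, ∫ s in a..b, D s = oddStep (2 * Real.cos (2 * Real.pi * b)) -
      oddStep (2 * Real.cos (2 * Real.pi * a)) := fun a b =>
    intervalIntegral.integral_eq_sub_of_hasDerivAt (fun s _ => hd s) (cD.intervalIntegrable _ _)
  have e0 : oddStep (2 * Real.cos (2 * Real.pi * 0)) = 1 := by
    rw [mul_zero, Real.cos_zero]; exact oddStep_of_one_le (by norm_num)
  have e1 : oddStep (2 * Real.cos (2 * Real.pi * (1 / 2))) = -1 := by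
    rw [show 2 * Real.pi * (1 / 2) = Real.pi by ring, Real.cos_pi]
    exact oddStep_of_le_neg_one (by norm_num)
  have e2 : oddStep (2 * Real.cos (2 * Real.pi * 1)) = 1 := by
    rw [mul_one, Real.cos_two_pi]; exact oddStep_of_one_le (by norm_num)
  obtain ⟨f, hf⟩ : ∃ f : ℝ → ℝ, f = fun s => edge μ (Real.sin (2 * Real.pi * s)) *
      ((deriv oddStep (2 * Real.cos (2 * Real.pi * s)) * 2 + μ) *
      (2 * Real.pi * Real.sin (2 * Real.pi * s))) := ⟨_, rfl⟩
  have hDf : ∀ s, |D s| ≤ f s := fun s => by rw [hf]; exact abs_deriv_oddStep_cos_le hμ _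
  have ci : Continuous f := by rw [hf]; exact continuous_fibreArea_integrand μ
  have b1 : 2 ≤ ∫ s in (0 : ℝ)..(1 / 2), f s := by
    refine le_trans ?_ (intervalIntegral.integral_mono_on (by norm_num : (0 : ℝ) ≤ 1 / 2)
      (cD.neg.intervalIntegrable _ _) (ci.intervalIntegrable _ _)
      fun s _ => (neg_le_abs _).trans (hDf s))
    simp only [Pi.neg_apply]
    rw [intervalIntegral.integral_neg, hI, e0, e1]
    norm_num
  have b2 : 2 ≤ ∫ s in (1 / 2 : ℝ)..1, f s := by
    refine le_trans ?_ (intervalIntegral.integral_mono_on (by norm_num : (1 / 2 : ℝ) ≤ 1)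
      (cD.intervalIntegrable _ _) (ci.intervalIntegrable _ _)
      fun s _ => (le_abs_self _).trans (hDf s))
    rw [hI, e1, e2]
    norm_num
  rw [fibreArea, ← hf, ← intervalIntegral.integral_add_adjacent_intervals
    (ci.intervalIntegrable 0 (1 / 2)) (ci.intervalIntegrable (1 / 2) 1)]
  linarith

/-! ### The spiral base curve and its rotation number -/

/-- The number of half turns of the base curve. -/
noncomputable def turns (n : ℕ) : ℝ := 2 * n + 1

/-- The half width of the angular sector in which the radius changes sign. -/
noncomputable def gap (n : ℕ) : ℝ := 1 / (20 * turns n)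

/-- The signed radius of the base curve in the direction `turns n * x`. -/
noncomputable def rad (n : ℕ) (x : ℝ) : ℝ := 9 * oddStep (Real.sin x / Real.sin (gap n)) + Real.cos x

noncomputable def px (n : ℕ) (x : ℝ) : ℝ := rad n x * Real.cos (turns n * x)

noncomputable def qx (n : ℕ) (x : ℝ) : ℝ := rad n x * Real.sin (turns n * x)

theorem one_le_turns (n : ℕ) : 1 ≤ turns n := by
  unfold turns
  have : (0 : ℝ) ≤ n := n.cast_nonneg
  linarith

theorem turns_pos (n : ℕ) : 0 < turns n := by
  have := one_le_turns n
  linarith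

theorem turns_mul_gap (n : ℕ) : turns n * gap n = 1 / 20 := by
  have := turns_pos n
  unfold gap
  field_simp

theorem gap_pos (n : ℕ) : 0 < gap n := by
  have := turns_pos n
  unfold gap
  positivity

theorem gap_le (n : ℕ) : gap n ≤ 1 / 20 := by
  have h1 := one_le_turns n
  have h2 := gap_pos n
  rw [← turns_mul_gap n]
  nlinarith

theorem sin_gap_pos (n : ℕ) : 0 < Real.sin (gap n) := by
  have h1 := gap_le n
  have := Real.pi_gt_three
  exact Real.sin_pos_of_pos_of_lt_pi (gap_pos n) (by linarith)

section base

variable {n : ℕ}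

/-- The signed radius changes sign after `π`, and so does the direction, because `turns n` is odd;
hence the curve closes up with period `π`. On `[gap n, π - gap n]` it spirals inwards through `n +
1/2` turns, less a small angle, with radius between 10 and 8. Near `0` the radius changes sign, and
the curve crosses the disc from left to right back to its outer end. -/
theorem rad_add_pi (x : ℝ) : rad n (x + Real.pi) = -rad n x := by
  unfold rad
  rw [Real.sin_add_pi, Real.cos_add_pi, neg_div, oddStep_neg]
  ring

theorem turns_mul_add_pi (x : ℝ) :
    turns n * (x + Real.pi) = turns n * x + Real.pi + n * (2 * Real.pi) := by
  unfold turns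
  ring

theorem periodic_px : Function.Periodic (px n) Real.pi := fun x => by
  rw [px, turns_mul_add_pi, Real.cos_add_nat_mul_two_pi, Real.cos_add_pi, rad_add_pi, px]
  ring

theorem periodic_qx : Function.Periodic (qx n) Real.pi := fun x => by
  rw [qx, turns_mul_add_pi, Real.sin_add_nat_mul_two_pi, Real.sin_add_pi, rad_add_pi, qx]
  ring

theorem sin_gap_le_sin {x : ℝ} (h1 : gap n ≤ x) (h2 : x ≤ Real.pi - gap n) :
    Real.sin (gap n) ≤ Real.sin x := by
  have := gap_pos n
  rcases le_total x (Real.pi / 2) with h | h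
  · exact Real.sin_le_sin_of_le_of_le_pi_div_two (by linarith) h h1
  · rw [← Real.sin_pi_sub x]
    exact Real.sin_le_sin_of_le_of_le_pi_div_two (by linarith) (by linarith) (by linarith)

theorem rad_of_mem {x : ℝ} (h1 : gap n ≤ x) (h2 : x ≤ Real.pi - gap n) :
    rad n x = 9 + Real.cos x := by
  rw [rad, oddStep_of_one_le, mul_one]
  rw [one_le_div (sin_gap_pos n)]
  exact sin_gap_le_sin h1 h2

theorem rad_of_mem_neg {x : ℝ} (h1 : gap n - Real.pi ≤ x) (h2 : x ≤ -gap n) :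
    rad n x = -9 + Real.cos x := by
  have h := rad_add_pi (n := n) x
  rw [rad_of_mem (by linarith) (by linarith), Real.cos_add_pi] at h
  linarith

theorem abs_rad_le (x : ℝ) : |rad n x| ≤ 10 := by
  have h1 := oddStep_le_one (Real.sin x / Real.sin (gap n))
  have h2 := neg_one_le_oddStep (Real.sin x / Real.sin (gap n))
  have h3 := Real.cos_le_one x
  have h4 := Real.neg_one_le_cos x
  unfold rad
  rw [abs_le]
  constructor <;> linarith

theorem rad_pos {x : ℝ} (h1 : 0 ≤ x) (h2 : x < Real.pi / 2) : 0 < rad n x := by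
  have h3 := Real.cos_pos_of_mem_Ioo ⟨by linarith, h2⟩
  have h4 := Real.sin_nonneg_of_nonneg_of_le_pi h1 (by linarith)
  have h5 := oddStep_nonneg (div_nonneg h4 (sin_gap_pos n).le)
  unfold rad
  linarith

theorem rad_lt_rad {x y : ℝ} (h1 : -(Real.pi / 2) ≤ x) (h2 : x < y) (h3 : y ≤ 0) :
    rad n x < rad n y := by
  have h4 := Real.sin_le_sin_of_le_of_le_pi_div_two h1 (by linarith) h2.le
  have h5 := monotone_oddStep (div_le_div_of_nonneg_right h4 (sin_gap_pos n).le)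
  have h6 : Real.cos x < Real.cos y := by
    rw [← Real.cos_neg x, ← Real.cos_neg y]
    exact Real.cos_lt_cos_of_nonneg_of_le_pi (by linarith) (by linarith) (by linarith)
  unfold rad
  linarith

noncomputable def radDeriv (n : ℕ) (x : ℝ) : ℝ :=
  9 * (deriv oddStep (Real.sin x / Real.sin (gap n)) * (Real.cos x / Real.sin (gap n))) - Real.sin x

theorem hasDerivAt_rad (x : ℝ) : HasDerivAt (rad n) (radDeriv n x) x := by
  have h := ((hasDerivAt_oddStep_comp
    ((Real.hasDerivAt_sin x).div_const (Real.sin (gap n)))).const_mul 9).add (Real.hasDerivAt_cos x)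
  exact h

theorem hasDerivAt_turns_mul (x : ℝ) : HasDerivAt (fun x => turns n * x) (turns n) x := by
  simpa using (hasDerivAt_id x).const_mul (turns n)

theorem hasDerivAt_px (x : ℝ) : HasDerivAt (px n) (radDeriv n x * Real.cos (turns n * x) -
    rad n x * turns n * Real.sin (turns n * x)) x := by
  have h := (hasDerivAt_rad (n := n) x).mul (hasDerivAt_turns_mul (n := n) x).cos
  exact h.congr_deriv (by ring)

theorem hasDerivAt_qx (x : ℝ) : HasDerivAt (qx n) (radDeriv n x * Real.sin (turns n * x) +
    rad n x * turns n * Real.cos (turns n * x)) x := by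
  have h := (hasDerivAt_rad (n := n) x).mul (hasDerivAt_turns_mul (n := n) x).sin
  exact h.congr_deriv (by ring)

theorem contDiff_rad : ContDiff ℝ (⊤ : ℕ∞) (rad n) :=
  (contDiff_const.mul (contDiff_oddStep.comp (Real.contDiff_sin.div_const _))).add
    Real.contDiff_cos

theorem contDiff_px : ContDiff ℝ (⊤ : ℕ∞) (px n) :=
  contDiff_rad.mul (Real.contDiff_cos.comp (contDiff_const.mul contDiff_id))

theorem contDiff_qx : ContDiff ℝ (⊤ : ℕ∞) (qx n) :=
  contDiff_rad.mul (Real.contDiff_sin.comp (contDiff_const.mul contDiff_id))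

/-- The velocity of the base curve in a frame that turns at the rate `turns n + 1`. -/
noncomputable def reducedVelocity (n : ℕ) (x : ℝ) : ℂ :=
  (((radDeriv n x : ℝ) : ℂ) + (rad n x * turns n : ℝ) * Complex.I) *
    Complex.exp ((-x : ℝ) * Complex.I)

theorem velocity_eq (x : ℝ) : ((deriv (px n) x : ℝ) : ℂ) + (deriv (qx n) x : ℝ) * Complex.I =
    reducedVelocity n x * Complex.exp (((turns n + 1) * x : ℝ) * Complex.I) := by
  rw [reducedVelocity, mul_assoc, ← Complex.exp_add, (hasDerivAt_px x).deriv,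
    (hasDerivAt_qx x).deriv]
  have : ((-x : ℝ) : ℂ) * Complex.I + (((turns n + 1) * x : ℝ) : ℂ) * Complex.I =
      ((turns n * x : ℝ) : ℂ) * Complex.I := by push_cast; ring
  rw [this]
  apply Complex.ext <;>
  simp only [Complex.mul_re, Complex.mul_im, Complex.add_re, Complex.add_im, Complex.ofReal_re,
    Complex.ofReal_im, Complex.I_re, Complex.I_im, Complex.exp_ofReal_mul_I_re,
    Complex.exp_ofReal_mul_I_im] <;> ring

theorem reducedVelocity_add_pi (x : ℝ) :
    reducedVelocity n (x + Real.pi) = reducedVelocity n x := by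
  have h : radDeriv n (x + Real.pi) = -radDeriv n x := by
    have h1 : HasDerivAt (fun y => rad n (y + Real.pi)) (radDeriv n (x + Real.pi)) x :=
      (hasDerivAt_rad (x + Real.pi)).comp_add_const x Real.pi
    have h2 : (fun y => rad n (y + Real.pi)) = fun y => -rad n y := funext rad_add_pi
    rw [h2] at h1
    exact h1.unique (hasDerivAt_rad x).neg
  have e : Complex.exp (((-(x + Real.pi) : ℝ) : ℂ) * Complex.I) =
      -Complex.exp (((-x : ℝ) : ℂ) * Complex.I) := by
    rw [← Complex.exp_sub_pi_mul_I]
    congr 1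
    push_cast
    ring
  rw [reducedVelocity, h, rad_add_pi, e, reducedVelocity]
  push_cast
  ring

theorem reducedVelocity_re (x : ℝ) : (reducedVelocity n x).re =
    radDeriv n x * Real.cos x + rad n x * turns n * Real.sin x := by
  simp only [reducedVelocity, Complex.mul_re, Complex.mul_im, Complex.add_re, Complex.add_im,
    Complex.ofReal_re, Complex.ofReal_im, Complex.I_re, Complex.I_im, Complex.exp_ofReal_mul_I_re,
    Complex.exp_ofReal_mul_I_im, Real.cos_neg, Real.sin_neg]
  ring

theorem reducedVelocity_im (x : ℝ) : (reducedVelocity n x).im =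
    -(radDeriv n x * Real.sin x) + rad n x * turns n * Real.cos x := by
  simp only [reducedVelocity, Complex.mul_re, Complex.mul_im, Complex.add_re, Complex.add_im,
    Complex.ofReal_re, Complex.ofReal_im, Complex.I_re, Complex.I_im, Complex.exp_ofReal_mul_I_re,
    Complex.exp_ofReal_mul_I_im, Real.cos_neg, Real.sin_neg]
  ring

theorem oddStep_mul_nonneg (x : ℝ) : 0 ≤ oddStep x * x := by
  rcases le_total 0 x with h | h
  · exact mul_nonneg (oddStep_nonneg h) h
  · have h1 := monotone_oddStep h
    rw [oddStep_zero] at h1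
    exact mul_nonneg_of_nonpos_of_nonpos h1 h

/-- Suppose that the imaginary part vanishes and the real part is nonpositive. Away from the
crossing the term `9 T |sin x|` dominates `(T - 1) sin x cos x`. In the crossing, `sin x cos x ≥ 0`
leaves only `sin x = 0`, where the imaginary part is `T`. If `sin x cos x < 0`, vanishing of the
imaginary part makes the real part equal to `r' / cos x`, which is positive. -/
theorem reducedVelocity_mem_slitPlane (hn : 1 ≤ n) (x : ℝ) :
    reducedVelocity n x ∈ Complex.slitPlane := by
  by_contra hcon
  rw [Complex.mem_slitPlane_iff, not_or, not_lt, not_not, reducedVelocity_re,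
    reducedVelocity_im] at hcon
  obtain ⟨hre, him⟩ := hcon
  have hT : 3 ≤ turns n := by
    have : (1 : ℝ) ≤ n := by exact_mod_cast hn
    unfold turns; linarith
  have hd := sin_gap_pos n
  have hd1 := Real.sin_le_one (gap n)
  have hsc := Real.sin_sq_add_cos_sq x
  have hσ := oddStep_mul_nonneg (Real.sin x / Real.sin (gap n))
  have hσ' := deriv_oddStep_nonneg (Real.sin x / Real.sin (gap n))
  have hσ1 : Real.sin (gap n) ≤ |Real.sin x| →
      oddStep (Real.sin x / Real.sin (gap n)) * Real.sin x = |Real.sin x| := by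
    intro h
    rcases le_abs.1 h with h | h
    · rw [oddStep_of_one_le (by rwa [one_le_div hd]), abs_of_nonneg (by linarith), one_mul]
    · rw [oddStep_of_le_neg_one (by rw [div_le_iff₀ hd]; linarith), abs_of_nonpos (by linarith)]
      ring
  have hs0 : Real.sin x = 0 → oddStep (Real.sin x / Real.sin (gap n)) = 0 := by
    intro h; rw [h, zero_div, oddStep_zero]
  unfold radDeriv rad at hre him
  rw [← mul_div_assoc] at hσ
  have hσ := (div_nonneg_iff.1 hσ).resolve_right (by rintro ⟨-, h⟩; linarith)
  replace hσ := hσ.1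
  set d := Real.sin (gap n)
  set s := Real.sin x
  set c := Real.cos x
  set σ := oddStep (s / d)
  set σ' := deriv oddStep (s / d)
  set T := turns n
  have hre2 : 9 * (σ' * c ^ 2 / d) + 9 * T * (σ * s) + (T - 1) * (s * c) ≤ 0 := by
    refine le_of_eq_of_le ?_ hre
    ring
  have h1 : 0 ≤ σ' * c ^ 2 / d := by positivity
  have h2 : 0 ≤ T * (σ * s) := mul_nonneg (by linarith) hσ
  by_cases hs : d ≤ |s|
  · have h3 : |s * c| ≤ |s| := by
      rw [abs_mul]
      exact mul_le_of_le_one_right (abs_nonneg _) (Real.abs_cos_le_one x)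
    have h4 := neg_le_of_abs_le h3
    rw [hσ1 hs] at hre2
    nlinarith
  · have hc : c ≠ 0 := by
      intro hc
      apply hs
      have : 1 ≤ |s| := by
        rw [← one_le_sq_iff_one_le_abs]
        nlinarith
      linarith
    rcases le_or_gt 0 (s * c) with h | h
    · have h3 : s * c = 0 := by nlinarith
      have hs' := (mul_eq_zero.1 h3).resolve_right hc
      rw [hs0 hs', hs'] at him
      rw [hs'] at hsc
      nlinarith
    · have hk : 0 < (9 * (σ' * (c / d)) - s) / c := by
        have : (9 * (σ' * (c / d)) - s) / c = 9 * (σ' / d) + (-(s * c)) / c ^ 2 := by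
          field_simp
          ring
        rw [this]
        have : 0 < -(s * c) / c ^ 2 := div_pos (by linarith) (by positivity)
        positivity
      have h5 : (9 * (σ' * (c / d)) - s) * c + (9 * σ + c) * T * s =
          (9 * (σ' * (c / d)) - s) / c := by
        rw [eq_div_iff hc]
        linear_combination s * him + (9 * (σ' * (c / d)) - s) * hsc
      linarith

/-- The angle of the base curve at time `t`. -/
noncomputable def angle (t : ℝ) : ℝ := Real.pi * t + Real.pi / 2

theorem angle_add_one (t : ℝ) : angle (t + 1) = angle t + Real.pi := by
  unfold angle; ring

theorem hasDerivAt_angle (t : ℝ) : HasDerivAt angle Real.pi t := by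
  have h : HasDerivAt (fun t => Real.pi * t) Real.pi t := by
    simpa using (hasDerivAt_id t).const_mul Real.pi
  exact h.add_const (Real.pi / 2)

theorem contDiff_angle : ContDiff ℝ (⊤ : ℕ∞) angle :=
  (contDiff_const.mul contDiff_id).add contDiff_const

theorem continuous_radDeriv : Continuous (radDeriv n) := by
  have := continuous_deriv_oddStep
  unfold radDeriv
  fun_prop

/-- In the frame turning at rate `turns n + 1` the velocity avoids the negative real axis and is
periodic, so it contributes no turns. Over a period the frame turns by `(2n + 2)π`. -/
theorem hasWinding_base (hn : 1 ≤ n) :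
    HasWinding (fun t => ((deriv (px n) (angle t) : ℝ) : ℂ) +
      (deriv (qx n) (angle t) : ℝ) * Complex.I) (n + 1) := by
  have hc : Continuous fun t => reducedVelocity n (angle t) := by
    have h1 := continuous_radDeriv (n := n)
    have h2 := (contDiff_rad (n := n)).continuous
    have h3 := contDiff_angle.continuous
    unfold reducedVelocity
    fun_prop
  have hw := fun t => reducedVelocity_mem_slitPlane hn (angle t)
  refine ⟨fun t => (turns n + 1) * angle t + Complex.arg (reducedVelocity n (angle t)), ?_,
    fun t => ?_, ?_⟩
  · refine (continuous_const.mul contDiff_angle.continuous).add (continuous_iff_continuousAt.2 fun t => ?_)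
    exact ContinuousAt.comp (f := fun t => reducedVelocity n (angle t))
      (Complex.continuousAt_arg (hw t)) hc.continuousAt
  · beta_reduce
    rw [velocity_eq]
    refine ⟨mul_ne_zero (Complex.slitPlane_ne_zero (hw t)) (Complex.exp_ne_zero _), ?_⟩
    rw [norm_mul, Complex.norm_exp_ofReal_mul_I, mul_one]
    conv_lhs => rw [← Complex.norm_mul_exp_arg_mul_I (reducedVelocity n (angle t))]
    rw [mul_assoc, ← Complex.exp_add]
    congr 2
    push_cast
    ring
  · have h : angle 1 = angle 0 + Real.pi := by
      rw [← angle_add_one]; norm_num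
    beta_reduce
    rw [h, reducedVelocity_add_pi]
    unfold turns
    push_cast
    ring

end base

/-! ### The area enclosed after squashing to a rectangle -/

section area

variable {n : ℕ}

theorem px_sq_add_qx_sq (x : ℝ) : px n x ^ 2 + qx n x ^ 2 = rad n x ^ 2 := by
  unfold px qx
  linear_combination rad n x ^ 2 * Real.cos_sq_add_sin_sq (turns n * x)

theorem hasDerivAt_oddStep_qx (x : ℝ) : HasDerivAt (fun y => oddStep (qx n y - 3))
    (deriv oddStep (qx n x - 3) * deriv (qx n) x) x :=
  hasDerivAt_oddStep_comp ((contDiff_qx.differentiable (by simp) x).hasDerivAt.sub_const 3)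

theorem continuous_deriv_oddStep_qx :
    Continuous fun x => deriv oddStep (qx n x - 3) * deriv (qx n) x := by
  have h1 := continuous_deriv_oddStep
  have h2 := (contDiff_qx (n := n)).continuous
  have h3 := (contDiff_qx (n := n)).continuous_deriv (by simp)
  fun_prop

theorem continuous_stepForm : Continuous fun x => oddStep (px n x) *
    (deriv oddStep (qx n x - 3) * deriv (qx n) x) :=
  (contDiff_oddStep.continuous.comp contDiff_px.continuous).mul continuous_deriv_oddStep_qx

/-- The derivative of the second step is supported in `2 < qx < 4`; there the first step is the
constant `σ`, so the integrand is an exact derivative. -/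
theorem integral_stepForm {a b σ : ℝ} (hab : a ≤ b) (hσ : σ = 1 ∨ σ = -1)
    (h : ∀ x, a ≤ x → x ≤ b → 2 < qx n x → qx n x < 4 → 1 ≤ σ * px n x) :
    ∫ x in a..b, oddStep (px n x) * (deriv oddStep (qx n x - 3) * deriv (qx n) x) =
      σ * (oddStep (qx n b - 3) - oddStep (qx n a - 3)) := by
  have e : ∀ x ∈ Set.uIcc a b, oddStep (px n x) *
      (deriv oddStep (qx n x - 3) * deriv (qx n) x) =
      σ * (deriv oddStep (qx n x - 3) * deriv (qx n) x) := by
    intro x hx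
    rw [Set.uIcc_of_le hab] at hx
    by_cases hq : 1 ≤ |qx n x - 3|
    · rw [deriv_oddStep_eq_zero hq]; ring
    · rw [not_le, abs_lt] at hq
      have := h x hx.1 hx.2 (by linarith) (by linarith)
      congr 1
      rcases hσ with rfl | rfl
      · exact oddStep_of_one_le (by linarith)
      · exact oddStep_of_le_neg_one (by linarith)
  rw [intervalIntegral.integral_congr e, intervalIntegral.integral_const_mul,
    intervalIntegral.integral_eq_sub_of_hasDerivAt (fun x _ => hasDerivAt_oddStep_qx x)
      (continuous_deriv_oddStep_qx.intervalIntegrable _ _)]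

/-- The `j`-th quarter point of the base curve, where it is vertical. -/
noncomputable def quarter (n j : ℕ) : ℝ := (Real.pi / 2 + Real.pi * j) / turns n

theorem turns_mul_quarter (j : ℕ) : turns n * quarter n j = Real.pi / 2 + j * Real.pi := by
  have := turns_pos n
  unfold quarter
  field_simp

theorem gap_le_quarter_zero : gap n ≤ quarter n 0 := by
  have := turns_pos n
  have h3 := Real.pi_gt_three
  unfold quarter gap
  rw [← div_div]
  gcongr
  simp
  linarith

theorem quarter_mono {i j : ℕ} (h : i ≤ j) : quarter n i ≤ quarter n j := by
  have := turns_pos n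
  have hpi := Real.pi_pos
  unfold quarter
  gcongr

theorem quarter_last : quarter n (2 * n) = Real.pi - quarter n 0 := by
  have := turns_pos n
  unfold quarter
  field_simp
  unfold turns
  push_cast
  ring

theorem sq_rad_of_mem {x : ℝ} (h1 : gap n ≤ x) (h2 : x ≤ Real.pi - gap n) :
    8 ≤ rad n x ∧ 64 ≤ px n x ^ 2 + qx n x ^ 2 := by
  have h : 8 ≤ rad n x := by
    rw [rad_of_mem h1 h2]
    linarith [Real.neg_one_le_cos x]
  refine ⟨h, ?_⟩
  rw [px_sq_add_qx_sq]
  nlinarith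

theorem oddStep_qx_quarter {j : ℕ} (hj : j ≤ 2 * n) :
    oddStep (qx n (quarter n j) - 3) = (-1) ^ j := by
  have h0 := gap_le_quarter_zero (n := n)
  have h1 := quarter_mono (n := n) j.zero_le
  have h2 := quarter_mono (n := n) hj
  rw [quarter_last] at h2
  have h := (sq_rad_of_mem (h0.trans h1) (by linarith)).1
  rw [qx, turns_mul_quarter, Real.sin_add_nat_mul_pi, Real.sin_pi_div_two, mul_one]
  rcases neg_one_pow_eq_or ℝ j with h' | h' <;> rw [h']
  · exact oddStep_of_one_le (by linarith)
  · exact oddStep_of_le_neg_one (by linarith)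

theorem integral_half_turn {j : ℕ} (hj : j + 1 ≤ 2 * n) :
    ∫ x in (quarter n j)..(quarter n (j + 1)), oddStep (px n x) *
      (deriv oddStep (qx n x - 3) * deriv (qx n) x) = 2 := by
  have h0 := gap_le_quarter_zero (n := n)
  have h1 := quarter_mono (n := n) j.zero_le
  have h2 := quarter_mono (n := n) hj
  rw [quarter_last] at h2
  rw [integral_stepForm (σ := -(-1) ^ j) (quarter_mono (by omega)) ?_ ?_,
    oddStep_qx_quarter hj, oddStep_qx_quarter (by omega)]
  · rcases neg_one_pow_eq_or ℝ j with h' | h' <;> rw [pow_succ, h'] <;> norm_num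
  · rcases neg_one_pow_eq_or ℝ j with h' | h' <;> rw [h'] <;> norm_num
  · intro x hx1 hx2 hq1 hq2
    obtain ⟨h8, h64⟩ := sq_rad_of_mem (n := n) (x := x) (by linarith) (by linarith)
    have hT := turns_pos n
    have hc : 0 ≤ -(-1) ^ j * Real.cos (turns n * x) := by
      have e : turns n * x = (turns n * x - Real.pi - j * Real.pi) + Real.pi + j * Real.pi := by ring
      have b1 := mul_le_mul_of_nonneg_left hx1 hT.le
      have b2 := mul_le_mul_of_nonneg_left hx2 hT.le
      rw [turns_mul_quarter] at b1 b2
      push_cast at b2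
      have hc := Real.cos_nonneg_of_mem_Icc (x := turns n * x - Real.pi - j * Real.pi)
        ⟨by linarith, by linarith⟩
      rw [e, Real.cos_add_nat_mul_pi, Real.cos_add_pi]
      have : ((-1 : ℝ) ^ j) * (-1) ^ j = 1 := by rw [← mul_pow]; norm_num
      nlinarith
    have hp : 0 ≤ -(-1) ^ j * px n x := by
      unfold px
      have := mul_nonneg (show 0 ≤ rad n x by linarith) hc
      linarith
    have hs : (-(-1) ^ j * px n x) ^ 2 = px n x ^ 2 := by
      rcases neg_one_pow_eq_or ℝ j with h' | h' <;> rw [h'] <;> ring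
    nlinarith

/-- The crossing segment stays below the window `2 < qx < 4`. This is why the step in `qx` is
centred at 3 and not at 0: the window lies in the upper half disc, which the curve encircles `n + 1`
times, whereas it encircles the lower half only `n` times. -/
theorem abs_qx_lt {x : ℝ} (h : |x| ≤ gap n) : |qx n x| < 1 := by
  have h1 : |turns n * x| ≤ 1 / 20 := by
    rw [abs_mul, abs_of_pos (turns_pos n), ← turns_mul_gap n]
    exact mul_le_mul_of_nonneg_left h (turns_pos n).le
  have h2 := (Real.abs_sin_le_abs (x := turns n * x)).trans h1
  rw [qx, abs_mul]
  calc |rad n x| * |Real.sin (turns n * x)| ≤ 10 * (1 / 20) := by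
        gcongr
        exact abs_rad_le x
    _ < 1 := by norm_num

theorem cos_turns_nonneg {x : ℝ} (h : |x| ≤ quarter n 0) : 0 ≤ Real.cos (turns n * x) := by
  rw [abs_le] at h
  have b1 := mul_le_mul_of_nonneg_left h.1 (turns_pos n).le
  have b2 := mul_le_mul_of_nonneg_left h.2 (turns_pos n).le
  have := turns_mul_quarter (n := n) 0
  refine Real.cos_nonneg_of_mem_Icc ⟨?_, ?_⟩ <;> push_cast at this <;> linarith

theorem quarter_zero_lt : quarter n 0 + gap n < Real.pi := by
  have hpi := Real.pi_gt_three
  have h1 := turns_mul_quarter (n := n) 0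
  have h2 := one_le_turns n
  have h3 := gap_le n
  have h4 : 0 ≤ quarter n 0 := (gap_pos n).le.trans gap_le_quarter_zero
  push_cast at h1
  nlinarith

/-- The curve descends through the window on the left, crosses the disc below it, and rises on the
right; each passage contributes 2. With 2 from each of the other `2n` half turns the total is `4(n +
1)`. -/
theorem integral_last_half_turn :
    ∫ x in (-quarter n 0)..(quarter n 0), oddStep (px n x) *
      (deriv oddStep (qx n x - 3) * deriv (qx n) x) = 4 := by
  have h0 := gap_le_quarter_zero (n := n)
  have hg := gap_pos n
  have h3 := quarter_zero_lt (n := n)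
  have e0 : oddStep (qx n 0 - 3) = -1 := by
    simp only [qx, mul_zero, Real.sin_zero]
    exact oddStep_of_le_neg_one (by norm_num)
  have e1 := oddStep_qx_quarter (n := n) (Nat.zero_le _)
  rw [pow_zero] at e1
  have e2 : oddStep (qx n (-quarter n 0) - 3) = 1 := by
    have h := turns_mul_quarter (n := n) 0
    rw [Nat.cast_zero, zero_mul, add_zero] at h
    rw [qx, mul_neg, h, Real.sin_neg, Real.sin_pi_div_two,
      rad_of_mem_neg (by linarith) (by linarith)]
    refine oddStep_of_one_le ?_
    linarith [Real.cos_le_one (-quarter n 0)]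
  rw [← intervalIntegral.integral_add_adjacent_intervals
    (continuous_stepForm.intervalIntegrable (-quarter n 0) 0)
    (continuous_stepForm.intervalIntegrable 0 (quarter n 0)),
    integral_stepForm (σ := -1) (by linarith) (by simp) ?_,
    integral_stepForm (σ := 1) (by linarith) (by simp) ?_, e0, e1, e2]
  · norm_num
  · intro x hx1 hx2 hq1 hq2
    have hx : gap n ≤ x := by
      by_contra hx
      have := abs_qx_lt (n := n) (x := x) (by rw [abs_of_nonneg hx1]; linarith)
      rw [abs_lt] at this
      linarith
    obtain ⟨h8, h64⟩ := sq_rad_of_mem (n := n) (x := x) hx (by linarith)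
    have hp : 0 ≤ px n x := mul_nonneg (by linarith)
      (cos_turns_nonneg (by rw [abs_of_nonneg hx1]; exact hx2))
    nlinarith
  · intro x hx1 hx2 hq1 hq2
    have hx : x ≤ -gap n := by
      by_contra hx
      have := abs_qx_lt (n := n) (x := x) (by rw [abs_of_nonpos hx2]; linarith)
      rw [abs_lt] at this
      linarith
    have h8 : rad n x ≤ -8 := by
      rw [rad_of_mem_neg (by linarith) hx]
      linarith [Real.cos_le_one x]
    have hp : px n x ≤ 0 := mul_nonpos_of_nonpos_of_nonneg (by linarith)
      (cos_turns_nonneg (by rw [abs_of_nonpos hx2]; linarith))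
    have := px_sq_add_qx_sq (n := n) x
    nlinarith

theorem integral_stepForm_period (a : ℝ) :
    ∫ x in a..(a + Real.pi), oddStep (px n x) *
      (deriv oddStep (qx n x - 3) * deriv (qx n) x) = 4 * (n + 1) := by
  have hper : Function.Periodic (fun x => oddStep (px n x) *
      (deriv oddStep (qx n x - 3) * deriv (qx n) x)) Real.pi := fun x => by
    have h : deriv (qx n) (x + Real.pi) = deriv (qx n) x := by
      rw [← deriv_comp_add_const]
      congr 1
      exact funext periodic_qx
    simp only [periodic_px x, periodic_qx x, h]
  have key : ∀ k, k ≤ 2 * n → ∫ x in (quarter n 0)..(quarter n k), oddStep (px n x) *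
      (deriv oddStep (qx n x - 3) * deriv (qx n) x) = 2 * k := by
    intro k
    induction k with
    | zero => simp
    | succ k ih =>
      intro hk
      rw [← intervalIntegral.integral_add_adjacent_intervals
        (continuous_stepForm.intervalIntegrable (quarter n 0) (quarter n k))
        (continuous_stepForm.intervalIntegrable _ _), ih (by omega), integral_half_turn hk]
      push_cast
      ring
  rw [hper.intervalIntegral_add_eq a (-quarter n 0),
    ← intervalIntegral.integral_add_adjacent_intervals
    (continuous_stepForm.intervalIntegrable (-quarter n 0) (quarter n 0))
    (continuous_stepForm.intervalIntegrable _ _), integral_last_half_turn,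
    show -quarter n 0 + Real.pi = quarter n (2 * n) by rw [quarter_last]; ring, key _ le_rfl]
  push_cast
  ring

end area

/-! ### The base curve in action-angle coordinates -/

/-- The squared radius of the base curve. -/
noncomputable def baseU (n : ℕ) (A μ x : ℝ) : ℝ :=
  A + 11 * μ - (A * oddStep (px n x) + μ * px n x)

/-- The polar angle of the base curve. -/
noncomputable def basePhi (n : ℕ) (B μ x : ℝ) : ℝ :=
  -(B * oddStep (qx n x - 3) + μ * qx n x)

section profile

variable {n : ℕ} (A B μ : ℝ)

theorem contDiff_baseU : ContDiff ℝ (⊤ : ℕ∞) (baseU n A μ) :=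
  contDiff_const.sub ((contDiff_const.mul (contDiff_oddStep.comp contDiff_px)).add
    (contDiff_const.mul contDiff_px))

theorem contDiff_basePhi : ContDiff ℝ (⊤ : ℕ∞) (basePhi n B μ) :=
  ((contDiff_const.mul (contDiff_oddStep.comp (contDiff_qx.sub contDiff_const))).add
    (contDiff_const.mul contDiff_qx)).neg

theorem periodic_baseU : Function.Periodic (baseU n A μ) Real.pi := fun x => by
  rw [baseU, periodic_px, baseU]

theorem periodic_basePhi : Function.Periodic (basePhi n B μ) Real.pi := fun x => by
  rw [basePhi, periodic_qx, basePhi]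

theorem hasDerivAt_baseU (x : ℝ) : HasDerivAt (baseU n A μ)
    (-((A * deriv oddStep (px n x) + μ) * deriv (px n) x)) x := by
  have hp : HasDerivAt (px n) (deriv (px n) x) x :=
    (contDiff_px.differentiable (by simp) x).hasDerivAt
  exact ((((hasDerivAt_oddStep_comp hp).const_mul A).add (hp.const_mul μ)).const_sub
    (A + 11 * μ)).congr_deriv (by ring)

theorem hasDerivAt_basePhi (x : ℝ) : HasDerivAt (basePhi n B μ)
    (-((B * deriv oddStep (qx n x - 3) + μ) * deriv (qx n) x)) x := by
  have hq : HasDerivAt (qx n) (deriv (qx n) x) x :=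
    (contDiff_qx.differentiable (by simp) x).hasDerivAt
  exact (((hasDerivAt_oddStep_comp (hq.sub_const 3)).const_mul B).add
    (hq.const_mul μ)).neg.congr_deriv (by ring)

theorem deriv_comp_angle {f : ℝ → ℝ} (hf : ContDiff ℝ (⊤ : ℕ∞) f) (t : ℝ) :
    deriv (fun t => f (angle t)) t = deriv f (angle t) * Real.pi :=
  ((hf.differentiable (by simp) (angle t)).hasDerivAt.comp t (hasDerivAt_angle t)).deriv

theorem periodic_comp_angle {f : ℝ → ℝ} (hf : Function.Periodic f Real.pi) :
    Function.Periodic (fun t => f (angle t)) 1 := fun t => by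
  simp only [angle_add_one, hf (angle t)]

theorem integral_comp_angle {f : ℝ → ℝ} (hf : Continuous f) :
    ∫ t in (0 : ℝ)..1, f (angle t) * Real.pi = ∫ x in (angle 0)..(angle 0 + Real.pi), f x := by
  rw [← angle_add_one, zero_add]
  exact intervalIntegral.integral_comp_mul_deriv (f := angle) (f' := fun _ => Real.pi)
    (fun t _ => hasDerivAt_angle t) continuousOn_const hf

theorem hasWinding_baseU_basePhi (hn : 1 ≤ n) {A B μ : ℝ} (hA : 0 < A) (hB : 0 < B) (hμ : 0 < μ) :
    HasWinding (fun t => ((deriv (fun t => baseU n A μ (angle t)) t : ℝ) : ℂ) +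
      (deriv (fun t => basePhi n B μ (angle t)) t : ℝ) * Complex.I) (n + 1) := by
  have hpi := Real.pi_pos
  have c0 := continuous_deriv_oddStep
  have c1 := (contDiff_px (n := n)).continuous
  have c2 := (contDiff_qx (n := n)).continuous
  have c3 := contDiff_angle.continuous
  have ha : angle 1 = angle 0 + Real.pi := by rw [← angle_add_one]; norm_num
  have h := (hasWinding_const (z := -1) (by norm_num)).mul ((hasWinding_base hn).rescale
    (a := fun t => Real.pi * (A * deriv oddStep (px n (angle t)) + μ))
    (b := fun t => Real.pi * (B * deriv oddStep (qx n (angle t) - 3) + μ))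
    (by fun_prop) (by fun_prop)
    (fun t => by have := deriv_oddStep_nonneg (px n (angle t)); positivity)
    (fun t => by have := deriv_oddStep_nonneg (qx n (angle t) - 3); positivity)
    (by simp only [ha, periodic_px (angle 0)])
    (by simp only [ha, periodic_qx (angle 0)]))
  rw [zero_add] at h
  convert h using 2 with t
  rw [deriv_comp_angle (contDiff_baseU A μ), deriv_comp_angle (contDiff_basePhi B μ),
    (hasDerivAt_baseU A μ _).deriv, (hasDerivAt_basePhi B μ _).deriv]
  simp only [Complex.add_re, Complex.add_im, Complex.mul_re, Complex.mul_im, Complex.ofReal_re,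
    Complex.ofReal_im, Complex.I_re, Complex.I_im]
  push_cast
  ring

theorem integral_deriv_period {f : ℝ → ℝ} (hf : ContDiff ℝ (⊤ : ℕ∞) f)
    (hp : Function.Periodic f Real.pi) (a : ℝ) : ∫ x in a..(a + Real.pi), deriv f x = 0 := by
  rw [intervalIntegral.integral_eq_sub_of_hasDerivAt
    (fun x _ => (hf.differentiable (by simp) x).hasDerivAt)
    ((hf.continuous_deriv (by simp)).intervalIntegrable _ _), hp, sub_self]

/-- The area enclosed by the base curve. -/
theorem exists_area_base (n : ℕ) : ∃ c₁ c₂ c₃ : ℝ, ∀ A B μ : ℝ,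
    ∫ t in (0 : ℝ)..1, baseU n A μ (angle t) * deriv (fun t => basePhi n B μ (angle t)) t =
      4 * A * B * (n + 1) + μ * (A * c₁ + B * c₂ + μ * c₃) := by
  set a := angle 0
  -- The constants do not involve `A`, `B` or `μ`, so the error vanishes as `μ` tends to 0 with `A`
  -- and `B` bounded.
  refine ⟨∫ x in a..(a + Real.pi), oddStep (px n x) * deriv (qx n) x,
    ∫ x in a..(a + Real.pi), px n x * (deriv oddStep (qx n x - 3) * deriv (qx n) x),
    ∫ x in a..(a + Real.pi), px n x * deriv (qx n) x, fun A B μ => ?_⟩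
  have c0 := continuous_deriv_oddStep
  have c1 := (contDiff_px (n := n)).continuous
  have c2 := (contDiff_qx (n := n)).continuous_deriv (by simp)
  have c3 := continuous_deriv_oddStep_qx (n := n)
  have c4 := (contDiff_basePhi (n := n) B μ).continuous_deriv (by simp)
  have c5 := contDiff_oddStep.continuous
  have c6 := (contDiff_baseU (n := n) A μ).continuous
  have e1 : ∀ t, baseU n A μ (angle t) * deriv (fun t => basePhi n B μ (angle t)) t =
      baseU n A μ (angle t) * deriv (basePhi n B μ) (angle t) * Real.pi := fun t => by
    rw [deriv_comp_angle (contDiff_basePhi B μ)]; ring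
  have e2 : ∀ x, baseU n A μ x * deriv (basePhi n B μ) x =
      (A + 11 * μ) * deriv (basePhi n B μ) x +
      (A * B * (oddStep (px n x) * (deriv oddStep (qx n x - 3) * deriv (qx n) x)) +
      (μ * A * (oddStep (px n x) * deriv (qx n) x) +
      (μ * B * (px n x * (deriv oddStep (qx n x - 3) * deriv (qx n) x)) +
      μ ^ 2 * (px n x * deriv (qx n) x)))) := fun x => by
    rw [(hasDerivAt_basePhi B μ x).deriv, baseU]; ring
  simp_rw [e1]
  rw [integral_comp_angle (f := fun x => baseU n A μ x * deriv (basePhi n B μ) x) (c6.mul c4)]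
  simp_rw [e2]
  rw [intervalIntegral.integral_add, intervalIntegral.integral_add, intervalIntegral.integral_add,
    intervalIntegral.integral_add]
  · simp only [intervalIntegral.integral_const_mul]
    rw [integral_deriv_period (contDiff_basePhi B μ) (periodic_basePhi B μ),
      integral_stepForm_period]
    ring
  all_goals exact Continuous.intervalIntegrable (by fun_prop) _ _

end profile

/-! ### A smooth ramp -/

/-- A primitive of the smooth transition function that vanishes on `(-∞, 0]`. -/
noncomputable def ramp (v : ℝ) : ℝ := ∫ x in (0 : ℝ)..v, Real.smoothTransition x

theorem hasDerivAt_integral {f : ℝ → ℝ} (hf : Continuous f) (a x : ℝ) :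
    HasDerivAt (fun v => ∫ y in a..v, f y) (f x) x :=
  intervalIntegral.integral_hasDerivAt_right (hf.intervalIntegrable _ _)
    (hf.stronglyMeasurableAtFilter _ _) hf.continuousAt

theorem contDiff_integral {f : ℝ → ℝ} (hf : ContDiff ℝ (⊤ : ℕ∞) f) (a : ℝ) :
    ContDiff ℝ (⊤ : ℕ∞) fun v => ∫ y in a..v, f y := by
  rw [contDiff_infty_iff_deriv]
  refine ⟨fun x => (hasDerivAt_integral hf.continuous a x).differentiableAt, ?_⟩
  rwa [funext fun x => (hasDerivAt_integral hf.continuous a x).deriv]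

theorem contDiff_smoothTransition : ContDiff ℝ (⊤ : ℕ∞) Real.smoothTransition :=
  Real.smoothTransition.contDiff

theorem hasDerivAt_ramp (v : ℝ) : HasDerivAt ramp (Real.smoothTransition v) v :=
  hasDerivAt_integral contDiff_smoothTransition.continuous 0 v

theorem contDiff_ramp : ContDiff ℝ (⊤ : ℕ∞) ramp := contDiff_integral contDiff_smoothTransition 0

theorem monotone_ramp : Monotone ramp :=
  monotone_of_deriv_nonneg (fun v => (hasDerivAt_ramp v).differentiableAt) fun v => by
    rw [(hasDerivAt_ramp v).deriv]; exact Real.smoothTransition.nonneg v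

theorem ramp_of_nonpos {v : ℝ} (hv : v ≤ 0) : ramp v = 0 := by
  have e : ∀ x ∈ Set.uIcc 0 v, Real.smoothTransition x = 0 := fun x hx => by
    rw [Set.uIcc_of_ge hv] at hx
    exact Real.smoothTransition.zero_of_nonpos hx.2
  rw [ramp, intervalIntegral.integral_congr e]
  simp

theorem ramp_nonneg (v : ℝ) : 0 ≤ ramp v := by
  rcases le_total v 0 with h | h
  · rw [ramp_of_nonpos h]
  · rw [← ramp_of_nonpos le_rfl]; exact monotone_ramp h

theorem antitone_ramp_sub : Antitone fun v => ramp v - v :=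
  antitone_of_deriv_nonpos
    (fun v => ((hasDerivAt_ramp v).sub (hasDerivAt_id v)).differentiableAt) fun v => by
    have h : HasDerivAt (fun v => ramp v - v) (Real.smoothTransition v - 1) v :=
      (hasDerivAt_ramp v).sub (hasDerivAt_id v)
    rw [h.deriv]
    linarith [Real.smoothTransition.le_one v]

theorem ramp_le {v : ℝ} (hv : 0 ≤ v) : ramp v ≤ v := by
  have := antitone_ramp_sub hv
  simp only [ramp_of_nonpos le_rfl] at this
  linarith

theorem sub_one_le_ramp (v : ℝ) : v - 1 ≤ ramp v := by
  rcases le_total v 1 with h | h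
  · linarith [ramp_nonneg v]
  · have e : ∀ x ∈ Set.uIcc 1 v, Real.smoothTransition x = 1 := fun x hx => by
      rw [Set.uIcc_of_le h] at hx
      exact Real.smoothTransition.one_of_one_le hx.1
    have c := fun a b => contDiff_smoothTransition.continuous.intervalIntegrable
      (μ := MeasureTheory.volume) a b
    have h0 := ramp_nonneg 1
    have h1 : ramp v = ramp 1 + ∫ x in (1 : ℝ)..v, Real.smoothTransition x :=
      (intervalIntegral.integral_add_adjacent_intervals (c 0 1) (c 1 v)).symm
    rw [h1, intervalIntegral.integral_congr e]
    simpa using h0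

theorem deriv_smoothTransition_eq_zero {x : ℝ} (h : x ≤ 0 ∨ 1 ≤ x) :
    deriv Real.smoothTransition x = 0 := by
  rcases h with h | h
  · have : IsLocalMin Real.smoothTransition x := Filter.Eventually.of_forall fun y => by
      simpa only [Real.smoothTransition.zero_of_nonpos h] using Real.smoothTransition.nonneg y
    exact this.deriv_eq_zero
  · have : IsLocalMax Real.smoothTransition x := Filter.Eventually.of_forall fun y => by
      simpa only [Real.smoothTransition.one_of_one_le h] using Real.smoothTransition.le_one y
    exact this.deriv_eq_zero

/-! ### The column and its cut-off -/

/-- A function on the base curve that is large on the column, that is on an interval containing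
the directions from `0` to `π/2`. -/
noncomputable def phase (n : ℕ) (x : ℝ) : ℝ := Real.cos (2 * x - 45 * gap n)

/-- `phase` is centred at `45/2 * gap n`. Modulo `π`, the level `cos (49 gap)` is reached at `-2
gap` and `47 gap`, and `innerLevel` at `-gap` and `46 gap`. Thus the column consists of the crossing
segment and the outermost arc up to polar angle `46/20 = 2.3`, where the curve is back at the far
side. -/
noncomputable def outerLevel (n : ℕ) : ℝ := Real.cos (49 * gap n)

noncomputable def innerLevel (n : ℕ) : ℝ := Real.cos (47 * gap n)

/-- A cut-off function that is `1` on the column. -/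
noncomputable def cut (n : ℕ) (x : ℝ) : ℝ :=
  Real.smoothTransition ((phase n x - outerLevel n) / (innerLevel n - outerLevel n))

theorem exists_sub_mem_Ico (a x : ℝ) :
    ∃ k : ℤ, a ≤ x - k * Real.pi ∧ x - k * Real.pi < a + Real.pi := by
  obtain ⟨k, hk, -⟩ := existsUnique_sub_zsmul_mem_Ico Real.pi_pos x a
  rw [zsmul_eq_mul] at hk
  exact ⟨k, hk.1, hk.2⟩

theorem abs_le_of_cos_le {c y : ℝ} (hc : 0 ≤ c) (hy : |y| ≤ Real.pi)
    (h : Real.cos c ≤ Real.cos y) : |y| ≤ c := by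
  by_contra hcon
  rw [not_le] at hcon
  have := Real.cos_lt_cos_of_nonneg_of_le_pi hc hy hcon
  rw [Real.cos_abs] at this
  linarith

theorem cos_le_cos_of_abs_le {c y : ℝ} (hc : c ≤ Real.pi) (h : |y| ≤ c) :
    Real.cos c ≤ Real.cos y := by
  rw [← Real.cos_abs y]
  exact Real.cos_le_cos_of_nonneg_of_le_pi (abs_nonneg y) hc h

section cut

variable {n : ℕ}

theorem outerLevel_lt_innerLevel : outerLevel n < innerLevel n := by
  have h1 := gap_le n
  have h2 := gap_pos n
  have := Real.pi_gt_three
  exact Real.cos_lt_cos_of_nonneg_of_le_pi (by linarith) (by linarith) (by linarith)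

theorem periodic_phase : Function.Periodic (phase n) Real.pi := fun x => by
  unfold phase
  rw [show 2 * (x + Real.pi) - 45 * gap n = 2 * x - 45 * gap n + 2 * Real.pi by ring,
    Real.cos_add_two_pi]

theorem contDiff_phase : ContDiff ℝ (⊤ : ℕ∞) (phase n) :=
  Real.contDiff_cos.comp ((contDiff_const.mul contDiff_id).sub contDiff_const)

theorem periodic_cut : Function.Periodic (cut n) Real.pi := fun x => by
  rw [cut, periodic_phase, cut]

theorem contDiff_cut : ContDiff ℝ (⊤ : ℕ∞) (cut n) :=
  contDiff_smoothTransition.comp ((contDiff_phase.sub contDiff_const).div_const _)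

theorem cut_of_innerLevel_le {x : ℝ} (h : innerLevel n ≤ phase n x) : cut n x = 1 := by
  refine Real.smoothTransition.one_of_one_le ?_
  rw [one_le_div (sub_pos.2 outerLevel_lt_innerLevel)]
  linarith

theorem cut_of_le_outerLevel {x : ℝ} (h : phase n x ≤ outerLevel n) : cut n x = 0 :=
  Real.smoothTransition.zero_of_nonpos
    (div_nonpos_of_nonpos_of_nonneg (by linarith) (sub_pos.2 outerLevel_lt_innerLevel).le)

theorem cut_nonneg (x : ℝ) : 0 ≤ cut n x := Real.smoothTransition.nonneg _

theorem cut_le_one (x : ℝ) : cut n x ≤ 1 := Real.smoothTransition.le_one _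

theorem deriv_cut_eq_zero {x : ℝ} (h : phase n x ≤ outerLevel n ∨ innerLevel n ≤ phase n x) :
    deriv (cut n) x = 0 := by
  have hd : 0 < innerLevel n - outerLevel n := sub_pos.2 outerLevel_lt_innerLevel
  have h1 : HasDerivAt (cut n) _ x :=
    (contDiff_smoothTransition.differentiable (by simp) _).hasDerivAt.comp x
      ((((contDiff_phase (n := n)).differentiable (by simp) x).hasDerivAt.sub_const
        (outerLevel n)).div_const (innerLevel n - outerLevel n))
  rw [h1.deriv, deriv_smoothTransition_eq_zero, zero_mul]
  rcases h with h | h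
  · exact Or.inl (div_nonpos_of_nonpos_of_nonneg (by linarith) hd.le)
  · exact Or.inr ((one_le_div hd).2 (by linarith))

/-- The cut-off varies only at the two ends of the column, and both lie on the far left, where the
lift vanishes. Hence the cut-off does not disturb the relation between translation and shear. -/
theorem px_le_of_phase {x : ℝ} (h1 : outerLevel n ≤ phase n x) (h2 : phase n x ≤ innerLevel n) :
    px n x ≤ -5 := by
  obtain ⟨k, hk1, hk2⟩ := exists_sub_mem_Ico (45 / 2 * gap n - Real.pi / 2) x
  rw [← periodic_phase.sub_int_mul_eq k] at h1 h2
  rw [← periodic_px.sub_int_mul_eq k]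
  set y := x - k * Real.pi
  have g1 := gap_le n
  have g2 := gap_pos n
  have hpi := Real.pi_gt_d2
  have hpi2 := Real.pi_lt_d2
  have ha : |2 * y - 45 * gap n| ≤ Real.pi := by rw [abs_le]; constructor <;> linarith
  have h3 := abs_le_of_cos_le (by linarith) ha h1
  have h4 : 47 * gap n ≤ |2 * y - 45 * gap n| := by
    by_contra hcon
    rw [not_le] at hcon
    have := Real.cos_lt_cos_of_nonneg_of_le_pi (abs_nonneg _) (by linarith) hcon
    rw [Real.cos_abs] at this
    unfold phase innerLevel at h2
    linarith
  have hT := turns_mul_gap n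
  have hT0 := turns_pos n
  rw [abs_le] at h3
  -- The ends are `[46 gap, 47 gap]`, at polar angles 2.3 to 2.35, and `[-2 gap, -gap]`, where the
  -- direction is nearly 0 but the radius is negative. In both the radius is at least 8 and the
  -- cosine at least `5/8` in absolute value, whence 5.
  rcases le_abs.1 h4 with h5 | h5
  · have b1 : 46 * gap n ≤ y := by linarith
    have b2 : y ≤ 47 * gap n := by linarith
    have hr : 8 ≤ rad n y := by
      rw [rad_of_mem (by linarith) (by linarith)]
      linarith [Real.neg_one_le_cos y]
    have d1 := mul_le_mul_of_nonneg_left b1 hT0.le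
    have d2 := mul_le_mul_of_nonneg_left b2 hT0.le
    have hc := Real.one_sub_sq_div_two_le_cos (x := Real.pi - turns n * y)
    rw [Real.cos_pi_sub] at hc
    have hc2 : Real.cos (turns n * y) ≤ -(5 / 8) := by nlinarith
    unfold px
    nlinarith
  · have b1 : -2 * gap n ≤ y := by linarith
    have b2 : y ≤ -gap n := by linarith
    have hr : rad n y ≤ -8 := by
      rw [rad_of_mem_neg (by linarith) (by linarith)]
      linarith [Real.cos_le_one y]
    have d1 := mul_le_mul_of_nonneg_left b1 hT0.le
    have d2 := mul_le_mul_of_nonneg_left b2 hT0.le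
    have hc := Real.one_sub_sq_div_two_le_cos (x := turns n * y)
    have hc2 : 5 / 8 ≤ Real.cos (turns n * y) := by nlinarith
    unfold px
    nlinarith

/-- The density of the degree one function `turnFn`; it vanishes on the column. -/
noncomputable def turnDensity (n : ℕ) (x : ℝ) : ℝ :=
  Real.smoothTransition (outerLevel n - phase n x)

/-- A function of degree one that is an integer constant on the column. -/
noncomputable def turnFn (n : ℕ) (x : ℝ) : ℝ :=
  (∫ y in (45 / 2 * gap n)..x, turnDensity n y) /
    ∫ y in (45 / 2 * gap n)..(45 / 2 * gap n + Real.pi), turnDensity n y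

theorem contDiff_turnDensity : ContDiff ℝ (⊤ : ℕ∞) (turnDensity n) :=
  contDiff_smoothTransition.comp (contDiff_const.sub contDiff_phase)

theorem periodic_turnDensity : Function.Periodic (turnDensity n) Real.pi := fun x => by
  rw [turnDensity, periodic_phase, turnDensity]

theorem integral_turnDensity_pos :
    0 < ∫ y in (45 / 2 * gap n)..(45 / 2 * gap n + Real.pi), turnDensity n y := by
  have hpi := Real.pi_gt_three
  have g1 := gap_le n
  have g2 := gap_pos n
  refine intervalIntegral.integral_pos (by linarith) contDiff_turnDensity.continuous.continuousOn
    (fun x _ => Real.smoothTransition.nonneg _)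
    ⟨45 / 2 * gap n + Real.pi / 2, ⟨by linarith, by linarith⟩,
      Real.smoothTransition.pos_of_pos ?_⟩
  have e : phase n (45 / 2 * gap n + Real.pi / 2) = -1 := by
    rw [phase, ← Real.cos_pi]
    congr 1
    ring
  rw [e, sub_neg_eq_add, ← neg_lt_iff_pos_add, ← Real.cos_pi]
  exact Real.cos_lt_cos_of_nonneg_of_le_pi (by linarith) le_rfl (by linarith)

theorem contDiff_turnFn : ContDiff ℝ (⊤ : ℕ∞) (turnFn n) :=
  (contDiff_integral contDiff_turnDensity _).div_const _

theorem turnFn_add_pi (x : ℝ) : turnFn n (x + Real.pi) = turnFn n x + 1 := by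
  have c := fun a b => (contDiff_turnDensity (n := n)).continuous.intervalIntegrable
    (μ := MeasureTheory.volume) a b
  rw [turnFn, ← intervalIntegral.integral_add_adjacent_intervals (c _ x) (c _ _),
    periodic_turnDensity.intervalIntegral_add_eq x (45 / 2 * gap n), add_div,
    div_self integral_turnDensity_pos.ne', turnFn]

theorem turnFn_sub_int_mul (x : ℝ) (k : ℤ) : turnFn n (x - k * Real.pi) = turnFn n x - k := by
  have hpi := Real.pi_pos
  have h : Function.Periodic (fun x => turnFn n x - x / Real.pi) Real.pi := fun x => by
    simp only [turnFn_add_pi]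
    field_simp
    ring
  have h1 := h.sub_int_mul_eq (x := x) k
  field_simp at h1
  nlinarith

/-- The density vanishes on the column, and the integral starts at its centre; so the function is 0
on the column and an integer on its translates by multiples of `π`. -/
theorem turnFn_of_outerLevel_le {x : ℝ} (h : outerLevel n ≤ phase n x) :
    (∃ k : ℤ, turnFn n x = k) ∧ deriv (turnFn n) x = 0 := by
  have hpi := Real.pi_gt_three
  have g1 := gap_le n
  have g2 := gap_pos n
  constructor
  · obtain ⟨k, hk1, hk2⟩ := exists_sub_mem_Ico (45 / 2 * gap n - Real.pi / 2) x
    rw [← periodic_phase.sub_int_mul_eq k] at h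
    refine ⟨k, ?_⟩
    have h2 := turnFn_sub_int_mul (n := n) x k
    set y := x - k * Real.pi
    have h3 := abs_le_of_cos_le (by linarith)
      (show |2 * y - 45 * gap n| ≤ Real.pi by rw [abs_le]; constructor <;> linarith) h
    have e : ∀ z ∈ Set.uIcc (45 / 2 * gap n) y, turnDensity n z = 0 := by
      intro z hz
      refine Real.smoothTransition.zero_of_nonpos (sub_nonpos.2 ?_)
      refine cos_le_cos_of_abs_le (by linarith) (le_trans ?_ h3)
      have := Set.abs_sub_left_of_mem_uIcc hz
      rw [show 2 * z - 45 * gap n = 2 * (z - 45 / 2 * gap n) by ring,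
        show 2 * y - 45 * gap n = 2 * (y - 45 / 2 * gap n) by ring, abs_mul, abs_mul]
      gcongr
    have h4 : turnFn n y = 0 := by
      rw [turnFn, intervalIntegral.integral_congr e]
      simp
    linarith
  · have h1 : HasDerivAt (turnFn n) _ x :=
      (hasDerivAt_integral (contDiff_turnDensity (n := n)).continuous (45 / 2 * gap n) x).div_const _
    rw [h1.deriv, turnDensity, Real.smoothTransition.zero_of_nonpos (by linarith), zero_div]

end cut

/-! ### Lifting the column removes the double points -/

/-- The translation of the fibre over a point of the column with squared radius `v`. -/
noncomputable def lift (A μ v : ℝ) : ℝ := μ / 2 * ramp ((2 * A + 16 * μ - v) / μ)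

/-- The shear of the fibre over a point of the column with squared radius `v`. -/
noncomputable def liftSlope (A μ v : ℝ) : ℝ :=
  1 / 2 * Real.smoothTransition ((2 * A + 16 * μ - v) / μ)

section injectivity

variable {n : ℕ}

theorem rad_pos_of_mem {x : ℝ} (h1 : 0 ≤ x) (h2 : x ≤ Real.pi - gap n) : 0 < rad n x := by
  rcases le_total x (gap n) with h | h
  · have := gap_le n
    exact rad_pos h1 (by linarith [Real.pi_gt_three])
  · linarith [(sq_rad_of_mem h h2).1]

theorem sq_rad_eq {x y : ℝ} (hp : px n x = px n y) (hq : qx n x = qx n y) :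
    rad n x ^ 2 = rad n y ^ 2 := by
  rw [← px_sq_add_qx_sq, ← px_sq_add_qx_sq, hp, hq]

theorem exp_turns (x : ℝ) : ((px n x : ℝ) : ℂ) + (qx n x : ℝ) * Complex.I =
    rad n x * Complex.exp ((turns n * x : ℝ) * Complex.I) := by
  rw [px, qx, Complex.exp_ofReal_mul_I]
  push_cast
  ring

/-- The column is embedded: its directions range over an interval of length less than `π`, so even
the line through the origin determines `x`. At radius 0 this fails, but there `x < 0`, where the
radius is strictly increasing. -/
theorem eq_of_mem_column {x y : ℝ} (hx1 : -(3 / 2) * gap n ≤ x) (hx2 : x ≤ 46 * gap n)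
    (hy1 : -(3 / 2) * gap n ≤ y) (hy2 : y ≤ 46 * gap n)
    (hp : px n x = px n y) (hq : qx n x = qx n y) : x = y := by
  have hpi := Real.pi_gt_three
  have g1 := gap_le n
  have g2 := gap_pos n
  have hT := turns_mul_gap n
  have hT0 := turns_pos n
  have bx1 := mul_le_mul_of_nonneg_left hx1 hT0.le
  have bx2 := mul_le_mul_of_nonneg_left hx2 hT0.le
  have by1 := mul_le_mul_of_nonneg_left hy1 hT0.le
  have by2 := mul_le_mul_of_nonneg_left hy2 hT0.le
  have he : (rad n x : ℂ) * Complex.exp ((turns n * x : ℝ) * Complex.I) =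
      rad n y * Complex.exp ((turns n * y : ℝ) * Complex.I) := by
    rw [← exp_turns, ← exp_turns, hp, hq]
  have key : ∀ k : ℤ, turns n * x = turns n * y + k * Real.pi → x = y := by
    intro k hk
    have h1 : (k : ℝ) < 1 := by nlinarith
    have h2 : (-1 : ℝ) < k := by nlinarith
    have h3 : k < 1 := by exact_mod_cast h1
    have h4 : -1 < k := by exact_mod_cast h2
    have h5 : k = 0 := by omega
    rw [h5] at hk
    refine mul_left_cancel₀ hT0.ne' (hk.trans ?_)
    push_cast
    ring
  by_cases h0 : rad n x = 0
  · have h0' : rad n y = 0 := by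
      have := sq_rad_eq hp hq
      rw [h0] at this
      exact pow_eq_zero_iff two_ne_zero |>.1 (by linarith)
    have hx : x < 0 := by
      by_contra hcon
      exact (rad_pos_of_mem (n := n) (not_lt.1 hcon) (by linarith)).ne' h0
    have hy : y < 0 := by
      by_contra hcon
      exact (rad_pos_of_mem (n := n) (not_lt.1 hcon) (by linarith)).ne' h0'
    rcases lt_trichotomy x y with h | h | h
    · have := rad_lt_rad (n := n) (by linarith) h hy.le
      linarith
    · exact h
    · have := rad_lt_rad (n := n) (by linarith) h hx.le
      linarith
  · have h0c : (rad n x : ℂ) ≠ 0 := by exact_mod_cast h0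
    rcases sq_eq_sq_iff_eq_or_eq_neg.1 (sq_rad_eq hp hq) with h | h
    · rw [← h] at he
      obtain ⟨k, hk⟩ := Complex.exp_eq_exp_iff_exists_int.1 (mul_left_cancel₀ h0c he)
      have h1 := congrArg Complex.im hk
      simp at h1
      exact key (2 * k) (by push_cast; linarith)
    · have he2 : Complex.exp ((turns n * x : ℝ) * Complex.I) =
          Complex.exp ((turns n * y : ℝ) * Complex.I + Real.pi * Complex.I) := by
        rw [Complex.exp_add, Complex.exp_pi_mul_I]
        refine mul_left_cancel₀ h0c (he.trans ?_)
        rw [show rad n y = -rad n x by linarith]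
        push_cast
        ring
      obtain ⟨k, hk⟩ := Complex.exp_eq_exp_iff_exists_int.1 he2
      have h1 := congrArg Complex.im hk
      simp at h1
      exact key (2 * k + 1) (by push_cast; linarith)

/-- The spiral part is embedded because its radius `9 + cos x` is strictly decreasing. -/
theorem eq_of_mem_long {x y : ℝ} (hx1 : gap n ≤ x) (hx2 : x ≤ Real.pi - gap n)
    (hy1 : gap n ≤ y) (hy2 : y ≤ Real.pi - gap n)
    (hp : px n x = px n y) (hq : qx n x = qx n y) : x = y := by
  have g2 := gap_pos n
  have h := sq_rad_eq hp hq
  have h1 := (sq_rad_of_mem hx1 hx2).1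
  have h2 := (sq_rad_of_mem hy1 hy2).1
  have h3 : rad n x = rad n y := by
    rw [← sq_eq_sq₀ (by linarith) (by linarith), h]
  rw [rad_of_mem hx1 hx2, rad_of_mem hy1 hy2] at h3
  exact Real.injOn_cos ⟨by linarith, by linarith⟩ ⟨by linarith, by linarith⟩ (by linarith)

/-- The inner end of the spiral continues into the disc: the radius is at most `9 - cos x` in
absolute value, while `9 + cos y > 9 - cos x` because `y < x + π`. -/
theorem sq_rad_lt {x y : ℝ} (hx1 : -(3 / 2) * gap n ≤ x) (hx2 : rad n x ≤ 0)
    (hy1 : gap n ≤ y) (hy2 : y < Real.pi - 3 / 2 * gap n) (hx3 : x ≤ 0) :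
    rad n x ^ 2 < rad n y ^ 2 := by
  have g1 := gap_le n
  have g2 := gap_pos n
  have hpi := Real.pi_gt_three
  have h1 := neg_one_le_oddStep (Real.sin x / Real.sin (gap n))
  have h2 : -9 + Real.cos x ≤ rad n x := by unfold rad; linarith
  have h3 := rad_of_mem hy1 (by linarith)
  have h4 := Real.cos_lt_cos_of_nonneg_of_le_pi (x := y) (y := x + Real.pi)
    (by linarith) (by linarith) (by linarith)
  rw [Real.cos_add_pi] at h4
  nlinarith

theorem mem_column_of_phase {x : ℝ} (h1 : -(3 / 2) * gap n ≤ x)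
    (h2 : x < Real.pi - 3 / 2 * gap n) (h : innerLevel n ≤ phase n x) :
    -gap n ≤ x ∧ x ≤ 46 * gap n := by
  have g1 := gap_le n
  have g2 := gap_pos n
  have hpi := Real.pi_gt_three
  rcases le_total (2 * x - 45 * gap n) Real.pi with h3 | h3
  · have h4 := abs_le_of_cos_le (by linarith)
      (show |2 * x - 45 * gap n| ≤ Real.pi by rw [abs_le]; constructor <;> linarith) h
    rw [abs_le] at h4
    constructor <;> linarith
  · exfalso
    have h4 := Real.cos_lt_cos_of_nonneg_of_le_pi (x := 47 * gap n)
      (y := 2 * Real.pi - (2 * x - 45 * gap n)) (by linarith) (by linarith) (by linarith)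
    rw [Real.cos_two_pi_sub] at h4
    unfold innerLevel phase at h
    linarith

theorem mem_long_of_phase {x : ℝ} (h1 : -(3 / 2) * gap n ≤ x)
    (h2 : x < Real.pi - 3 / 2 * gap n) (h : phase n x < outerLevel n) :
    47 * gap n ≤ x ∧ x ≤ Real.pi - 2 * gap n := by
  have g1 := gap_le n
  have g2 := gap_pos n
  have hpi := Real.pi_gt_three
  unfold outerLevel phase at h
  constructor
  · by_contra hcon
    have := cos_le_cos_of_abs_le (c := 49 * gap n) (y := 2 * x - 45 * gap n) (by linarith)
      (by rw [abs_le]; constructor <;> linarith)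
    linarith
  · by_contra hcon
    have := cos_le_cos_of_abs_le (c := 49 * gap n) (y := 2 * Real.pi - (2 * x - 45 * gap n))
      (by linarith) (by rw [abs_le]; constructor <;> linarith)
    rw [Real.cos_two_pi_sub] at this
    linarith

theorem lt_or_le_of_px {x : ℝ} (h1 : -(3 / 2) * gap n ≤ x) (hp : px n x < 0) :
    (x ≤ 0 ∧ rad n x ≤ 0) ∨ gap n ≤ x := by
  by_contra hcon
  rw [not_or, not_and_or, not_le, not_le, not_le] at hcon
  obtain ⟨h2, h3⟩ := hcon
  have g1 := gap_le n
  have g2 := gap_pos n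
  have hpi := Real.pi_gt_three
  have hT := turns_mul_gap n
  have hT0 := turns_pos n
  have hr : 0 < rad n x := by
    rcases h2 with h2 | h2
    · exact rad_pos_of_mem h2.le (by linarith)
    · exact h2
  have b1 := mul_le_mul_of_nonneg_left h1 hT0.le
  have b2 := mul_le_mul_of_nonneg_left h3.le hT0.le
  have hc := Real.cos_nonneg_of_mem_Icc (x := turns n * x) ⟨by linarith, by linarith⟩
  exact absurd (mul_nonneg hr.le hc) (not_le.2 hp)

theorem strictMono_step {B μ : ℝ} (hB : 0 < B) (hμ : 0 < μ) (c : ℝ) :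
    StrictMono fun q => B * oddStep (q - c) + μ * q := by
  intro x y h
  have h1 := monotone_oddStep (show x - c ≤ y - c by linarith)
  have h2 := mul_le_mul_of_nonneg_left h1 hB.le
  have h3 := mul_lt_mul_of_pos_left h hμ
  linarith

theorem px_eq_of_baseU_eq {A μ : ℝ} (hA : 0 < A) (hμ : 0 < μ) {x y : ℝ}
    (h : baseU n A μ x = baseU n A μ y) : px n x = px n y := by
  unfold baseU at h
  refine (strictMono_step hA hμ 0).injective ?_
  simp only [sub_zero]
  linarith

theorem qx_eq_of_basePhi_eq {B μ : ℝ} (hB : 0 < B) (hμ : 0 < μ) {x y : ℝ}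
    (h : basePhi n B μ x = basePhi n B μ y) : qx n x = qx n y := by
  unfold basePhi at h
  refine (strictMono_step hB hμ 3).injective ?_
  linarith

/-- A sheared point of the column does not meet the other strands of the base curve with the same
first coordinate. -/
theorem basePhi_ne_of_shear {B μ w x y : ℝ} (hB : 0 < B) (hμ : 0 < μ) (hw0 : 0 ≤ w)
    (hw : w ≤ 2 * B) (hx1 : -gap n ≤ x) (hx2 : x ≤ 46 * gap n) (hy1 : 47 * gap n ≤ y)
    (hy2 : y ≤ Real.pi - gap n) (hp : px n x = px n y) (hp5 : |px n x| < 5) :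
    basePhi n B μ x - w ≠ basePhi n B μ y := by
  have g1 := gap_le n
  have g2 := gap_pos n
  have hpi := Real.pi_gt_three
  -- On the crossing segment the unsheared angle is nearly `B`, and shearing by at most `2B` keeps
  -- it above the upper strands, at `-B - 6μ` or less, and below the lower ones, at `B + 6μ` or
  -- more. On the outer arc `qx` exceeds that of any other strand with the same `px`, so the angle
  -- is already smaller and the shear only decreases it.
  unfold basePhi
  intro heq
  rcases le_total x (gap n) with hx | hx
  · have hq := abs_qx_lt (n := n) (abs_le.2 ⟨hx1, hx⟩)
    rw [abs_lt] at hq hp5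
    have h64 := (sq_rad_of_mem (n := n) (x := y) (by linarith) hy2).2
    rw [← hp] at h64
    have h6 : 36 < qx n y ^ 2 := by nlinarith
    rw [oddStep_of_le_neg_one (x := qx n x - 3) (by linarith)] at heq
    rcases le_total 0 (qx n y) with h0 | h0
    · have h7 : 6 < qx n y := by nlinarith
      rw [oddStep_of_one_le (x := qx n y - 3) (by linarith)] at heq
      nlinarith
    · have h7 : qx n y < -6 := by nlinarith
      rw [oddStep_of_le_neg_one (x := qx n y - 3) (by linarith)] at heq
      nlinarith
  · have hT := turns_mul_gap n
    have hT0 := turns_pos n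
    have b1 := mul_le_mul_of_nonneg_left hx hT0.le
    have b2 := mul_le_mul_of_nonneg_left hx2 hT0.le
    have hs := Real.sin_pos_of_pos_of_lt_pi (x := turns n * x) (by linarith) (by linarith)
    have hr := (sq_rad_of_mem (n := n) (x := x) hx (by linarith)).1
    have hr' := (sq_rad_of_mem (n := n) (x := y) (by linarith) hy2).1
    have hlt : rad n y < rad n x := by
      rw [rad_of_mem hx (by linarith), rad_of_mem (by linarith) hy2]
      have := Real.cos_lt_cos_of_nonneg_of_le_pi (x := x) (y := y) (by linarith) (by linarith)
        (by linarith)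
      linarith
    have hqx : 0 < qx n x := mul_pos (by linarith) hs
    have e1 := px_sq_add_qx_sq (n := n) x
    have e2 := px_sq_add_qx_sq (n := n) y
    rw [hp] at e1
    have hq : qx n y < qx n x := by nlinarith
    have := strictMono_step hB hμ 3 hq
    linarith

theorem lift_eq_zero {A μ v : ℝ} (hμ : 0 < μ) (hv : 2 * A + 16 * μ ≤ v) : lift A μ v = 0 := by
  rw [lift, ramp_of_nonpos (div_nonpos_of_nonpos_of_nonneg (by linarith) hμ.le), mul_zero]

theorem liftSlope_eq_zero {A μ v : ℝ} (hμ : 0 < μ) (hv : 2 * A + 16 * μ ≤ v) :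
    liftSlope A μ v = 0 := by
  rw [liftSlope, Real.smoothTransition.zero_of_nonpos
    (div_nonpos_of_nonpos_of_nonneg (by linarith) hμ.le), mul_zero]

theorem liftSlope_nonneg (A μ v : ℝ) : 0 ≤ liftSlope A μ v :=
  mul_nonneg (by norm_num) (Real.smoothTransition.nonneg _)

theorem liftSlope_le (A μ v : ℝ) : liftSlope A μ v ≤ 1 / 2 := by
  have := Real.smoothTransition.le_one ((2 * A + 16 * μ - v) / μ)
  unfold liftSlope
  linarith

theorem le_lift {A μ v : ℝ} (hμ : 0 < μ) (hv : v ≤ 6 * μ) : A ≤ lift A μ v := by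
  have h := sub_one_le_ramp ((2 * A + 16 * μ - v) / μ)
  unfold lift
  have h2 : μ / 2 * ((2 * A + 16 * μ - v) / μ - 1) = (2 * A + 15 * μ - v) / 2 := by
    field_simp
    ring
  have h3 := mul_le_mul_of_nonneg_left h (show 0 ≤ μ / 2 by linarith)
  linarith

theorem baseU_of_le {A μ x : ℝ} (hμ : 0 < μ) (h : px n x ≤ -5) :
    2 * A + 16 * μ ≤ baseU n A μ x := by
  rw [baseU, oddStep_of_le_neg_one (by linarith)]
  nlinarith

theorem baseU_of_ge {A μ x : ℝ} (hμ : 0 < μ) (h : 5 ≤ px n x) : baseU n A μ x ≤ 6 * μ := by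
  rw [baseU, oddStep_of_one_le (by linarith)]
  nlinarith

/-- For `px ≥ 5` the lift is at least `A`, more than the fibres can compensate; for `|px| < 5` the
sheared angles are different. -/
theorem angle_eq_of_column_of_long {A B μ e x y : ℝ} (hμ : 0 < μ) (hB : 0 < B)
    (he0 : e ≤ 0) (he : -(4 * B) ≤ e) (hx1 : -gap n ≤ x) (hx2 : x ≤ 46 * gap n)
    (hy1 : 47 * gap n ≤ y) (hy2 : y ≤ Real.pi - gap n) (hp : px n x = px n y)
    (hp5 : -5 < px n x) (hφ : basePhi n B μ x + liftSlope A μ (baseU n A μ x) * e = basePhi n B μ y)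
    (hR : lift A μ (baseU n A μ x) < A) : False := by
  have h5 : px n x < 5 := by
    by_contra hcon
    exact absurd (le_lift (A := A) hμ (baseU_of_ge hμ (not_lt.1 hcon))) (not_le.2 hR)
  have h1 := liftSlope_nonneg A μ (baseU n A μ x)
  have h2 := liftSlope_le A μ (baseU n A μ x)
  refine basePhi_ne_of_shear (w := -(liftSlope A μ (baseU n A μ x) * e)) hB hμ (by nlinarith)
    (by nlinarith) hx1 hx2 hy1 hy2 hp (abs_lt.2 ⟨hp5, h5⟩) ?_
  linarith

/-- The parameter on the base curve is determined modulo `π`. -/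
theorem exists_eq_add_int_mul_pi {A B μ e x y : ℝ} (hA : 0 < A) (hB : 0 < B) (hμ : 0 < μ)
    (he0 : e ≤ 0) (he : -(4 * B) ≤ e) (hu : baseU n A μ x = baseU n A μ y)
    (hφ : basePhi n B μ x + cut n x * liftSlope A μ (baseU n A μ x) * e =
      basePhi n B μ y + cut n y * liftSlope A μ (baseU n A μ y) * e)
    (hR : |cut n x * lift A μ (baseU n A μ x) - cut n y * lift A μ (baseU n A μ y)| < A) :
    ∃ k : ℤ, x = y + k * Real.pi := by
  -- The fundamental interval starts at `-3/2 gap`, in the middle of a cut-off interval, so that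
  -- neither the column nor the long part is split.
  obtain ⟨k, hk1, hk2⟩ := exists_sub_mem_Ico (-(3 / 2) * gap n) x
  obtain ⟨l, hl1, hl2⟩ := exists_sub_mem_Ico (-(3 / 2) * gap n) y
  suffices h : x - k * Real.pi = y - l * Real.pi from ⟨k - l, by push_cast; linarith⟩
  rw [← (periodic_baseU A μ).sub_int_mul_eq k, ← (periodic_baseU A μ).sub_int_mul_eq (x := y) l,
    ← periodic_cut.sub_int_mul_eq k, ← periodic_cut.sub_int_mul_eq (x := y) l] at hR hφ
  rw [← (periodic_baseU A μ).sub_int_mul_eq k, ← (periodic_baseU A μ).sub_int_mul_eq (x := y) l]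
    at hu
  rw [← (periodic_basePhi B μ).sub_int_mul_eq k,
    ← (periodic_basePhi B μ).sub_int_mul_eq (x := y) l] at hφ
  replace hk2 : x - k * Real.pi < Real.pi - 3 / 2 * gap n := by linarith
  replace hl2 : y - l * Real.pi < Real.pi - 3 / 2 * gap n := by linarith
  generalize x - k * Real.pi = x at *
  generalize y - l * Real.pi = y at *
  have g1 := gap_le n
  have g2 := gap_pos n
  have hpi := Real.pi_gt_three
  have hp := px_eq_of_baseU_eq hA hμ hu
  -- For `px ≤ -5` there is no shear, and the embeddedness of the plane curve on that side is used.
  -- For `px > -5` the cut-off is 0 or 1, and only a point of the column paired with one of the long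
  -- part needs the lift or the shear.
  rcases le_or_gt (px n x) (-5) with h5 | h5
  · rw [liftSlope_eq_zero hμ (baseU_of_le hμ h5),
      liftSlope_eq_zero hμ (baseU_of_le hμ (hp ▸ h5))] at hφ
    have hq : qx n x = qx n y := qx_eq_of_basePhi_eq hB hμ (by linarith)
    have hr := sq_rad_eq hp hq
    rcases lt_or_le_of_px hk1 (by linarith) with ⟨hx, hx'⟩ | hx <;>
    rcases lt_or_le_of_px hl1 (by linarith) with ⟨hy, hy'⟩ | hy
    · exact eq_of_mem_column hk1 (by linarith) hl1 (by linarith) hp hq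
    · exact absurd hr (sq_rad_lt hk1 hx' hy hl2 hx).ne
    · exact absurd hr (sq_rad_lt hl1 hy' hx hk2 hy).ne'
    · exact eq_of_mem_long hx (by linarith) hy (by linarith) hp hq
  · have hph : ∀ z, -5 < px n z → phase n z < outerLevel n ∨ innerLevel n < phase n z := by
      intro z hz
      by_contra hcon
      rw [not_or, not_lt, not_lt] at hcon
      linarith [px_le_of_phase hcon.1 hcon.2]
    rcases hph x h5 with hx | hx <;> rcases hph y (hp ▸ h5) with hy | hy
    · rw [cut_of_le_outerLevel hx.le, cut_of_le_outerLevel hy.le] at hφ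
      have hq : qx n x = qx n y := qx_eq_of_basePhi_eq hB hμ (by linarith)
      obtain ⟨a1, a2⟩ := mem_long_of_phase hk1 hk2 hx
      obtain ⟨b1, b2⟩ := mem_long_of_phase hl1 hl2 hy
      exact eq_of_mem_long (by linarith) (by linarith) (by linarith) (by linarith) hp hq
    · exfalso
      rw [cut_of_le_outerLevel hx.le, cut_of_innerLevel_le hy.le] at hφ hR
      obtain ⟨a1, a2⟩ := mem_long_of_phase hk1 hk2 hx
      obtain ⟨b1, b2⟩ := mem_column_of_phase hl1 hl2 hy.le
      refine angle_eq_of_column_of_long hμ hB he0 he b1 b2 a1 (by linarith) hp.symm (hp ▸ h5)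
        (by linarith) ?_
      rw [abs_lt] at hR
      linarith
    · exfalso
      rw [cut_of_le_outerLevel hy.le, cut_of_innerLevel_le hx.le] at hφ hR
      obtain ⟨a1, a2⟩ := mem_long_of_phase hl1 hl2 hy
      obtain ⟨b1, b2⟩ := mem_column_of_phase hk1 hk2 hx.le
      refine angle_eq_of_column_of_long hμ hB he0 he b1 b2 a1 (by linarith) hp h5 (by linarith) ?_
      rw [abs_lt] at hR
      linarith
    · rw [cut_of_innerLevel_le hx.le, cut_of_innerLevel_le hy.le, hu] at hφ
      have hq : qx n x = qx n y := qx_eq_of_basePhi_eq hB hμ (by linarith)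
      obtain ⟨a1, a2⟩ := mem_column_of_phase hk1 hk2 hx.le
      obtain ⟨b1, b2⟩ := mem_column_of_phase hl1 hl2 hy.le
      exact eq_of_mem_column (by linarith) a2 (by linarith) b2 hp hq

end injectivity

/-! ### Translation and shear along the base curve -/

/-- The translation of the fibres along the base curve. -/
noncomputable def shift (n : ℕ) (A μ x : ℝ) : ℝ := cut n x * lift A μ (baseU n A μ x)

/-- The shear of the fibres along the base curve. -/
noncomputable def shear (n : ℕ) (A μ x : ℝ) : ℝ := cut n x * liftSlope A μ (baseU n A μ x)

section shift

variable {n : ℕ} {A B μ : ℝ}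

theorem contDiff_lift : ContDiff ℝ (⊤ : ℕ∞) (lift A μ) :=
  contDiff_const.mul (contDiff_ramp.comp ((contDiff_const.sub contDiff_id).div_const _))

theorem contDiff_liftSlope : ContDiff ℝ (⊤ : ℕ∞) (liftSlope A μ) :=
  contDiff_const.mul
    (contDiff_smoothTransition.comp ((contDiff_const.sub contDiff_id).div_const _))

theorem contDiff_shift : ContDiff ℝ (⊤ : ℕ∞) (shift n A μ) :=
  contDiff_cut.mul (contDiff_lift.comp (contDiff_baseU A μ))

theorem contDiff_shear : ContDiff ℝ (⊤ : ℕ∞) (shear n A μ) :=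
  contDiff_cut.mul (contDiff_liftSlope.comp (contDiff_baseU A μ))

theorem periodic_shift : Function.Periodic (shift n A μ) Real.pi := fun x => by
  rw [shift, periodic_cut, periodic_baseU, shift]

theorem periodic_shear : Function.Periodic (shear n A μ) Real.pi := fun x => by
  rw [shear, periodic_cut, periodic_baseU, shear]

theorem hasDerivAt_lift (hμ : 0 < μ) (v : ℝ) : HasDerivAt (lift A μ) (-liftSlope A μ v) v := by
  have h : HasDerivAt (lift A μ) _ v := ((hasDerivAt_ramp _).comp v
    (((hasDerivAt_id v).const_sub (2 * A + 16 * μ)).div_const μ)).const_mul (μ / 2)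
  refine h.congr_deriv ?_
  simp only [liftSlope, id]
  field_simp

theorem cut_transition (x : ℝ) : deriv (cut n) x = 0 ∨ px n x ≤ -5 := by
  by_cases h : phase n x ≤ outerLevel n ∨ innerLevel n ≤ phase n x
  · exact Or.inl (deriv_cut_eq_zero h)
  · rw [not_or, not_le, not_le] at h
    exact Or.inr (px_le_of_phase h.1.le h.2.le)

theorem hasDerivAt_cut (x : ℝ) : HasDerivAt (cut n) (deriv (cut n) x) x :=
  (contDiff_cut.differentiable (by simp) x).hasDerivAt

/-- The slope of `lift` is `-liftSlope`, and the term with the derivative of the cut-off vanishes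
because the lift is zero where the cut-off varies. -/
theorem deriv_shift (hμ : 0 < μ) (x : ℝ) :
    deriv (shift n A μ) x = -(shear n A μ x * deriv (baseU n A μ) x) := by
  have h : HasDerivAt (shift n A μ) _ x := (hasDerivAt_cut x).mul
    ((hasDerivAt_lift hμ _).comp x (hasDerivAt_baseU A μ x))
  rw [h.deriv, (hasDerivAt_baseU A μ x).deriv, shear]
  rcases cut_transition (n := n) x with h0 | h0
  · rw [h0]; ring
  · rw [lift_eq_zero hμ (baseU_of_le hμ h0)]; ring

/-- Where the cut-off is locally irrelevant, the shear is a function of `u` alone up to a constant,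
so it is critical wherever `u` is. -/
theorem deriv_shear (hμ : 0 < μ) {x : ℝ} (hx : deriv (baseU n A μ) x = 0) :
    deriv (shear n A μ) x = 0 := by
  have h : HasDerivAt (shear n A μ) _ x := (hasDerivAt_cut x).mul
    (((contDiff_liftSlope (A := A) (μ := μ)).differentiable (by simp) _).hasDerivAt.comp x
      ((contDiff_baseU A μ).differentiable (by simp) x).hasDerivAt)
  rw [h.deriv, hx]
  rcases cut_transition (n := n) x with h0 | h0
  · rw [h0]; ring
  · rw [liftSlope_eq_zero hμ (baseU_of_le hμ h0)]; ring

theorem shift_shear_eq_zero {x : ℝ} (hx : phase n x < outerLevel n) :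
    shift n A μ x = 0 ∧ shear n A μ x = 0 ∧ deriv (shift n A μ) x = 0 ∧
      deriv (shear n A μ) x = 0 := by
  have h : ∀ᶠ y in nhds x, phase n y < outerLevel n :=
    ((contDiff_phase (n := n)).continuous.tendsto x).eventually_lt_const hx
  have h1 : shift n A μ =ᶠ[nhds x] fun _ => 0 := h.mono fun y hy => by
    rw [shift, cut_of_le_outerLevel hy.le, zero_mul]
  have h2 : shear n A μ =ᶠ[nhds x] fun _ => 0 := h.mono fun y hy => by
    rw [shear, cut_of_le_outerLevel hy.le, zero_mul]
  exact ⟨h1.eq_of_nhds, h2.eq_of_nhds, by rw [h1.deriv_eq, deriv_const],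
    by rw [h2.deriv_eq, deriv_const]⟩

/-- Time 0 corresponds to `x = π/2`, off the column, so the first generator is an untranslated and
unsheared fibre. Here `n ≥ 1` makes the column short enough. -/
theorem phase_angle_zero (hn : 1 ≤ n) : phase n (angle 0) < outerLevel n := by
  have hT : 3 ≤ turns n := by
    have : (1 : ℝ) ≤ n := by exact_mod_cast hn
    unfold turns
    linarith
  have h1 := turns_mul_gap n
  have h2 := gap_pos n
  have h3 : gap n ≤ 1 / 60 := by nlinarith
  have hpi := Real.pi_gt_three
  unfold phase outerLevel angle
  rw [mul_zero, zero_add, mul_div_cancel₀ _ two_ne_zero]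
  exact Real.cos_lt_cos_of_nonneg_of_le_pi (by linarith) (by linarith) (by linarith)

theorem abs_px_le (x : ℝ) : |px n x| ≤ 10 := by
  rw [px, abs_mul]
  nlinarith [abs_rad_le (n := n) x, Real.abs_cos_le_one (turns n * x), abs_nonneg (rad n x),
    abs_nonneg (Real.cos (turns n * x))]

theorem abs_qx_le (x : ℝ) : |qx n x| ≤ 10 := by
  rw [qx, abs_mul]
  nlinarith [abs_rad_le (n := n) x, Real.abs_sin_le_one (turns n * x), abs_nonneg (rad n x),
    abs_nonneg (Real.sin (turns n * x))]

theorem baseU_mem (hA : 0 < A) (hμ : 0 < μ) (x : ℝ) :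
    μ ≤ baseU n A μ x ∧ baseU n A μ x ≤ 2 * A + 21 * μ := by
  have h1 := abs_le.1 (abs_px_le (n := n) x)
  have h2 := oddStep_le_one (px n x)
  have h3 := neg_one_le_oddStep (px n x)
  unfold baseU
  constructor <;> nlinarith

theorem abs_basePhi_le (hB : 0 < B) (hμ : 0 < μ) (x : ℝ) : |basePhi n B μ x| ≤ B + 10 * μ := by
  have h1 := abs_le.1 (abs_qx_le (n := n) x)
  have h2 := oddStep_le_one (qx n x - 3)
  have h3 := neg_one_le_oddStep (qx n x - 3)
  unfold basePhi
  rw [abs_le]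
  constructor <;> nlinarith

theorem lift_nonneg (hμ : 0 < μ) (v : ℝ) : 0 ≤ lift A μ v :=
  mul_nonneg (by linarith) (ramp_nonneg _)

theorem shift_nonneg (hμ : 0 < μ) (x : ℝ) : 0 ≤ shift n A μ x :=
  mul_nonneg (cut_nonneg x) (lift_nonneg hμ _)

theorem shear_nonneg (x : ℝ) : 0 ≤ shear n A μ x :=
  mul_nonneg (cut_nonneg x) (liftSlope_nonneg _ _ _)

theorem shear_le (x : ℝ) : shear n A μ x ≤ 1 / 2 :=
  (mul_le_of_le_one_left (liftSlope_nonneg _ _ _) (cut_le_one x)).trans (liftSlope_le _ _ _)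

/-- The translation is at most `(2A + 16μ - u)/2` where this is positive, and 0 otherwise. The slope
`1/2` is exactly that of the boundary of `E(2, 4)` in the `(W, Z)` quadrant. -/
theorem shift_add_baseU_le (hA : 0 < A) (hμ : 0 < μ) (x : ℝ) :
    shift n A μ x + baseU n A μ x / 2 ≤ A + 11 * μ := by
  have h1 : shift n A μ x ≤ lift A μ (baseU n A μ x) :=
    mul_le_of_le_one_left (lift_nonneg hμ _) (cut_le_one x)
  rcases le_total (2 * A + 16 * μ) (baseU n A μ x) with h | h
  · rw [lift_eq_zero hμ h] at h1
    linarith [(baseU_mem (n := n) hA hμ x).2]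
  · have h2 := mul_le_mul_of_nonneg_left (ramp_le (div_nonneg (sub_nonneg.2 h) hμ.le))
      (show 0 ≤ μ / 2 by linarith)
    have h3 : μ / 2 * ((2 * A + 16 * μ - baseU n A μ x) / μ) =
        (2 * A + 16 * μ - baseU n A μ x) / 2 := by field_simp
    unfold lift at h1
    linarith

end shift

/-! ### The winding torus and the choice of parameters -/

/-- Half the height of the fibre curve, up to the factor `1 + μ`. -/
noncomputable def halfHeight (B μ : ℝ) : ℝ := 2 * B / (1 + μ)

/-- Half the width of the fibre curve, up to the factor `1 + μ`; the curve bounds area one. -/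
noncomputable def halfWidth (B μ : ℝ) : ℝ := 1 / (halfHeight B μ * fibreArea μ)

theorem halfHeight_pos {B μ : ℝ} (hB : 0 < B) (hμ : 0 < μ) : 0 < halfHeight B μ := by
  unfold halfHeight
  positivity

theorem halfWidth_pos {B μ : ℝ} (hB : 0 < B) (hμ : 0 < μ) : 0 < halfWidth B μ := by
  have h1 := halfHeight_pos hB hμ
  have h2 := four_le_fibreArea hμ
  unfold halfWidth
  positivity

theorem two_mul_halfWidth_le {B μ : ℝ} (hB : 0 < B) (hμ : 0 < μ) :
    2 * halfWidth B μ * (1 + μ) ≤ (1 + μ) ^ 2 / (4 * B) := by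
  have h1 := halfHeight_pos hB hμ
  have h2 := four_le_fibreArea hμ
  have h3 : halfWidth B μ ≤ 1 / (halfHeight B μ * 4) := by
    unfold halfWidth
    gcongr
  calc 2 * halfWidth B μ * (1 + μ) ≤ 2 * (1 / (halfHeight B μ * 4)) * (1 + μ) := by gcongr
    _ = (1 + μ) ^ 2 / (4 * B) := by
      unfold halfHeight
      field_simp

theorem fibreY_sub_mem {B μ : ℝ} (hB : 0 < B) (hμ : 0 < μ) (s : ℝ) :
    -(4 * B) ≤ fibreY μ 0 (halfHeight B μ) s - fibreY μ 0 (halfHeight B μ) 0 ∧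
      fibreY μ 0 (halfHeight B μ) s - fibreY μ 0 (halfHeight B μ) 0 ≤ 0 := by
  have h := fibreY_mem 0 hμ (halfHeight_pos hB hμ) s
  have e : halfHeight B μ * (1 + μ) = 2 * B := by
    unfold halfHeight
    field_simp
  rw [e] at h
  rw [fibreY_zero, e]
  constructor <;> linarith [h.1, h.2]

theorem fibreX_mem_halfWidth {B μ : ℝ} (hB : 0 < B) (hμ : 0 < μ) (s : ℝ) :
    μ ≤ fibreX μ (μ + halfWidth B μ * (1 + μ)) (halfWidth B μ) s ∧
      fibreX μ (μ + halfWidth B μ * (1 + μ)) (halfWidth B μ) s ≤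
        μ + 2 * halfWidth B μ * (1 + μ) := by
  have h := fibreX_mem (μ + halfWidth B μ * (1 + μ)) hμ (halfWidth_pos hB hμ) s
  constructor <;> linarith [h.1, h.2]

theorem abs_shear_mul_le {n : ℕ} {A B μ e : ℝ} (hB : 0 < B) (he : -(4 * B) ≤ e) (he0 : e ≤ 0)
    (x : ℝ) : -(2 * B) ≤ shear n A μ x * e ∧ shear n A μ x * e ≤ 0 := by
  have h1 := shear_nonneg (n := n) (A := A) (μ := μ) x
  have h2 := shear_le (n := n) (A := A) (μ := μ) x
  constructor <;> nlinarith

/-- The suspension torus over the base curve with `n` additional turns. -/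
noncomputable def windingTorus (n : ℕ) (A B μ : ℝ) (hn : 1 ≤ n) (hA : 0 < A) (hB : 0 < B)
    (hμ : 0 < μ) (hL : 2 * halfWidth B μ * (1 + μ) < A) (hBμ : 4 * B + 20 * μ < 1) :
    Suspension where
  ξ := fibreX μ (μ + halfWidth B μ * (1 + μ)) (halfWidth B μ)
  η := fibreY μ 0 (halfHeight B μ)
  u t := baseU n A μ (angle t)
  φ t := basePhi n B μ (angle t)
  R t := shift n A μ (angle t)
  κ t := shear n A μ (angle t)
  g t := turnFn n (angle t)
  -- The base contributes `n + 1` turns, and `n` fibre classes are subtracted.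
  m := -n
  N := n + 1
  β := fibrePhase μ (halfWidth B μ) (halfHeight B μ)
  contDiff_ξ := contDiff_fibreX _ _ _
  contDiff_η := contDiff_fibreY _ _ _
  contDiff_u := (contDiff_baseU A μ).comp contDiff_angle
  contDiff_φ := (contDiff_basePhi B μ).comp contDiff_angle
  contDiff_R := contDiff_shift.comp contDiff_angle
  contDiff_κ := contDiff_shear.comp contDiff_angle
  contDiff_g := contDiff_turnFn.comp contDiff_angle
  periodic_ξ := periodic_fibreX _ _ _
  periodic_η := periodic_fibreY _ _ _
  periodic_u := periodic_comp_angle (periodic_baseU A μ)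
  periodic_φ := periodic_comp_angle (periodic_basePhi B μ)
  periodic_R := periodic_comp_angle periodic_shift
  periodic_κ := periodic_comp_angle periodic_shear
  g_add_one t := by rw [angle_add_one, turnFn_add_pi]
  pos_ξ s t := by
    have h1 := (fibreX_mem_halfWidth hB hμ s).1
    have h2 := shift_nonneg (n := n) (A := A) hμ (angle t)
    linarith
  pos_u t := hμ.trans_le (baseU_mem hA hμ (angle t)).1
  rel t := by
    rw [deriv_comp_angle (contDiff_baseU A μ), deriv_comp_angle contDiff_shift, deriv_shift hμ]
    ring
  flat t := by
    rw [deriv_comp_angle contDiff_turnFn, deriv_comp_angle contDiff_shift,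
      deriv_comp_angle contDiff_shear]
    rcases le_or_gt (outerLevel n) (phase n (angle t)) with h | h
    · obtain ⟨h1, h2⟩ := turnFn_of_outerLevel_le h
      exact Or.inl ⟨h1, by rw [h2, zero_mul]⟩
    · obtain ⟨h1, h2, h3, h4⟩ := shift_shear_eq_zero (A := A) (μ := μ) h
      exact Or.inr ⟨h1, h2, by rw [h3, zero_mul], by rw [h4, zero_mul]⟩
  flat_zero := by
    rw [deriv_comp_angle contDiff_shift, deriv_comp_angle contDiff_shear]
    obtain ⟨h1, h2, h3, h4⟩ := shift_shear_eq_zero (A := A) (μ := μ) (phase_angle_zero hn)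
    exact ⟨h1, h2, by rw [h3, zero_mul], by rw [h4, zero_mul]⟩
  deriv_κ t h := by
    rw [deriv_comp_angle (contDiff_baseU A μ)] at h
    rw [deriv_comp_angle contDiff_shear,
      deriv_shear hμ ((mul_eq_zero.1 h).resolve_right Real.pi_pos.ne'), zero_mul]
  deriv_η_zero := by
    rw [deriv_fibreY]
    simp
  continuous_β := continuous_fibrePhase hμ (halfWidth_pos hB hμ) (halfHeight_pos hB hμ)
  periodic_β := periodic_fibrePhase _ _ _
  fibre := fibre_phase _ _ hμ (halfWidth_pos hB hμ) (halfHeight_pos hB hμ)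
  base := hasWinding_baseU_basePhi hn hA hB hμ
  sum_eq := by ring
  η_range s s' := by
    have h1 := fibreY_sub_mem hB hμ s
    have h2 := fibreY_sub_mem hB hμ s'
    rw [abs_lt]
    constructor <;> linarith [h1.1, h1.2, h2.1, h2.2]
  φ_range s t s' t' := by
    have h1 := fibreY_sub_mem hB hμ s
    have h2 := fibreY_sub_mem hB hμ s'
    have h3 := abs_shear_mul_le (n := n) (A := A) (μ := μ) hB h1.1 h1.2 (angle t)
    have h4 := abs_shear_mul_le (n := n) (A := A) (μ := μ) hB h2.1 h2.2 (angle t')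
    have h5 := abs_le.1 (abs_basePhi_le (n := n) hB hμ (angle t))
    have h6 := abs_le.1 (abs_basePhi_le (n := n) hB hμ (angle t'))
    rw [abs_lt]
    constructor <;> linarith [h3.1, h3.2, h4.1, h4.2, h5.1, h5.2, h6.1, h6.2]
  inj s t s' t' h1 h2 h3 h4 := by
    have hpi := Real.pi_pos
    have he := fibreY_sub_mem hB hμ s'
    have hs := fibreX_mem_halfWidth hB hμ s
    have hs' := fibreX_mem_halfWidth hB hμ s'
    rw [h2] at h4
    -- Equal `Z` bounds the difference of the translations by the width of the fibre, which is less
    -- than `A`.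
    have hR : |shift n A μ (angle t) - shift n A μ (angle t')| < A := by
      rw [abs_lt]
      constructor <;> linarith [hs.1, hs.2, hs'.1, hs'.2]
    obtain ⟨k, hk⟩ := exists_eq_add_int_mul_pi hA hB hμ he.2 he.1 h3 h4 hR
    have ht : t = t' + k := by
      unfold angle at hk
      exact mul_left_cancel₀ hpi.ne' (by linarith)
    rw [hk, periodic_shift.int_mul k (angle t')] at h1
    exact ⟨fibre_inj hμ (halfWidth_pos hB hμ) (halfHeight_pos hB hμ) (by linarith) h2, k, ht⟩
  area_fibre := by
    have h1 := halfHeight_pos hB hμ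
    have h2 := four_le_fibreArea hμ
    rw [integral_fibre, halfWidth]
    field_simp

/-- The region of the ellipsoid `E(2, 4)` cut off at `π |w|² = 2`, slightly enlarged. -/
def cutEllipsoid (ε : ℝ) : Set (ℂ × ℂ) :=
  {p | Real.pi * ‖p.1‖ ^ 2 / 2 + Real.pi * ‖p.2‖ ^ 2 / 4 ≤ 1 + ε ∧
    Real.pi * ‖p.2‖ ^ 2 ≤ 2 * (1 + ε)}

theorem windingTorus_map_mem {n : ℕ} {A B μ : ℝ} (hn : 1 ≤ n) (hA : 0 < A) (hB : 0 < B)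
    (hμ : 0 < μ) (hL : 2 * halfWidth B μ * (1 + μ) < A) (hBμ : 4 * B + 20 * μ < 1) {ε : ℝ}
    (h1 : 2 * A + 21 * μ ≤ 2 * (1 + ε)) (p : ℝ × ℝ) :
    (windingTorus n A B μ hn hA hB hμ hL hBμ).map p ∈ cutEllipsoid ε := by
  set D := windingTorus n A B μ hn hA hB hμ hL hBμ
  have e1 : Real.pi * ‖(D.map p).1‖ ^ 2 = D.ξ (D.S p) + D.R p.2 :=
    pi_mul_norm_polarPoint_sq (D.Z_pos p).le _
  have e2 : Real.pi * ‖(D.map p).2‖ ^ 2 = D.u p.2 :=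
    pi_mul_norm_polarPoint_sq (D.W_pos p).le _
  have h2 : D.ξ (D.S p) ≤ μ + 2 * halfWidth B μ * (1 + μ) := (fibreX_mem_halfWidth hB hμ _).2
  have h3 : D.R p.2 + D.u p.2 / 2 ≤ A + 11 * μ := shift_add_baseU_le hA hμ _
  have h4 : D.u p.2 ≤ 2 * A + 21 * μ := (baseU_mem hA hμ _).2
  refine ⟨?_, ?_⟩
  · rw [e1, e2]
    linarith
  · rw [e2]
    linarith

/-- The parameters of the winding torus can be chosen such that it is close to `E(2, 4)`. -/
theorem exists_parameters {y ε : ℝ} (hy : 0 < y) {n : ℕ} (hn : y / (n + 1) < ε)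
    (c₁ c₂ c₃ : ℝ) : ∃ A B μ : ℝ, 0 < A ∧ 0 < B ∧ 0 < μ ∧ (1 + μ) ^ 2 / (4 * B) < A ∧
      4 * B + 20 * μ < 1 ∧ 2 * A + 21 * μ ≤ 2 * (1 + ε) ∧
      4 * A * B * (n + 1) + μ * (A * c₁ + B * c₂ + μ * c₃) = n + 1 + y := by
  have hN : (0 : ℝ) < n + 1 := by positivity
  -- This `B` gives `4B + 20μ = 1 - μ < 1`, and `A` solves the area equation, which is linear in
  -- `A`. At `μ = 0` these are `1/4` and `1 + y/(n + 1)`, where the remaining inequalities are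
  -- strict because `0 < y/(n + 1) < ε`; they persist for small `μ` by continuity.
  set B : ℝ → ℝ := fun μ => (1 - 21 * μ) / 4 with hB
  set E : ℝ → ℝ := fun μ => 4 * B μ * (n + 1) + μ * c₁ with hE
  set A : ℝ → ℝ := fun μ => (n + 1 + y - μ * (B μ * c₂ + μ * c₃)) / E μ with hA
  have cB : Continuous B := by fun_prop
  have cE : Continuous E := by fun_prop
  have B0 : B 0 = 1 / 4 := by simp [hB]
  have E0 : E 0 = n + 1 := by simp only [hE, B0]; ring
  have A0 : A 0 = 1 + y / (n + 1) := by simp only [hA, E0]; field_simp; ring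
  have cA : ContinuousAt A 0 :=
    ContinuousAt.div (by fun_prop) cE.continuousAt (by rw [E0]; exact hN.ne')
  have hyN : 0 < y / (n + 1) := by positivity
  have e1 : ∀ᶠ μ in nhds (0 : ℝ), 0 < B μ :=
    cB.continuousAt.eventually_const_lt (by rw [B0]; norm_num)
  have e2 : ∀ᶠ μ in nhds (0 : ℝ), 0 < E μ :=
    cE.continuousAt.eventually_const_lt (by rw [E0]; exact hN)
  have e3 : ∀ᶠ μ in nhds (0 : ℝ), 0 < A μ :=
    cA.eventually_const_lt (by rw [A0]; linarith)
  have e4 : ∀ᶠ μ in nhds (0 : ℝ), (1 + μ) ^ 2 / (4 * B μ) < A μ := by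
    have h : ContinuousAt (fun μ => (1 + μ) ^ 2 / (4 * B μ)) 0 :=
      ContinuousAt.div (by fun_prop) (by fun_prop) (by rw [B0]; norm_num)
    exact h.eventually_lt cA (by rw [A0, B0]; norm_num; linarith)
  have e5 : ∀ᶠ μ in nhds (0 : ℝ), 2 * A μ + 21 * μ < 2 * (1 + ε) := by
    have h : ContinuousAt (fun μ => 2 * A μ + 21 * μ) 0 := by fun_prop
    exact h.eventually_lt_const (by beta_reduce; rw [A0]; linarith)
  have e6 := (e1.and (e2.and (e3.and (e4.and e5)))).filter_mono
    (nhdsWithin_le_nhds (s := Set.Ioi 0))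
  obtain ⟨μ, ⟨h1, h2, h3, h4, h5⟩, hμ⟩ := (e6.and self_mem_nhdsWithin).exists
  have hμ : 0 < μ := hμ
  refine ⟨A μ, B μ, μ, h3, h1, hμ, h4, by simp only [hB]; linarith, h5.le, ?_⟩
  have h6 : A μ * E μ = n + 1 + y - μ * (B μ * c₂ + μ * c₃) := div_mul_cancel₀ _ h2.ne'
  simp only [hE] at h6
  linear_combination h6

theorem lagrangianTorusEmbeds_cutEllipsoid {y ε : ℝ} (hy : 0 < y) (hε : 0 < ε) :
    LagrangianTorusEmbeds 1 (1 + y) (cutEllipsoid ε) := by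
  obtain ⟨k, hk⟩ := exists_nat_gt (y / ε)
  have hk' : y / ((k + 1 : ℕ) + 1) < ε := by
    push_cast
    rw [div_lt_comm₀ (by positivity) hε]
    linarith
  obtain ⟨c₁, c₂, c₃, hc⟩ := exists_area_base (k + 1)
  obtain ⟨A, B, μ, hA, hB, hμ, hL, hBμ, hε', harea⟩ := exists_parameters hy hk' c₁ c₂ c₃
  have hL' := (two_mul_halfWidth_le hB hμ).trans_lt hL
  have h := (windingTorus (k + 1) A B μ k.succ_pos hA hB hμ hL' hBμ).lagrangianTorusEmbeds
    (windingTorus_map_mem k.succ_pos hA hB hμ hL' hBμ hε')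
  convert h using 1
  change 1 + y = (∫ t in (0 : ℝ)..1, baseU (k + 1) A μ (angle t) *
    deriv (fun t => basePhi (k + 1) B μ (angle t)) t) + ((-(k + 1 : ℕ) : ℤ) : ℝ)
  rw [hc, harea]
  push_cast
  ring

/-! ### Product tori -/

/-- The product of two circles of areas `a` and `b`. -/
noncomputable def productMap (a b : ℝ) : ℝ × ℝ → ℂ × ℂ :=
  toricMap (fun _ => a) Prod.fst (fun _ => b) Prod.snd

section product

variable {a b : ℝ}

theorem productMap_add_int (s t : ℝ) (k l : ℤ) :
    productMap a b (s + k, t + l) = productMap a b (s, t) := by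
  simp only [productMap, toricMap, polarPoint_add_int]

theorem contDiff_productMap (ha : 0 < a) (hb : 0 < b) :
    ContDiff ℝ (⊤ : ℕ∞) (productMap a b) :=
  contDiff_toricMap contDiff_const contDiff_fst contDiff_const contDiff_snd (fun _ => ha)
    fun _ => hb

theorem fderiv_productMap (ha : 0 < a) (hb : 0 < b) (p v : ℝ × ℝ) :
    fderiv ℝ (productMap a b) p v =
      (polarPoint a p.1 * ((2 * Real.pi * v.1 : ℝ) * Complex.I),
        polarPoint b p.2 * ((2 * Real.pi * v.2 : ℝ) * Complex.I)) := by
  rw [productMap, fderiv_toricMap (by fun_prop) (by fun_prop) (by fun_prop) (by fun_prop) ha hb]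
  simp [fderiv_fst, fderiv_snd]

theorem isLagrangianEmbedding_productMap (ha : 0 < a) (hb : 0 < b) :
    IsLagrangianEmbedding (torusDescend (productMap a b)) := by
  have hpi := Real.pi_ne_zero
  refine isLagrangianEmbedding_torusDescend productMap_add_int (contDiff_productMap ha hb)
    (fun s t s' t' h => ?_) (fun p v hv => ?_) fun p v w => ?_
  · exact ⟨(polarPoint_injective ha ha (congrArg Prod.fst h)).2,
      (polarPoint_injective hb hb (congrArg Prod.snd h)).2⟩
  · rw [fderiv_productMap ha hb, Prod.mk_eq_zero] at hv
    have h1 := (mul_eq_zero.1 hv.1).resolve_left (polarPoint_ne_zero ha _)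
    have h2 := (mul_eq_zero.1 hv.2).resolve_left (polarPoint_ne_zero hb _)
    exact Prod.ext (by simpa [hpi] using h1) (by simpa [hpi] using h2)
  · rw [productMap, omegaStd_fderiv_toricMap (by fun_prop) (by fun_prop) (by fun_prop)
      (by fun_prop) ha hb]
    simp

theorem hasWinding_productMap (ha : 0 < a) (hb : 0 < b) {c : ℝ → ℝ × ℝ} (hc : Continuous c)
    {k l : ℤ} (hk : (c 1).1 - (c 0).1 = k) (hl : (c 1).2 - (c 0).2 = l) :
    HasWinding (fun t => complexDet (fderiv ℝ (productMap a b) (c t) (1, 0))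
      (fderiv ℝ (productMap a b) (c t) (0, 1))) (k + l) := by
  have hpi : (Real.pi : ℂ) ≠ 0 := by exact_mod_cast Real.pi_ne_zero
  have h := (hasWinding_const (z := -(2 * Real.pi) ^ 2) (by simp [hpi])).mul
    ((hasWinding_polarPoint (fun _ => ha) (hc.fst) hk).mul
      (hasWinding_polarPoint (fun _ => hb) (hc.snd) hl))
  rw [zero_add] at h
  convert h using 2 with t
  rw [fderiv_productMap ha hb, fderiv_productMap ha hb, complexDet]
  push_cast
  linear_combination (4 * Real.pi ^ 2 * polarPoint a (c t).1 * polarPoint b (c t).2) *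
    Complex.I_sq

theorem maslovClassEq_productMap (ha : 0 < a) (hb : 0 < b) (k : ℤ × ℤ) :
    MaslovClassEq (torusDescend (productMap a b)) k (2 * (k.1 + k.2)) := by
  unfold MaslovClassEq tangentPlane
  rw [torusLift_torusDescend productMap_add_int]
  refine hasMaslovIndex_of_hasWinding (contDiff_productMap ha hb) (c := torusLoop k)
    (by unfold torusLoop; fun_prop) (hasWinding_productMap ha hb (by unfold torusLoop; fun_prop)
      (by simp [torusLoop]) (by simp [torusLoop]))

theorem areaClass_productMap (ha : 0 < a) (hb : 0 < b) (k : ℤ × ℤ) :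
    areaClass (torusDescend (productMap a b)) k = a * k.1 + b * k.2 := by
  have hper : toricMap (fun _ => a) (fun t : ℝ => (k.1 : ℝ) * t) (fun _ => b)
      (fun t : ℝ => (k.2 : ℝ) * t) 1 = toricMap (fun _ => a) (fun t : ℝ => (k.1 : ℝ) * t)
      (fun _ => b) (fun t : ℝ => (k.2 : ℝ) * t) 0 := by
    have h1 := polarPoint_add_int a 0 k.1
    have h2 := polarPoint_add_int b 0 k.2
    simp only [toricMap, mul_one, mul_zero]
    rw [zero_add] at h1 h2
    rw [h1, h2]
  have hd : ∀ c t : ℝ, deriv (fun t => c * t) t = c := fun c t => by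
    simp
  have h := integral_liouvilleStd_toricMap contDiff_const (contDiff_const.mul contDiff_id)
    contDiff_const (contDiff_const.mul contDiff_id) (fun _ => ha) (fun _ => hb) hper
  unfold areaClass
  rw [torusLift_torusDescend productMap_add_int]
  refine h.trans ?_
  simp [hd]

theorem lagrangianTorusEmbeds_productMap (ha : 0 < a) (hb : 0 < b) {X : Set (ℂ × ℂ)}
    (hX : ∀ p, Real.pi * ‖p.1‖ ^ 2 = a → Real.pi * ‖p.2‖ ^ 2 = b → p ∈ X) :
    LagrangianTorusEmbeds a b X := by
  refine ⟨torusDescend (productMap a b), isLagrangianEmbedding_productMap ha hb, ?_,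
    maslovClassEq_productMap ha hb (1, 0), maslovClassEq_productMap ha hb (0, 1), ?_, ?_⟩
  · rintro _ ⟨p, rfl⟩
    exact hX _ (pi_mul_norm_polarPoint_sq ha.le _) (pi_mul_norm_polarPoint_sq hb.le _)
  · rw [areaClass_productMap ha hb]
    simp
  · rw [areaClass_productMap ha hb]
    simp

end product

/-! ### Neighbourhoods, closures and the corollary -/

theorem pi_mul_norm_smul_sq (r : ℝ) (z : ℂ) :
    Real.pi * ‖r • z‖ ^ 2 = r ^ 2 * (Real.pi * ‖z‖ ^ 2) := by
  rw [norm_smul, mul_pow, Real.norm_eq_abs, sq_abs]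
  ring

theorem norm_le_one_of_mem_cutEllipsoid {p : ℂ × ℂ} (hp : p ∈ cutEllipsoid 0) : ‖p‖ ≤ 1 := by
  obtain ⟨h1, h2⟩ := hp
  have hpi := Real.pi_gt_three
  have e1 : 0 ≤ Real.pi * ‖p.1‖ ^ 2 := by positivity
  have e2 : 0 ≤ Real.pi * ‖p.2‖ ^ 2 := by positivity
  rw [Prod.norm_def, max_le_iff]
  have key : ∀ z : ℂ, Real.pi * ‖z‖ ^ 2 ≤ 2 → ‖z‖ ≤ 1 := fun z hz => by
    have := mul_nonneg (show 0 ≤ Real.pi - 3 by linarith) (sq_nonneg ‖z‖)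
    nlinarith [norm_nonneg z]
  exact ⟨key _ (by linarith), key _ (by linarith)⟩

theorem isCompact_cutEllipsoid : IsCompact (cutEllipsoid 0) := by
  refine Metric.isCompact_of_isClosed_isBounded ?_ ?_
  · have h1 : IsClosed
        {p : ℂ × ℂ | Real.pi * ‖p.1‖ ^ 2 / 2 + Real.pi * ‖p.2‖ ^ 2 / 4 ≤ 1 + 0} :=
      isClosed_le (by fun_prop) continuous_const
    have h2 : IsClosed {p : ℂ × ℂ | Real.pi * ‖p.2‖ ^ 2 ≤ 2 * (1 + 0)} :=
      isClosed_le (by fun_prop) continuous_const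
    exact h1.inter h2
  · exact (Metric.isBounded_closedBall (x := (0 : ℂ × ℂ)) (r := 1)).subset fun p hp =>
      mem_closedBall_zero_iff.2 (norm_le_one_of_mem_cutEllipsoid hp)

/-- Both inequalities are homogeneous of degree 2, so the enlarged region is the compact one scaled
by `√(1 + ε)`. -/
theorem exists_cutEllipsoid_subset {U : Set (ℂ × ℂ)} (hU : IsOpen U) (h : cutEllipsoid 0 ⊆ U) :
    ∃ ε > 0, cutEllipsoid ε ⊆ U := by
  obtain ⟨δ, hδ, hδU⟩ := isCompact_cutEllipsoid.exists_thickening_subset_open hU h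
  have hr : 0 < 1 + δ / 2 := by linarith
  -- Scaling by `1 + δ/2` moves points of norm at most 1 by at most `δ/2 < δ`.
  refine ⟨(1 + δ / 2) ^ 2 - 1, by nlinarith, fun p hp => hδU ?_⟩
  set r := 1 + δ / 2 with hrdef
  have e : r⁻¹ ^ 2 * r ^ 2 = 1 := by rw [← mul_pow, inv_mul_cancel₀ hr.ne', one_pow]
  have hq : r⁻¹ • p ∈ cutEllipsoid 0 := by
    obtain ⟨h1, h2⟩ := hp
    have hs : 0 ≤ r⁻¹ ^ 2 := sq_nonneg _
    simp only [cutEllipsoid, Set.mem_ofPred_eq, Prod.smul_fst, Prod.smul_snd, pi_mul_norm_smul_sq]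
    have g1 := mul_le_mul_of_nonneg_left h1 hs
    have g2 := mul_le_mul_of_nonneg_left h2 hs
    constructor <;> linarith
  refine Metric.mem_thickening_iff.2 ⟨r⁻¹ • p, hq, ?_⟩
  have e2 : p = r • (r⁻¹ • p) := by rw [smul_smul, mul_inv_cancel₀ hr.ne', one_smul]
  have h1 := norm_le_one_of_mem_cutEllipsoid hq
  generalize r⁻¹ • p = q at *
  have e3 : p - q = (δ / 2) • q := by rw [e2, hrdef, add_smul, one_smul, add_sub_cancel_left]
  rw [dist_eq_norm, e3, norm_smul, Real.norm_of_nonneg (by linarith)]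
  nlinarith

theorem mem_closure_of_smul_mem {S : Set (ℂ × ℂ)} {p : ℂ × ℂ}
    (h : ∀ r : ℝ, 0 < r → r < 1 → r • p ∈ S) : p ∈ closure S := by
  have ht : Filter.Tendsto (fun r : ℝ => r • p) (nhdsWithin 1 (Set.Iio 1)) (nhds p) := by
    have hc : ContinuousAt (fun r : ℝ => r • p) 1 := by fun_prop
    have := hc.tendsto.mono_left (nhdsWithin_le_nhds (s := Set.Iio 1))
    rwa [one_smul] at this
  refine mem_closure_of_tendsto ht ?_
  filter_upwards [Ioo_mem_nhdsLT (show (0 : ℝ) < 1 by norm_num)] with r hr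
  exact h r hr.1 hr.2

theorem lagrangianTorusEmbeds_of_cutEllipsoid_subset {x : ℝ} (hx : 1 ≤ x) {U : Set (ℂ × ℂ)}
    (hU : IsOpen U) (h : cutEllipsoid 0 ⊆ U) : LagrangianTorusEmbeds 1 x U := by
  -- The winding torus needs a positive excess `x - 1`; for `x = 1` the product torus at `Z = W = 1`
  -- lies in the region.
  rcases hx.eq_or_lt with rfl | hx
  · refine lagrangianTorusEmbeds_productMap one_pos one_pos fun p h1 h2 => h ?_
    simp only [cutEllipsoid, Set.mem_ofPred_eq, h1, h2]
    norm_num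
  · obtain ⟨ε, hε, hεU⟩ := exists_cutEllipsoid_subset hU h
    obtain ⟨f, h1, h2, h3⟩ := lagrangianTorusEmbeds_cutEllipsoid (sub_pos.2 hx) hε
    rw [add_sub_cancel] at h3
    exact ⟨f, h1, h2.trans hεU, h3⟩

theorem cutEllipsoid_subset_closure :
    cutEllipsoid 0 ⊆ closure (ellipsoid 2 4 ∩ {p | Real.pi * ‖p.2‖ ^ 2 < 2}) := by
  rintro p ⟨h1, h2⟩
  refine mem_closure_of_smul_mem fun r h0 hr => ?_
  have hr2 : r ^ 2 < 1 := by nlinarith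
  have hs : 0 ≤ r ^ 2 := sq_nonneg r
  simp only [ellipsoid, Set.mem_inter_iff, Set.mem_ofPred_eq, Prod.smul_fst, Prod.smul_snd,
    pi_mul_norm_smul_sq]
  have g1 := mul_le_mul_of_nonneg_left h1 hs
  have g2 := mul_le_mul_of_nonneg_left h2 hs
  constructor <;> linarith

/-- A linear function on the polygon `Z/2 + W/4 ≤ 1`, `W ≤ 2` is compared with its values at the
vertices `(2, 0)` and `(1, 2)`; on the edge joining them it is the convex combination with weights
`1 - W/2` and `W/2`. -/
theorem div_add_div_le_of_mem_cutEllipsoid {a b : ℝ} (ha : 2 < a) {p : ℂ × ℂ}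
    (hp : p ∈ cutEllipsoid 0) : Real.pi * ‖p.1‖ ^ 2 / a + Real.pi * ‖p.2‖ ^ 2 / b ≤
      max (2 / a) (1 / a + 2 / b) := by
  obtain ⟨h1, h2⟩ := hp
  have e2 : 0 ≤ Real.pi * ‖p.2‖ ^ 2 := by positivity
  generalize Real.pi * ‖p.1‖ ^ 2 = Z at *
  generalize Real.pi * ‖p.2‖ ^ 2 = W at *
  have m1 := le_max_left (2 / a) (1 / a + 2 / b)
  have m2 := le_max_right (2 / a) (1 / a + 2 / b)
  generalize max (2 / a) (1 / a + 2 / b) = M at *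
  have ha' : 0 < a := by linarith
  calc Z / a + W / b ≤ (2 - W / 2) / a + W / b := by gcongr; linarith
    _ = (1 - W / 2) * (2 / a) + W / 2 * (1 / a + 2 / b) := by ring
    _ ≤ (1 - W / 2) * M + W / 2 * M := by
      gcongr
      linarith
    _ = M := by ring

theorem isOpen_ellipsoid (a b : ℝ) : IsOpen (ellipsoid a b) :=
  isOpen_lt (by fun_prop) continuous_const

theorem mainTheorem6 :
    (∀ x : ℝ, 1 ≤ x → ∀ U : Set (ℂ × ℂ), IsOpen U →
      closure (ellipsoid 2 4 ∩ {p | Real.pi * ‖p.2‖ ^ 2 < 2}) ⊆ U →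
      LagrangianTorusEmbeds 1 x U) ∧
    (∀ a b : ℝ, 2 < a → 0 < b → 1 / a + 2 / b ≤ 1 → ∀ x : ℝ, 1 ≤ x →
      (1 / a + 2 / b < 1 ∨ x < 2 → LagrangianTorusEmbeds 1 x (ellipsoid a b)) ∧
      (∀ V : Set (ℂ × ℂ), IsOpen V → closure (ellipsoid a b) ⊆ V →
        LagrangianTorusEmbeds 1 x V)) := by
  refine ⟨fun x hx U hU h => lagrangianTorusEmbeds_of_cutEllipsoid_subset hx hU
    (cutEllipsoid_subset_closure.trans h), fun a b ha hb hab x hx => ⟨?_, fun V hV h =>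
    lagrangianTorusEmbeds_of_cutEllipsoid_subset hx hV (Set.Subset.trans (fun p hp => ?_) h)⟩⟩
  · have h2a : 2 / a < 1 := by rwa [div_lt_one (by linarith)]
    rintro (hlt | hx2)
    · exact lagrangianTorusEmbeds_of_cutEllipsoid_subset hx (isOpen_ellipsoid a b) fun p hp =>
        (div_add_div_le_of_mem_cutEllipsoid ha hp).trans_lt (max_lt h2a hlt)
    -- For `x < 2` the circles of areas 1 and `x` satisfy `1/a + x/b < 1/a + 2/b ≤ 1`, so equality
    -- in the hypothesis is harmless.
    · refine lagrangianTorusEmbeds_productMap one_pos (by linarith) fun p h1 h2 => ?_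
      simp only [ellipsoid, Set.mem_ofPred_eq, h1, h2]
      have : x / b < 2 / b := by gcongr
      linarith
  · have h2a : 2 / a < 1 := by rwa [div_lt_one (by linarith)]
    have hle := (div_add_div_le_of_mem_cutEllipsoid (b := b) ha hp).trans (max_le h2a.le hab)
    refine mem_closure_of_smul_mem fun r h0 hr => ?_
    have hr2 : r ^ 2 < 1 := by nlinarith
    simp only [ellipsoid, Set.mem_ofPred_eq, Prod.smul_fst, Prod.smul_snd, pi_mul_norm_smul_sq]
    rw [mul_div_assoc, mul_div_assoc (r ^ 2), ← mul_add]
    have g1 := mul_le_mul_of_nonneg_left hle (sq_nonneg r)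
    linarith
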